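/- Let $U_q(\mathfrak g)$ be the quantized enveloping algebra over $\mathbb{Q}(q)$ of type $A_1^{(1)}$ (Cartan matrix $(a_{ij})$ with $a_{11}=a_{22}=2$, $a_{12}=a_{21}=-2$), generated by $E_i,F_i,K_i^{\pm1}$ $(i=1,2)$ with the relations $K_iK_j=K_jK_i$, $K_iK_i^{-1}=K_i^{-1}K_i=1$, $K_iE_jK_i^{-1}=q^{a_{ij}}E_j$, $K_iF_jK_i^{-1}=q^{-a_{ij}}F_j$, $E_iF_j-F_jE_i=\delta_{ij}\frac{K_i-K_i^{-1}}{q-q^{-1}}$ and, for $i\neq j$ and $X\in\{E,F\}$, $X_i^3X_j-[3]X_i^2X_jX_i+[3]X_iX_jX_i^2-X_jX_i^3=0$. Here $[k]=\frac{q^k-q^{-k}}{q-q^{-1}}$. Let $T_i$ be Lusztig's automorphism of $U_q(\mathfrak g)$ given by $T_i(E_i)=-K_i^{-1}F_i$, $T_i(F_i)=-E_iK_i$, $T_i(K_j)=K_jK_i^{-a_{ij}}$ and, for $j\ne i$, $T_i(E_j)=\sum_{r+s=2}(-1)^rq^{-r}E_i^{(r)}E_jE_i^{(s)}$, $T_i(F_j)=\sum_{r+s=2}(-1)^rq^{r}F_i^{(s)}F_jF_i^{(r)}$,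 where $X^{(r)}=X^r/([r][r-1]\cdots[1])$. Put $v_0=E_1$, $v_1=T_1(E_2)$, $v_2=T_1T_2(E_1)$, $v_3=T_1T_2T_1(E_2)$ and $u_i=(1-q^{-2})^{-2i}v_i$. Let $U_q^+(w)$, $w=s_1s_2s_1s_2$, be the subalgebra generated by $v_0,v_1,v_2,v_3$. For $\mathbf a=(a_3,a_2,a_1,a_0)\in\mathbb{N}^4$ (with $0\in\mathbb N$) put $$E[\mathbf a]=q^{\binom{a_3}{2}+\binom{a_2}{2}+\binom{a_1}{2}+\binom{a_0}{2}}\,u_3^{a_3}u_2^{a_2}u_1^{a_1}u_0^{a_0},\qquad N(\mathbf a)=(a_3+a_2+a_1+a_0)^2-7a_3-5a_2-3a_1-a_0,$$ and let $S(\mathbf a)$ be the set of all $\mathbf b\in\mathbb{N}^4$ with $\mathbf b\neq\mathbf a$ and $\mathbf b-\mathbf a\in\mathbb{N}(-1,2,-1,0)+\mathbb{N}(0,-1,2,-1)$. Let $\sigma$ be the ring anti-automorphism of $U_q^+(w)$ with $\sigma(q)=q^{-1}$ and $\sigma(u_i)=q^{2i}u_i$ for $0\le i\le3$. There is a unique $\mathbb{Q}(q)$-basis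 $\{B[\mathbf a]:\mathbf a\in\mathbb{N}^4\}$ of $U_q^+(w)$, the dual canonical basis, such that for every $\mathbf a$ $$B[\mathbf a]-E[\mathbf a]\in\bigoplus_{\mathbf b\in S(\mathbf a)}q\mathbb{Z}[q]\,E[\mathbf b]\qquad\text{and}\qquad\sigma(B[\mathbf a])=q^{-N(\mathbf a)}B[\mathbf a].$$ **Corollary 4.4.** For every integer $n\ge1$, \begin{align*} B[n,0,0,n-1]\,B[1,0,0,1]&=q^{3-4n}B[n+1,0,0,n]+q^{4-4n}B[n,1,1,n-1],\\ B[1,0,0,1]\,B[n,0,0,n-1]&=q^{1-4n}B[n+1,0,0,n]+q^{-4n}B[n,1,1,n-1],\\ B[n,0,0,n]\,B[1,0,0,1]&=q^{-4n}B[n+1,0,0,n+1]+q^{-4n}B[n,1,1,n],\\ B[1,0,0,1]\,B[n,0,0,n]&=q^{-4n}B[n+1,0,0,n+1]+q^{-4n}B[n,1,1,n]. \end{align*} Consequently, for every $n\ge1$ the elements $B[n,0,0,n]$ and $B[1,0,0,1]$ commute up to a power of $q$, but their product is not of the form $q^sB[\mathbf a]$ with $s\in\mathbb{Z}$, $\mathbf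 a\in\mathbb{N}^4$. Hence there are infinitely many pairs $(b_1,b_2)$ of elements of the dual canonical basis of $U_q^+(w)$ that violate the conjecture of Berenstein and Zelevinsky that $b_1b_2$ is a power of $q$ times an element of the dual canonical basis if and only if $b_1b_2=q^sb_2b_1$ for some $s\in\mathbb{Z}$. -/

import Mathlib

namespace KroneckerQuantum

noncomputable section

/-- The base field `ℚ(q)`. -/
abbrev Kq : Type := RatFunc ℚ

/-- The deformation parameter `q`. -/
abbrev q : Kq := RatFunc.X

/-- The quantum integer `[k] = (q ^ k - q ^ (-k)) / (q - q⁻¹)`. -/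
def qInt (k : ℤ) : Kq := (q ^ k - q ^ (-k)) / (q - q⁻¹)

/-- The quantum factorial `[k]! = [k] [k-1] ⋯ [1]`. -/
def qFact (k : ℕ) : Kq := ∏ j ∈ Finset.range k, qInt ((j : ℤ) + 1)

/-- The Cartan matrix of type `A₁⁽¹⁾`. The index `0 : Fin 2` stands for the label `1`
and the index `1 : Fin 2` for the label `2`. -/
def cartan : Matrix (Fin 2) (Fin 2) ℤ := !![2, -2; -2, 2]

/-- The generators `E_i, F_i, K_i, K_i⁻¹` of `U_q(𝔤)`. -/
inductive Gen : Type
  | E (i : Fin 2)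
  | F (i : Fin 2)
  | K (i : Fin 2)
  | Kinv (i : Fin 2)

/-- The free algebra over `ℚ(q)` on the generators of `U_q(𝔤)`. -/
abbrev FreeUq : Type := FreeAlgebra Kq Gen

/-- `E_i` as an element of the free algebra. -/
def fE (i : Fin 2) : FreeUq := FreeAlgebra.ι Kq (Gen.E i)
/-- `F_i` as an element of the free algebra. -/
def fF (i : Fin 2) : FreeUq := FreeAlgebra.ι Kq (Gen.F i)
/-- `K_i` as an element of the free algebra. -/
def fK (i : Fin 2) : FreeUq := FreeAlgebra.ι Kq (Gen.K i)
/-- `K_i⁻¹` as an element of the free algebra. -/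
def fKinv (i : Fin 2) : FreeUq := FreeAlgebra.ι Kq (Gen.Kinv i)

/-- The expression `x³ y - [3] x² y x + [3] x y x² - y x³` of the quantized Serre relations. -/
def serre (x y : FreeUq) : FreeUq :=
  x ^ 3 * y - qInt 3 • (x ^ 2 * y * x) + qInt 3 • (x * y * x ^ 2) - y * x ^ 3

/-- The defining relations of `U_q(𝔤)`. -/
inductive Rel : FreeUq → FreeUq → Prop
  | K_comm (i j : Fin 2) : Rel (fK i * fK j) (fK j * fK i)
  | K_mul_Kinv (i : Fin 2) : Rel (fK i * fKinv i) 1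
  | Kinv_mul_K (i : Fin 2) : Rel (fKinv i * fK i) 1
  | K_E (i j : Fin 2) : Rel (fK i * fE j * fKinv i) (q ^ (cartan i j) • fE j)
  | K_F (i j : Fin 2) : Rel (fK i * fF j * fKinv i) (q ^ (-cartan i j) • fF j)
  | E_F_same (i : Fin 2) :
      Rel (fE i * fF i - fF i * fE i) ((q - q⁻¹)⁻¹ • (fK i - fKinv i))
  | E_F_ne (i j : Fin 2) (h : i ≠ j) : Rel (fE i * fF j - fF j * fE i) 0
  | serre_E (i j : Fin 2) (h : i ≠ j) : Rel (serre (fE i) (fE j)) 0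
  | serre_F (i j : Fin 2) (h : i ≠ j) : Rel (serre (fF i) (fF j)) 0

/-- The quantized enveloping algebra `U_q(𝔤)` of type `A₁⁽¹⁾`. -/
abbrev Uqg : Type := RingQuot Rel

/-- The quotient map from the free algebra onto `U_q(𝔤)`. -/
def toUqg : FreeUq →ₐ[Kq] Uqg := RingQuot.mkAlgHom Kq Rel

/-- The divided power `x ^ (r) = x ^ r / [r]!`. -/
def dividedPow (x : FreeUq) (r : ℕ) : FreeUq := (qFact r)⁻¹ • x ^ r

/-- The word representing the integer power `K_i ^ m`. -/
def fKpow (i : Fin 2) (m : ℤ) : FreeUq := fK i ^ m.toNat * fKinv i ^ (-m).toNat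

/-- The formulas for Lusztig's automorphism `T_i` (which is `T'_{i,-1}` in Lusztig's notation)
on the generators. -/
def lusztigTGen (i : Fin 2) : Gen → FreeUq
  | Gen.E j => if j = i then -(fKinv i * fF i) else
      ∑ r ∈ Finset.range 3,
        ((-1) ^ r * q ^ (-(r : ℤ))) • (dividedPow (fE i) r * fE j * dividedPow (fE i) (2 - r))
  | Gen.F j => if j = i then -(fE i * fK i) else
      ∑ r ∈ Finset.range 3,
        ((-1) ^ r * q ^ (r : ℤ)) • (dividedPow (fF i) (2 - r) * fF j * dividedPow (fF i) r)
  | Gen.K j => fK j * fKpow i (-cartan i j)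
  | Gen.Kinv j => fKinv j * fKpow i (cartan i j)

/-- Lusztig's `T_i`, as the endomorphism of the free algebra given by the formulas on the
generators. It induces the automorphism `T_i` of `U_q(𝔤)` on the quotient, so that the class in
`U_q(𝔤)` of `lusztigT i x` is `T_i` applied to the class of `x`. -/
def lusztigT (i : Fin 2) : FreeUq →ₐ[Kq] FreeUq := FreeAlgebra.lift Kq (lusztigTGen i)

/-- The root vectors for the reduced word `s₁ s₂ s₁ s₂`:
`v₀ = E₁`, `v₁ = T₁(E₂)`, `v₂ = T₁(T₂(E₁))`, `v₃ = T₁(T₂(T₁(E₂)))`. -/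
def v : Fin 4 → Uqg :=
  ![toUqg (fE 0),
    toUqg (lusztigT 0 (fE 1)),
    toUqg (lusztigT 0 (lusztigT 1 (fE 0))),
    toUqg (lusztigT 0 (lusztigT 1 (lusztigT 0 (fE 1))))]

/-- The subalgebra `U_q⁺(w)` of `U_q(𝔤)` for `w = s₁ s₂ s₁ s₂`, generated by the root vectors. -/
def UqPlus : Subalgebra Kq Uqg := Algebra.adjoin Kq (Set.range v)

/-- The rescaled (dual) root vectors `u_i = (1 - q⁻²)^(-2i) v_i`. -/
def u (i : Fin 4) : UqPlus :=
  ((1 - q ^ (-2 : ℤ)) ^ (2 * (i : ℕ)))⁻¹ • ⟨v i, Algebra.subset_adjoin ⟨i, rfl⟩⟩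

/-- Index set of the bases; the quadruple `(a₃, a₂, a₁, a₀)` is written in this order. -/
abbrev Idx : Type := ℕ × ℕ × ℕ × ℕ

/-- The norm `N`. -/
def normN : Idx → ℤ
  | (a₃, a₂, a₁, a₀) =>
    ((a₃ : ℤ) + a₂ + a₁ + a₀) ^ 2 - 7 * a₃ - 5 * a₂ - 3 * a₁ - a₀

/-- The partial order `a ⊲ b`: the difference `b - a` lies in
`ℕ (-1, 2, -1, 0) + ℕ (0, -1, 2, -1)`. -/
def idxLE : Idx → Idx → Prop
  | (a₃, a₂, a₁, a₀), (b₃, b₂, b₁, b₀) =>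
    ∃ s r : ℕ, (b₃ : ℤ) = a₃ - s ∧ (b₂ : ℤ) = a₂ + 2 * s - r ∧
      (b₁ : ℤ) = a₁ - s + 2 * r ∧ (b₀ : ℤ) = a₀ - r

/-- The set `S(a)` of the indices strictly above `a`. -/
def idxAbove (a : Idx) : Set Idx := {b | idxLE a b ∧ a ≠ b}

/-- The exponent `b(a)`. -/
def bExp : Idx → ℕ
  | (a₃, a₂, a₁, a₀) => a₃.choose 2 + a₂.choose 2 + a₁.choose 2 + a₀.choose 2

/-- The dual PBW element `E[a] = q ^ b(a) u₃^a₃ u₂^a₂ u₁^a₁ u₀^a₀`. -/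
def dualPBW : Idx → UqPlus
  | (a₃, a₂, a₁, a₀) =>
    q ^ bExp (a₃, a₂, a₁, a₀) • (u 3 ^ a₃ * u 2 ^ a₂ * u 1 ^ a₁ * u 0 ^ a₀)

/-- `σ` is the ring anti-automorphism of `U_q⁺(w)` with `σ(q) = q⁻¹` and
`σ(u_i) = q^(2i) u_i`. These values determine `σ`. -/
def IsSigma (σ : UqPlus ≃+* UqPlusᵐᵒᵖ) : Prop :=
  (σ (algebraMap Kq UqPlus q)).unop = algebraMap Kq UqPlus q⁻¹ ∧
  ∀ i : Fin 4, (σ (u i)).unop = q ^ (2 * (i : ℕ)) • u i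

/-- `B` is the dual canonical basis of `U_q⁺(w)`: for every `a`, the difference `B[a] - E[a]` is a
combination of the `E[b]`, `b ∈ S(a)`, with coefficients in `q ℤ[q]`, and
`σ(B[a]) = q ^ (-N(a)) B[a]`. -/
def IsDualCanonicalBasis (B : Module.Basis Idx Kq UqPlus) : Prop :=
  ∃ σ : UqPlus ≃+* UqPlusᵐᵒᵖ, IsSigma σ ∧ ∀ a : Idx,
    (∃ c : Idx →₀ Polynomial ℤ, (∀ b ∈ c.support, b ∈ idxAbove a) ∧
      (∀ b, Polynomial.X ∣ c b) ∧
      B a - dualPBW a = c.sum fun b p => Polynomial.aeval q p • dualPBW b) ∧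
    (σ (B a)).unop = q ^ (-normN a) • B a

/-- `x` and `y` commute up to a power of `q`. -/
def QCommute (x y : UqPlus) : Prop := ∃ s : ℤ, x * y = q ^ s • (y * x)

/-- The pair `(x, y)` is a counterexample to the conjecture of Berenstein and Zelevinsky
(the product of two elements of the dual canonical basis is a power of `q` times an element of the
dual canonical basis if and only if the two elements `q`-commute). -/
def IsBZCounterexample (B : Module.Basis Idx Kq UqPlus) (x y : UqPlus) : Prop :=
  x ∈ Set.range B ∧ y ∈ Set.range B ∧
    ¬ ((∃ (s : ℤ) (a : Idx), x * y = q ^ s • B a) ↔ QCommute x y)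

end

end KroneckerQuantum

/-! Everything is reduced to computation with six relations between `u 0`, ..., `u 3`. Put w = E₂E₁
- q⁻²E₁E₂, an imaginary root vector. The root vectors are the terms v₀, v₁, v₂, v₃ of the sequence
with v₀ = E₁ and [w, vₖ] = [2]vₖ₊₁, because each braid operator carries w to itself up to exchanging
the two generators (`v_eq_rootVec`). The Serre relations give v₁v₀ = q²v₀v₁ and v₂v₁ = q²v₁v₂, and a
second imaginary element h acts by commutators as a shift by two. Applying the derivations [w, ·]
and [h, ·] to these two relations yields all the others (`straightening_rootVec`).

Linear independence of the ordered monomials needs a faithful enough model. The algebra presented by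
the Serre relations embeds in the quantized enveloping algebra, because it is the underlying space
of a Verma module (`posToUqg_injective`). It also acts on quantum polynomials in four variables,
where the root vectors have explicit leading terms with independent exponents
(`linearIndependent_ordMonomial_op`). The anti-automorphism σ is first built on the presented
algebra. The straightening relations show that σ, scaled by a power of q, is unitriangular on the
dual PBW basis, and the Kazhdan-Lusztig argument (`exists_sub_eq_of_antiinvariant`,
`eq_zero_of_invariant`) gives existence and uniqueness of the dual canonical basis.

For the product formulas, let Z be the middle minor and P the product of the two outer quantum
minors. Z and P commute, and each outer minor commutes up to powers of q with all `u i`. Define Xₙ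
(`evenSeq`) by a q-Chebyshev recursion Xₙ₊₂ = q^(4n)Xₙ₊₁Z - q^(8n-2)PXₙ, and a companion sequence Yₙ
(`oddSeq`). Then Xₙ₊₁ = B[n,0,0,n], Yₙ = B[n+1,0,0,n], Z = B[1,0,0,1], and the elements B[m,1,1,m]
and B[m+1,1,1,m] with m ≥ 1 are powers of q times PXₘ and PYₘ₋₁; B[1,1,1,0] comes from the minor
`minor₁` times `u 2`. Read backwards, the recursion is the multiplication formula. As Xₙ is a
polynomial in the commuting elements Z and P, it commutes with Z, while XₙZ for n ≥ 2 is a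
combination of two distinct basis elements; this refutes the conjecture.

To recognize these elements as basis elements one checks σ-invariance, by induction along the
recursion, and positivity of the exponents of q in the PBW expansion. Positivity is hidden in the
recursion by a cancellation. It becomes visible in a ladder that produces Yₙ from Xₙ₊₁ by
multiplying with `u 3` on the left and Xₙ₊₂ from Yₙ by multiplying with `u 0` on the right
(`evenSeq_eq_oddSeq`). -/

namespace KroneckerQuantum

/-! ### Root vectors as iterated commutators, and their relations from the Serre relations -/

section RootVectors

variable {K A : Type*} [Field K] [Ring A] [Algebra K A]

/-- The imaginary root vector `y x - q⁻² x y`. -/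
def imagVec (q : K) (x y : A) : A := y * x - (q ^ 2)⁻¹ • (x * y)

/-- The real root vectors obtained from `x` by iterating `[2]⁻¹ [imagVec, ·]`. -/
def rootVec (q : K) (x y : A) : ℕ → A
  | 0 => x
  | k + 1 => (q + q⁻¹)⁻¹ •
      (imagVec q x y * rootVec q x y k - rootVec q x y k * imagVec q x y)

/-- The quantized Serre expression in an arbitrary algebra. -/
def serreExpr (q : K) (x y : A) : A :=
  x ^ 3 * y - (q ^ 2 + 1 + (q ^ 2)⁻¹) • (x ^ 2 * y * x)
    + (q ^ 2 + 1 + (q ^ 2)⁻¹) • (x * y * x ^ 2) - y * x ^ 3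

variable {q : K} {x y : A}

theorem imagVec_mul_rootVec (h2 : q + q⁻¹ ≠ 0) (k : ℕ) :
    imagVec q x y * rootVec q x y k =
      rootVec q x y k * imagVec q x y + (q + q⁻¹) • rootVec q x y (k + 1) := by
  rw [rootVec, smul_inv_smul₀ h2]; abel

/-- With L and R the left and right multiplications by x, the Serre expression is up to a scalar (R
- q²L)(R - L)(R - q⁻²L)y. The last two factors produce the root vector, and the first one is the
relation. -/
theorem rootVec_one_mul_zero (hq : q ≠ 0) (h : serreExpr q x y = 0) :
    rootVec q x y 1 * x = q ^ 2 • (x * rootVec q x y 1) := by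
  rw [← sub_eq_zero]
  trans (-(q + q⁻¹)⁻¹) • serreExpr q x y
  · simp only [rootVec, imagVec, serreExpr, pow_succ, pow_zero, one_mul, mul_sub,
      sub_mul, smul_mul_assoc, mul_smul_comm, smul_add, smul_sub, smul_smul, mul_assoc]
    match_scalars <;> field_simp <;> ring
  · rw [h, smul_zero]

variable {a b w v : A}

/-- The Serre expression factors as (L - R)(L - q²R)(L - q⁻²R) applied to a, with L and R the
multiplications by b; the last factor turns a into w. -/
theorem cubic_of_serre (hq : q ≠ 0)
    (hba : b * a = (q ^ 2)⁻¹ • (a * b) + w) (h : serreExpr q b a = 0) :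
    b * (b * w) - (1 + q ^ 2) • (b * (w * b)) + q ^ 2 • (w * (b * b)) = 0 := by
  have hba' : ∀ z, b * (a * z) = (q ^ 2)⁻¹ • (a * (b * z)) + w * z := fun z => by
    rw [← mul_assoc, hba]; simp only [add_mul, smul_mul_assoc, mul_assoc]
  rw [← h]
  simp only [serreExpr, pow_succ, pow_zero, one_mul, mul_add, add_mul, smul_mul_assoc,
    mul_smul_comm, smul_add, smul_smul, mul_assoc, hba, hba']
  match_scalars <;> field_simp <;> ring

/-- Taking q-commutators of the cubic relation with a twice, with the exponents -4 and -2 given by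
pairing the weights with that of a, leaves [2][3] times the commutator of w with the second
imaginary element. -/
theorem imag_two_commute (hq : q ≠ 0) (h2 : q + q⁻¹ ≠ 0) (h3 : q ^ 2 + 1 + (q ^ 2)⁻¹ ≠ 0)
    (hba : b * a = (q ^ 2)⁻¹ • (a * b) + w) (hwa : w * a = a * w + (q + q⁻¹) • v)
    (hva : v * a = q ^ 2 • (a * v))
    (h : b * (b * w) - (1 + q ^ 2) • (b * (w * b)) + q ^ 2 • (w * (b * b)) = 0) :
    w * (b * v - (q ^ 2)⁻¹ • (v * b)) = (b * v - (q ^ 2)⁻¹ • (v * b)) * w := by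
  have hba' : ∀ z, b * (a * z) = (q ^ 2)⁻¹ • (a * (b * z)) + w * z := fun z => by
    rw [← mul_assoc, hba]; simp only [add_mul, smul_mul_assoc, mul_assoc]
  have hwa' : ∀ z, w * (a * z) = a * (w * z) + (q + q⁻¹) • (v * z) := fun z => by
    rw [← mul_assoc, hwa]; simp only [add_mul, smul_mul_assoc, mul_assoc]
  have hva' : ∀ z, v * (a * z) = q ^ 2 • (a * (v * z)) := fun z => by
    rw [← mul_assoc, hva]; simp only [smul_mul_assoc, mul_assoc]
  set P0 := b * (b * w) - (1 + q ^ 2) • (b * (w * b)) + q ^ 2 • (w * (b * b)) with hP0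
  set P1 := P0 * a - (q ^ 4)⁻¹ • (a * P0) with hP1
  have e1 : P1 = (q + q⁻¹) • (b * (b * v)) - ((q + q⁻¹) * (1 + (q ^ 2)⁻¹)) • (b * (v * b))
      - q ^ 2 • (b * (w * w)) + ((q + q⁻¹) * (q ^ 2)⁻¹) • (v * (b * b))
      + (q ^ 2 + (q ^ 2)⁻¹) • (w * (b * w)) - (q ^ 2)⁻¹ • (w * (w * b)) := by
    simp only [hP1, hP0, mul_add, add_mul, mul_sub, sub_mul, smul_mul_assoc, mul_smul_comm,
      smul_add, smul_sub, smul_smul, mul_assoc, hba, hba', hwa, hwa']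
    match_scalars <;> field_simp <;> ring
  have e2 : P1 * a - (q ^ 2)⁻¹ • (a * P1) = ((q + q⁻¹) * (q ^ 2 + 1 + (q ^ 2)⁻¹)) •
      (w * (b * v - (q ^ 2)⁻¹ • (v * b)) - (b * v - (q ^ 2)⁻¹ • (v * b)) * w) := by
    rw [e1]
    simp only [mul_add, add_mul, mul_sub, sub_mul, smul_mul_assoc, mul_smul_comm,
      smul_add, smul_sub, smul_smul, mul_assoc, hba, hba', hwa, hwa', hva, hva']
    match_scalars <;> field_simp <;> ring
  have e3 : P1 = 0 := by rw [hP1, h]; simp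
  rw [e3] at e2
  simp only [zero_mul, mul_zero, smul_zero, sub_zero] at e2
  exact sub_eq_zero.1 ((smul_eq_zero.1 e2.symm).resolve_left (mul_ne_zero h2 h3))

/-- Two further q-commutators with a, with exponents 0 and 2, leave -[4] times the cubic. Since [w,
v] is a multiple of the next root vector, the cubic is the relation v₂v₁ = q²v₁v₂ in disguise. -/
theorem cubic_of_imag_two_commute (hq : q ≠ 0) (h4 : (q + q⁻¹) * (q ^ 2 + (q ^ 2)⁻¹) ≠ 0)
    (hba : b * a = (q ^ 2)⁻¹ • (a * b) + w) (hwa : w * a = a * w + (q + q⁻¹) • v)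
    (hva : v * a = q ^ 2 • (a * v))
    (h : w * (b * v - (q ^ 2)⁻¹ • (v * b)) = (b * v - (q ^ 2)⁻¹ • (v * b)) * w) :
    w * (v * v) - (1 + q ^ 2) • (v * (w * v)) + q ^ 2 • (v * (v * w)) = 0 := by
  have hba' : ∀ z, b * (a * z) = (q ^ 2)⁻¹ • (a * (b * z)) + w * z := fun z => by
    rw [← mul_assoc, hba]; simp only [add_mul, smul_mul_assoc, mul_assoc]
  have hwa' : ∀ z, w * (a * z) = a * (w * z) + (q + q⁻¹) • (v * z) := fun z => by
    rw [← mul_assoc, hwa]; simp only [add_mul, smul_mul_assoc, mul_assoc]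
  have hva' : ∀ z, v * (a * z) = q ^ 2 • (a * (v * z)) := fun z => by
    rw [← mul_assoc, hva]; simp only [smul_mul_assoc, mul_assoc]
  set P2 := w * (b * v - (q ^ 2)⁻¹ • (v * b)) - (b * v - (q ^ 2)⁻¹ • (v * b)) * w with hP2
  set P3 := P2 * a - a * P2 with hP3
  have e1 : P3 = (q + q⁻¹) • (v * (b * v - (q ^ 2)⁻¹ • (v * b)) -
      (b * v - (q ^ 2)⁻¹ • (v * b)) * v) + w * (q ^ 2 • (w * v) - (q ^ 2)⁻¹ • (v * w)) -
      (q ^ 2 • (w * v) - (q ^ 2)⁻¹ • (v * w)) * w := by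
    simp only [hP3, hP2, mul_add, add_mul, mul_sub, sub_mul, smul_mul_assoc, mul_smul_comm,
      smul_add, smul_sub, smul_smul, mul_assoc, hba, hba', hwa, hwa', hva, hva']
    match_scalars <;> field_simp <;> ring
  have e2 : P3 * a - q ^ 2 • (a * P3) = -((q + q⁻¹) * (q ^ 2 + (q ^ 2)⁻¹)) •
      (w * (v * v) - (1 + q ^ 2) • (v * (w * v)) + q ^ 2 • (v * (v * w))) := by
    rw [e1]
    simp only [mul_add, add_mul, mul_sub, sub_mul, smul_mul_assoc, mul_smul_comm,
      smul_add, smul_sub, smul_smul, mul_assoc, hba, hba', hwa, hwa', hva, hva']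
    match_scalars <;> field_simp <;> ring
  have e3 : P3 = 0 := by rw [hP3, hP2, h]; simp
  rw [e3] at e2
  simp only [zero_mul, mul_zero, smul_zero, sub_zero] at e2
  exact (smul_eq_zero.1 e2.symm).resolve_left (neg_ne_zero.2 h4)

/-- The straightening relations between four elements which `q`-commute like the root vectors. -/
structure Straightening (q : K) (u : Fin 4 → A) : Prop where
  mul_10 : u 1 * u 0 = q ^ 2 • (u 0 * u 1)
  mul_21 : u 2 * u 1 = q ^ 2 • (u 1 * u 2)
  mul_32 : u 3 * u 2 = q ^ 2 • (u 2 * u 3)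
  mul_20 : u 2 * u 0 = q ^ 2 • (u 0 * u 2) + (q ^ 2 - 1) • (u 1 * u 1)
  mul_31 : u 3 * u 1 = q ^ 2 • (u 1 * u 3) + (q ^ 2 - 1) • (u 2 * u 2)
  mul_30 : u 3 * u 0 = q ^ 2 • (u 0 * u 3) + (q ^ 4 - 1) • (u 1 * u 2)

/-- Commutators with w and h are derivations that shift the index by one and by two; applied to the
two given relations they generate the rest. -/
theorem straightening_of_derivation [CharZero K] {s κ : K} (hs : s ≠ 0) (hκ : κ ≠ 0)
    {v : ℕ → A} {w h : A} (hw : ∀ k, w * v k = v k * w + s • v (k + 1))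
    (hh : ∀ k, h * v k = v k * h + κ • v (k + 2))
    (h10 : v 1 * v 0 = q ^ 2 • (v 0 * v 1)) (h21 : v 2 * v 1 = q ^ 2 • (v 1 * v 2)) :
    Straightening q (fun i : Fin 4 => v i) := by
  have D : ∀ i j, w * (v i * v j) - v i * v j * w = s • (v (i + 1) * v j + v i * v (j + 1)) := by
    intro i j
    rw [← mul_assoc, hw, add_mul, mul_assoc, hw]
    simp only [mul_add, smul_mul_assoc, mul_smul_comm, smul_add, mul_assoc]; abel
  have H : ∀ i j, h * (v i * v j) - v i * v j * h = κ • (v (i + 2) * v j + v i * v (j + 2)) := by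
    intro i j
    rw [← mul_assoc, hh, add_mul, mul_assoc, hh]
    simp only [mul_add, smul_mul_assoc, mul_smul_comm, smul_add, mul_assoc]; abel
  have e20 : v 2 * v 0 + v 1 * v 1 = q ^ 2 • (v 1 * v 1 + v 0 * v 2) := by
    have := congrArg (fun t => w * t - t * w) h10
    simp only [mul_smul_comm, smul_mul_assoc, ← smul_sub, D] at this
    exact smul_right_injective _ hs (this.trans (smul_comm _ _ _))
  have e31 : v 3 * v 1 + v 2 * v 2 = q ^ 2 • (v 2 * v 2 + v 1 * v 3) := by
    have := congrArg (fun t => w * t - t * w) h21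
    simp only [mul_smul_comm, smul_mul_assoc, ← smul_sub, D] at this
    exact smul_right_injective _ hs (this.trans (smul_comm _ _ _))
  have e30 : v 3 * v 0 + v 2 * v 1 + (v 2 * v 1 + v 1 * v 2) =
      q ^ 2 • (v 2 * v 1 + v 1 * v 2 + (v 1 * v 2 + v 0 * v 3)) := by
    have := congrArg (fun t => w * t - t * w) e20
    simp only [mul_smul_comm, smul_mul_assoc, ← smul_sub, mul_add, add_mul, add_sub_add_comm, D,
      ← smul_add] at this
    exact smul_right_injective _ hs (this.trans (smul_comm _ _ _))
  have e41 : v 4 * v 1 + v 3 * v 2 + (v 3 * v 2 + v 2 * v 3) =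
      q ^ 2 • (v 3 * v 2 + v 2 * v 3 + (v 2 * v 3 + v 1 * v 4)) := by
    have := congrArg (fun t => w * t - t * w) e31
    simp only [mul_smul_comm, smul_mul_assoc, ← smul_sub, mul_add, add_mul, add_sub_add_comm, D,
      ← smul_add] at this
    exact smul_right_injective _ hs (this.trans (smul_comm _ _ _))
  have e41' : v 4 * v 1 + v 2 * v 3 = q ^ 2 • (v 3 * v 2 + v 1 * v 4) := by
    have := congrArg (fun t => h * t - t * h) h21
    simp only [mul_smul_comm, smul_mul_assoc, ← smul_sub, H] at this
    exact smul_right_injective _ hκ (this.trans (smul_comm _ _ _))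
  refine ⟨h10, h21, ?_, ?_, ?_, ?_⟩
  -- Shifting the relation between v₂ and v₁ twice by one and once by two gives two identities with
  -- the same terms v₄v₁ and v₁v₄. Their difference is twice the wanted relation.
  · refine smul_right_injective _ (two_ne_zero (α := K)) ?_
    change (2 : K) • (v 3 * v 2) = (2 : K) • q ^ 2 • (v 2 * v 3)
    linear_combination (norm := module) e41 - e41'
  · change v 2 * v 0 = q ^ 2 • (v 0 * v 2) + (q ^ 2 - 1) • (v 1 * v 1)
    linear_combination (norm := module) e20
  · change v 3 * v 1 = q ^ 2 • (v 1 * v 3) + (q ^ 2 - 1) • (v 2 * v 2)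
    linear_combination (norm := module) e31
  · change v 3 * v 0 = q ^ 2 • (v 0 * v 3) + (q ^ 4 - 1) • (v 1 * v 2)
    linear_combination (norm := module) e30 + (q ^ 2 - 2) • h21

theorem straightening_rootVec [CharZero K] (hq : q ≠ 0) (h2 : q + q⁻¹ ≠ 0)
    (h3 : q ^ 2 + 1 + (q ^ 2)⁻¹ ≠ 0) (h4 : q ^ 2 + (q ^ 2)⁻¹ ≠ 0)
    (hxy : serreExpr q x y = 0) (hyx : serreExpr q y x = 0) :
    Straightening q (fun i : Fin 4 => rootVec q x y i) := by
  set w := imagVec q x y with hw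
  set v := rootVec q x y with hv
  have hba : y * x = (q ^ 2)⁻¹ • (x * y) + w := by rw [hw, imagVec]; abel
  have hD : ∀ k, w * v k = v k * w + (q + q⁻¹) • v (k + 1) := imagVec_mul_rootVec h2
  have hva : v 1 * x = q ^ 2 • (x * v 1) := rootVec_one_mul_zero hq hxy
  have hψ := imag_two_commute hq h2 h3 hba (hD 0) hva (cubic_of_serre hq hba hyx)
  have hc := cubic_of_imag_two_commute hq (mul_ne_zero h2 h4) hba (hD 0) hva hψ
  set ψ := y * v 1 - (q ^ 2)⁻¹ • (v 1 * y) with hψdef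
  have hψa : ψ * x = x * ψ + q ^ 2 • (w * v 1) - (q ^ 2)⁻¹ • (v 1 * w) := by
    have hba' : ∀ z, y * (x * z) = (q ^ 2)⁻¹ • (x * (y * z)) + w * z := fun z => by
      rw [← mul_assoc, hba]; simp only [add_mul, smul_mul_assoc, mul_assoc]
    have hva' : ∀ z, v 1 * (x * z) = q ^ 2 • (x * (v 1 * z)) := fun z => by
      rw [← mul_assoc, hva]; simp only [smul_mul_assoc, mul_assoc]
    simp only [hψdef, mul_add, mul_sub, sub_mul, smul_mul_assoc, mul_smul_comm,
      smul_add, smul_smul, mul_assoc, hba, hba', hva, hva']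
    match_scalars <;> field_simp
  -- The multiple of w² is chosen to cancel the terms v₁w in the commutator of ψ with v₀, so that
  -- only v₂ remains. As h commutes with w, the shift property then propagates to every vₖ.
  set h := (2 : K) • ψ - (q - q⁻¹) • (w * w) with hh
  have hhw : h * w = w * h := by
    simp only [hh, sub_mul, mul_sub, smul_mul_assoc, mul_smul_comm, hψ, mul_assoc]
  have hrec : ∀ k, v (k + 1) = (q + q⁻¹)⁻¹ • (w * v k - v k * w) := fun k => rfl
  have hH : ∀ k, h * v k = v k * h + ((q + q⁻¹) * (q ^ 2 + (q ^ 2)⁻¹)) • v (k + 2) := by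
    intro k
    induction k with
    | zero =>
      have h0 : v 0 = x := rfl
      have e := hD 0
      have e' : ∀ z, w * (v 0 * z) = v 0 * (w * z) + (q + q⁻¹) • (v 1 * z) := fun z => by
        rw [← mul_assoc, e]; simp only [add_mul, smul_mul_assoc, mul_assoc]
      have e1 := hD 1
      rw [← h0] at hψa
      simp only [hh, sub_mul, mul_sub, smul_mul_assoc, mul_smul_comm, hψa, mul_assoc, e, e', mul_add,
        smul_add, smul_sub, smul_smul, e1]
      match_scalars <;> field_simp <;> ring
    | succ k ih =>
      rw [hrec k, hrec (k + 2)]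
      have ih' : ∀ z, h * (v k * z) = v k * (h * z) +
          ((q + q⁻¹) * (q ^ 2 + (q ^ 2)⁻¹)) • (v (k + 2) * z) := fun z => by
        rw [← mul_assoc, ih]; simp only [add_mul, smul_mul_assoc, mul_assoc]
      have hhw' : ∀ z, h * (w * z) = w * (h * z) := fun z => by
        rw [← mul_assoc, hhw, mul_assoc]
      simp only [sub_mul, mul_sub, smul_mul_assoc, mul_smul_comm, mul_assoc, hhw', ih, ih', hhw,
        mul_add, smul_add, smul_sub, smul_smul]
      match_scalars <;> ring
  refine straightening_of_derivation h2 (mul_ne_zero h2 h4) hD hH hva ?_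
  rw [hrec 1, ← sub_eq_zero]
  trans (q + q⁻¹)⁻¹ • (w * (v 1 * v 1) - (1 + q ^ 2) • (v 1 * (w * v 1)) + q ^ 2 • (v 1 * (v 1 * w)))
  · simp only [sub_mul, mul_sub, smul_mul_assoc, mul_smul_comm, mul_assoc]
    match_scalars <;> ring
  · rw [hc, smul_zero]

end RootVectors

/-! ### Invariance of the imaginary root vector under the braid operators -/

section BraidAction

variable {K A : Type*} [Field K] [Ring A] [Algebra K A] {q : K}

theorem rootVec_one (x y : A) : rootVec q x y 1 =
    (q + q⁻¹)⁻¹ • (imagVec q x y * x - x * imagVec q x y) := rfl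

theorem mul_left_comm_of {x y : A} {c : K} (h : x * y = c • (y * x)) (z : A) :
    x * (y * z) = c • (y * (x * z)) := by
  rw [← mul_assoc, h, smul_mul_assoc, mul_assoc]

/-- Here `e₂` stands for Eᵢ and `e₁` for Eⱼ, so that the arguments on the left are Tᵢ(Eⱼ) and
Tᵢ(Eᵢ): the operator Tᵢ preserves the imaginary root vector up to exchanging the two generators. -/
theorem imagVec_braid (hq : q ≠ 0) (h2 : q + q⁻¹ ≠ 0) (h1 : q - q⁻¹ ≠ 0) {e₁ e₂ f k k' : A}
    (hkk : k' * k = 1) (hk₁ : k * e₁ = (q ^ 2)⁻¹ • (e₁ * k)) (hk₂ : k * e₂ = q ^ 2 • (e₂ * k))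
    (hk₁' : k' * e₁ = q ^ 2 • (e₁ * k')) (hk₂' : k' * e₂ = (q ^ 2)⁻¹ • (e₂ * k'))
    (hf₁ : f * e₁ = e₁ * f) (hf₂ : f * e₂ = e₂ * f - (q - q⁻¹)⁻¹ • (k - k')) :
    imagVec q (rootVec q e₂ e₁ 1) (-(k' * f)) = imagVec q e₂ e₁ := by
  have a1 := mul_left_comm_of hk₁
  have a2 := mul_left_comm_of hk₂
  have a3 := mul_left_comm_of hk₁'
  have a4 := mul_left_comm_of hk₂'
  have a5 : ∀ z, f * (e₁ * z) = e₁ * (f * z) := fun z => by rw [← mul_assoc, hf₁, mul_assoc]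
  have a6 : ∀ z, f * (e₂ * z) = e₂ * (f * z) - (q - q⁻¹)⁻¹ • (k * z - k' * z) := fun z => by
    rw [← mul_assoc, hf₂]; simp only [sub_mul, smul_mul_assoc, mul_assoc]
  have h1' : q ^ 2 - 1 ≠ 0 := fun h => h1 (by field_simp; linear_combination h)
  have h2' : q ^ 2 + 1 ≠ 0 := fun h => h2 (by field_simp; linear_combination h)
  simp only [rootVec_one, imagVec, neg_mul, mul_neg, mul_sub, sub_mul, smul_mul_assoc,
    mul_smul_comm, smul_sub, smul_smul, mul_assoc, hk₁, hk₂, hk₁', hk₂', hf₁, hf₂, a1, a2, a3, a4,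
    a5, a6, hkk, mul_one]
  match_scalars <;> field_simp <;> ring

/-- The defining relations of `U_q(𝔤)` without the quantized Serre relations. -/
structure QuantumRel (q : K) (e f k k' : Fin 2 → A) : Prop where
  k_comm (i j : Fin 2) : k i * k j = k j * k i
  k_mul_k' (i : Fin 2) : k i * k' i = 1
  k'_mul_k (i : Fin 2) : k' i * k i = 1
  k_e (i j : Fin 2) : k i * e j * k' i = q ^ cartan i j • e j
  k_f (i j : Fin 2) : k i * f j * k' i = q ^ (-cartan i j) • f j
  e_f_same (i : Fin 2) : e i * f i - f i * e i = (q - q⁻¹)⁻¹ • (k i - k' i)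
  e_f_ne (i j : Fin 2) (h : i ≠ j) : e i * f j - f j * e i = 0

namespace QuantumRel

variable {e f k k' : Fin 2 → A} (R : QuantumRel q e f k k')
include R

theorem k_mul_e (i j : Fin 2) : k i * e j = q ^ cartan i j • (e j * k i) := by
  rw [← smul_mul_assoc, ← R.k_e, mul_assoc, R.k'_mul_k, mul_one]

theorem k_mul_f (i j : Fin 2) : k i * f j = q ^ (-cartan i j) • (f j * k i) := by
  rw [← smul_mul_assoc, ← R.k_f, mul_assoc, R.k'_mul_k, mul_one]

theorem k'_mul_e (hq : q ≠ 0) (i j : Fin 2) : k' i * e j = q ^ (-cartan i j) • (e j * k' i) := by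
  have h := congrArg (fun t => k' i * t) (R.k_e i j)
  simp only [← mul_assoc, R.k'_mul_k, one_mul, mul_smul_comm] at h
  rw [h, smul_smul, ← zpow_add₀ hq, neg_add_cancel, zpow_zero, one_smul]

theorem k'_mul_f (hq : q ≠ 0) (i j : Fin 2) : k' i * f j = q ^ cartan i j • (f j * k' i) := by
  have h := congrArg (fun t => k' i * t) (R.k_f i j)
  simp only [← mul_assoc, R.k'_mul_k, one_mul, mul_smul_comm] at h
  rw [h, smul_smul, ← zpow_add₀ hq, add_neg_cancel, zpow_zero, one_smul]

theorem f_mul_e_same (i : Fin 2) : f i * e i = e i * f i - (q - q⁻¹)⁻¹ • (k i - k' i) := by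
  rw [← R.e_f_same]; abel

theorem f_mul_e_ne {i j : Fin 2} (h : j ≠ i) : f i * e j = e j * f i :=
  (sub_eq_zero.1 (R.e_f_ne j i h)).symm

theorem k_comm_k' (i j : Fin 2) : k i * k' j = k' j * k i := by
  have h : k' j * (k j * k i) * k' j = k' j * (k i * k j) * k' j := by rw [R.k_comm]
  rwa [← mul_assoc, R.k'_mul_k, one_mul, mul_assoc, mul_assoc, R.k_mul_k', mul_one] at h

theorem k'_comm (i j : Fin 2) : k' i * k' j = k' j * k' i := by
  have h : k' i * (k i * k' j) * k' i = k' i * (k' j * k i) * k' i := by rw [R.k_comm_k']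
  rw [← mul_assoc, R.k'_mul_k, one_mul, mul_assoc, mul_assoc, R.k_mul_k', mul_one] at h
  exact h.symm

end QuantumRel

/-- The value of `T₁` on the generator `F₂`. -/
def braidF (q : K) (x y : A) : A :=
  (q + q⁻¹)⁻¹ • (x * x * y) - q • (x * y * x) + (q ^ 2 * (q + q⁻¹)⁻¹) • (y * x * x)

/-- This is the relation between E₂ and F₂ after applying T₁. It has to be verified directly, since
`lusztigT` is an endomorphism of the free algebra and is not yet known to respect the relations. -/
theorem braidF_mul_rootVec (hq : q ≠ 0) (h2 : q + q⁻¹ ≠ 0) (h1 : q - q⁻¹ ≠ 0)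
    {e f k k' : Fin 2 → A} (R : QuantumRel q e f k k') :
    braidF q (f 0) (f 1) * rootVec q (e 0) (e 1) 1 = rootVec q (e 0) (e 1) 1 * braidF q (f 0) (f 1)
      - (q - q⁻¹)⁻¹ • (k 1 * k 0 ^ 2 - k' 1 * k' 0 ^ 2) := by
  have z2 : q ^ (2 : ℤ) = q ^ 2 := by norm_cast
  have z2' : q ^ (-2 : ℤ) = (q ^ 2)⁻¹ := by rw [zpow_neg, z2]
  have c00 : cartan 0 0 = 2 := rfl
  have c01 : cartan 0 1 = -2 := rfl
  have c10 : cartan 1 0 = -2 := rfl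
  have c11 : cartan 1 1 = 2 := rfl
  have ke00 : k 0 * e 0 = q ^ 2 • (e 0 * k 0) := by rw [R.k_mul_e, c00, z2]
  have ke01 : k 0 * e 1 = (q ^ 2)⁻¹ • (e 1 * k 0) := by rw [R.k_mul_e, c01, z2']
  have ke10 : k 1 * e 0 = (q ^ 2)⁻¹ • (e 0 * k 1) := by rw [R.k_mul_e, c10, z2']
  have ke11 : k 1 * e 1 = q ^ 2 • (e 1 * k 1) := by rw [R.k_mul_e, c11, z2]
  have kf00 : k 0 * f 0 = (q ^ 2)⁻¹ • (f 0 * k 0) := by rw [R.k_mul_f, c00, z2']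
  have kf01 : k 0 * f 1 = q ^ 2 • (f 1 * k 0) := by rw [R.k_mul_f, c01, neg_neg, z2]
  have kf10 : k 1 * f 0 = q ^ 2 • (f 0 * k 1) := by rw [R.k_mul_f, c10, neg_neg, z2]
  have kf11 : k 1 * f 1 = (q ^ 2)⁻¹ • (f 1 * k 1) := by rw [R.k_mul_f, c11, z2']
  have le00 : k' 0 * e 0 = (q ^ 2)⁻¹ • (e 0 * k' 0) := by rw [R.k'_mul_e hq, c00, z2']
  have le01 : k' 0 * e 1 = q ^ 2 • (e 1 * k' 0) := by rw [R.k'_mul_e hq, c01, neg_neg, z2]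
  have le10 : k' 1 * e 0 = q ^ 2 • (e 0 * k' 1) := by rw [R.k'_mul_e hq, c10, neg_neg, z2]
  have le11 : k' 1 * e 1 = (q ^ 2)⁻¹ • (e 1 * k' 1) := by rw [R.k'_mul_e hq, c11, z2']
  have lf00 : k' 0 * f 0 = q ^ 2 • (f 0 * k' 0) := by rw [R.k'_mul_f hq, c00, z2]
  have lf01 : k' 0 * f 1 = (q ^ 2)⁻¹ • (f 1 * k' 0) := by rw [R.k'_mul_f hq, c01, z2']
  have lf10 : k' 1 * f 0 = (q ^ 2)⁻¹ • (f 0 * k' 1) := by rw [R.k'_mul_f hq, c10, z2']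
  have lf11 : k' 1 * f 1 = q ^ 2 • (f 1 * k' 1) := by rw [R.k'_mul_f hq, c11, z2]
  have f00 := R.f_mul_e_same 0
  have f11 := R.f_mul_e_same 1
  have f01 : f 0 * e 1 = e 1 * f 0 := R.f_mul_e_ne (by decide)
  have f10 : f 1 * e 0 = e 0 * f 1 := R.f_mul_e_ne (by decide)
  have f00' : ∀ z, f 0 * (e 0 * z) = e 0 * (f 0 * z) - (q - q⁻¹)⁻¹ • (k 0 * z - k' 0 * z) :=
    fun z => by rw [← mul_assoc, f00]; simp only [sub_mul, smul_mul_assoc, mul_assoc]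
  have f11' : ∀ z, f 1 * (e 1 * z) = e 1 * (f 1 * z) - (q - q⁻¹)⁻¹ • (k 1 * z - k' 1 * z) :=
    fun z => by rw [← mul_assoc, f11]; simp only [sub_mul, smul_mul_assoc, mul_assoc]
  have f01' : ∀ z, f 0 * (e 1 * z) = e 1 * (f 0 * z) := fun z => by
    rw [← mul_assoc, f01, mul_assoc]
  have f10' : ∀ z, f 1 * (e 0 * z) = e 0 * (f 1 * z) := fun z => by
    rw [← mul_assoc, f10, mul_assoc]
  have kk0 : ∀ z, k 0 * (k' 0 * z) = z := fun z => by rw [← mul_assoc, R.k_mul_k', one_mul]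
  have kk0' : ∀ z, k' 0 * (k 0 * z) = z := fun z => by rw [← mul_assoc, R.k'_mul_k, one_mul]
  have c1 : ∀ z, k 1 * (k 0 * z) = k 0 * (k 1 * z) := fun z => by
    rw [← mul_assoc, R.k_comm, mul_assoc]
  have c2 : ∀ z, k 1 * (k' 0 * z) = k' 0 * (k 1 * z) := fun z => by
    rw [← mul_assoc, R.k_comm_k', mul_assoc]
  have c3 : ∀ z, k' 1 * (k 0 * z) = k 0 * (k' 1 * z) := fun z => by
    rw [← mul_assoc, ← R.k_comm_k', mul_assoc]
  have c4 : ∀ z, k' 1 * (k' 0 * z) = k' 0 * (k' 1 * z) := fun z => by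
    rw [← mul_assoc, R.k'_comm, mul_assoc]
  have h1' : q ^ 2 - 1 ≠ 0 := fun h => h1 (by field_simp; linear_combination h)
  have h2' : q ^ 2 + 1 ≠ 0 := fun h => h2 (by field_simp; linear_combination h)
  -- Commuting the F's first past w and then past V, as single symbols, keeps the expansion small.
  set w := imagVec q (e 0) (e 1) with hw
  set V := rootVec q (e 0) (e 1) 1 with hV
  have kw00 : k 0 * w = w * k 0 := by
    simp only [hw, imagVec, mul_sub, sub_mul, mul_smul_comm, smul_mul_assoc, mul_assoc, ke00, ke01,
      mul_left_comm_of ke00, mul_left_comm_of ke01, smul_smul]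
    match_scalars <;> field_simp
  have kw00' : k' 1 * w = w * k' 1 := by
    simp only [hw, imagVec, mul_sub, sub_mul, mul_smul_comm, smul_mul_assoc, mul_assoc, le10, le11,
      mul_left_comm_of le10, mul_left_comm_of le11, smul_smul]
    match_scalars <;> field_simp
  have fw0 : f 0 * w = w * f 0 - ((q ^ 2)⁻¹ * (q + q⁻¹)) • (e 1 * k 0) := by
    simp only [hw, imagVec, mul_sub, sub_mul, mul_smul_comm, smul_mul_assoc, mul_assoc, f00, f01,
      f00', f01', ke01, le01, smul_smul, smul_sub]
    match_scalars <;> field_simp <;> ring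
  have fw1 : f 1 * w = w * f 1 + (q + q⁻¹) • (e 0 * k' 1) := by
    simp only [hw, imagVec, mul_sub, sub_mul, mul_smul_comm, smul_mul_assoc, mul_assoc, f11, f10,
      f11', f10', ke10, le10, smul_smul, smul_sub]
    match_scalars <;> field_simp <;> ring
  have fw0' : ∀ z, f 0 * (w * z) =
      w * (f 0 * z) - ((q ^ 2)⁻¹ * (q + q⁻¹)) • (e 1 * (k 0 * z)) := fun z => by
    rw [← mul_assoc, fw0]; simp only [sub_mul, smul_mul_assoc, mul_assoc]
  have fw1' : ∀ z, f 1 * (w * z) = w * (f 1 * z) + (q + q⁻¹) • (e 0 * (k' 1 * z)) := fun z => by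
    rw [← mul_assoc, fw1]; simp only [add_mul, smul_mul_assoc, mul_assoc]
  have hV' : V = (q + q⁻¹)⁻¹ • (w * e 0 - e 0 * w) := rfl
  have fV0 : f 0 * V = V * f 0 - w * k 0 := by
    simp only [hV', mul_sub, sub_mul, mul_smul_comm, smul_mul_assoc, mul_assoc, fw0, fw0', f00,
      f00', smul_smul, smul_sub, kw00, ke00]
    have : k' 0 * w = w * k' 0 := by
      simp only [hw, imagVec, mul_sub, sub_mul, mul_smul_comm, smul_mul_assoc, mul_assoc, le00,
        le01, mul_left_comm_of le00, mul_left_comm_of le01, smul_smul]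
      match_scalars <;> field_simp
    simp only [this]
    have h10 : e 1 * (e 0 * k 0) = w * k 0 + (q ^ 2)⁻¹ • (e 0 * (e 1 * k 0)) := by
      rw [hw, imagVec, sub_mul, smul_mul_assoc, mul_assoc, mul_assoc, sub_add_cancel]
    simp only [h10, smul_add, smul_smul]
    match_scalars <;> field_simp <;> ring
  have fV1 : f 1 * V = V * f 1 + (q ^ 2 - 1) • (e 0 * (e 0 * k' 1)) := by
    simp only [hV', mul_sub, sub_mul, mul_smul_comm, smul_mul_assoc, mul_assoc, fw1, fw1', f10,
      f10', smul_add, smul_smul, smul_sub, mul_add, le10]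
    match_scalars <;> field_simp
  have fV0' : ∀ z, f 0 * (V * z) = V * (f 0 * z) - w * (k 0 * z) := fun z => by
    rw [← mul_assoc, fV0]; simp only [sub_mul, mul_assoc]
  have fV1' : ∀ z, f 1 * (V * z) = V * (f 1 * z) + (q ^ 2 - 1) • (e 0 * (e 0 * (k' 1 * z))) :=
    fun z => by
    rw [← mul_assoc, fV1]; simp only [add_mul, smul_mul_assoc, mul_assoc]
  simp only [braidF, pow_two (k 0), pow_two (k' 0), mul_sub, sub_mul, mul_add,
    add_mul, smul_mul_assoc, mul_smul_comm, smul_sub, smul_add, smul_smul, mul_assoc,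
    fV0, fV1, fV0', fV1', fw0', fw1']
  simp only [mul_sub, sub_mul, add_mul, mul_smul_comm, smul_sub, smul_smul, mul_assoc,
    f00', f11']
  simp only [sub_mul, add_mul, mul_smul_comm, smul_sub, smul_smul, mul_assoc,
    kf00, kf01, lf10, mul_left_comm_of ke00, mul_left_comm_of kf00, mul_left_comm_of kf01, mul_left_comm_of le00, mul_left_comm_of lf00, mul_left_comm_of lf10, f00', kk0, kk0', mul_one,
    c1, c3, c4, R.k_comm 1 0, ← R.k_comm_k' 0 1, R.k'_comm 1 0]
  match_scalars <;> field_simp <;> ring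

theorem rootVec_one_expand (hq : q ≠ 0) (h2 : q + q⁻¹ ≠ 0) (x y : A) : rootVec q x y 1 =
    (q + q⁻¹)⁻¹ • (y * x ^ 2) + -(q⁻¹ • (x * y * x)) +
      (q ^ 2)⁻¹ • (q + q⁻¹)⁻¹ • (x ^ 2 * y) := by
  have h2' : q ^ 2 + 1 ≠ 0 := fun h => h2 (by field_simp; linear_combination h)
  simp only [rootVec_one, imagVec, pow_two x, smul_mul_assoc, mul_smul_comm, smul_smul, mul_sub,
    sub_mul, mul_assoc]
  match_scalars <;> field_simp
  ring

/-- The Serre relation once more; it serves to show that T₁(F₂) commutes with T₁(E₁), as F₂ does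
with E₁. -/
theorem braidF_mul_self {x y : A} (h : serreExpr q x y = 0) (hq : q ≠ 0)
    (h2 : q + q⁻¹ ≠ 0) : braidF q x y * x = q ^ 2 • (x * braidF q x y) := by
  have h2' : q ^ 2 + 1 ≠ 0 := fun h => h2 (by field_simp; linear_combination h)
  rw [← sub_eq_zero]
  trans (-(q ^ 2 * (q + q⁻¹)⁻¹)) • serreExpr q x y
  · simp only [braidF, serreExpr, pow_succ, pow_zero, one_mul, mul_sub, mul_add, add_mul,
      sub_mul, smul_mul_assoc, mul_smul_comm, smul_add, smul_sub, smul_smul, mul_assoc]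
    match_scalars <;> field_simp <;> ring
  · rw [h, smul_zero]

namespace QuantumRel

variable {e f k k' : Fin 2 → A} (R : QuantumRel q e f k k')
include R

theorem imagVec_braid_first (hq : q ≠ 0) (h2 : q + q⁻¹ ≠ 0) (h1 : q - q⁻¹ ≠ 0) :
    imagVec q (rootVec q (e 0) (e 1) 1) (-(k' 0 * f 0)) = imagVec q (e 0) (e 1) := by
  have z2 : q ^ (2 : ℤ) = q ^ 2 := by norm_cast
  have z2' : q ^ (-2 : ℤ) = (q ^ 2)⁻¹ := by rw [zpow_neg, z2]
  have c00 : cartan 0 0 = 2 := rfl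
  have c01 : cartan 0 1 = -2 := rfl
  refine imagVec_braid hq h2 h1 (R.k'_mul_k 0) ?_ ?_ ?_ ?_
    (R.f_mul_e_ne (by decide)) (R.f_mul_e_same 0)
  · rw [R.k_mul_e, c01, z2']
  · rw [R.k_mul_e, c00, z2]
  · rw [R.k'_mul_e hq, c01, neg_neg, z2]
  · rw [R.k'_mul_e hq, c00, z2']

/-- The invariance under T₂ transported by T₁: the images of E₂, E₁, F₂, K₂ under T₁ satisfy the
hypotheses of `imagVec_braid`, and one further application for T₁ itself leads back to w. -/
theorem imagVec_braid_second (hq : q ≠ 0) (h2 : q + q⁻¹ ≠ 0) (h1 : q - q⁻¹ ≠ 0)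
    (hs : serreExpr q (f 0) (f 1) = 0) :
    imagVec q (rootVec q (rootVec q (e 0) (e 1) 1) (-(k' 0 * f 0)) 1)
      (-((k' 1 * k' 0 ^ 2) * braidF q (f 0) (f 1))) = imagVec q (e 0) (e 1) := by
  have z2 : q ^ (2 : ℤ) = q ^ 2 := by norm_cast
  have z2' : q ^ (-2 : ℤ) = (q ^ 2)⁻¹ := by rw [zpow_neg, z2]
  have c00 : cartan 0 0 = 2 := rfl
  have c01 : cartan 0 1 = -2 := rfl
  have c10 : cartan 1 0 = -2 := rfl
  have c11 : cartan 1 1 = 2 := rfl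
  have ke00 : k 0 * e 0 = q ^ 2 • (e 0 * k 0) := by rw [R.k_mul_e, c00, z2]
  have ke01 : k 0 * e 1 = (q ^ 2)⁻¹ • (e 1 * k 0) := by rw [R.k_mul_e, c01, z2']
  have ke10 : k 1 * e 0 = (q ^ 2)⁻¹ • (e 0 * k 1) := by rw [R.k_mul_e, c10, z2']
  have ke11 : k 1 * e 1 = q ^ 2 • (e 1 * k 1) := by rw [R.k_mul_e, c11, z2]
  have le00 : k' 0 * e 0 = (q ^ 2)⁻¹ • (e 0 * k' 0) := by rw [R.k'_mul_e hq, c00, z2']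
  have le01 : k' 0 * e 1 = q ^ 2 • (e 1 * k' 0) := by
    rw [R.k'_mul_e hq, c01, neg_neg, z2]
  have le10 : k' 1 * e 0 = q ^ 2 • (e 0 * k' 1) := by
    rw [R.k'_mul_e hq, c10, neg_neg, z2]
  have le11 : k' 1 * e 1 = (q ^ 2)⁻¹ • (e 1 * k' 1) := by rw [R.k'_mul_e hq, c11, z2']
  have kf00 : k 0 * f 0 = (q ^ 2)⁻¹ • (f 0 * k 0) := by rw [R.k_mul_f, c00, z2']
  have kf10 : k 1 * f 0 = q ^ 2 • (f 0 * k 1) := by rw [R.k_mul_f, c10, neg_neg, z2]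
  have lf00 : k' 0 * f 0 = q ^ 2 • (f 0 * k' 0) := by rw [R.k'_mul_f hq, c00, z2]
  have lf01 : k' 0 * f 1 = (q ^ 2)⁻¹ • (f 1 * k' 0) := by rw [R.k'_mul_f hq, c01, z2']
  have lf10 : k' 1 * f 0 = (q ^ 2)⁻¹ • (f 0 * k' 1) := by rw [R.k'_mul_f hq, c10, z2']
  have kk : ∀ i j z, k i * (k' j * z) = k' j * (k i * z) := fun i j z => by
    rw [← mul_assoc, R.k_comm_k', mul_assoc]
  have kk10 : ∀ z, k' 1 * (k' 0 * z) = k' 0 * (k' 1 * z) := fun z => by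
    rw [← mul_assoc, R.k'_comm, mul_assoc]
  have kc : ∀ z, k 1 * (k 0 * z) = k 0 * (k 1 * z) := fun z => by
    rw [← mul_assoc, R.k_comm, mul_assoc]
  refine (imagVec_braid (k := k 1 * k 0 ^ 2) hq h2 h1 ?_ ?_ ?_ ?_ ?_ ?_ ?_).trans
    (R.imagVec_braid_first hq h2 h1)
  · have hkk : ∀ z, k' 0 * (k 0 * z) = z := fun z => by rw [← mul_assoc, R.k'_mul_k, one_mul]
    simp only [pow_two, mul_assoc, hkk, R.k'_mul_k, kc, R.k_comm 1 0]
  · simp only [pow_two (k 0), mul_neg, neg_mul, mul_assoc, kk, kf00, mul_left_comm_of kf00,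
      mul_left_comm_of kf10, mul_smul_comm, smul_smul]
    match_scalars; field_simp
  · simp only [pow_two (k 0), rootVec_one, imagVec, mul_sub, sub_mul, mul_assoc, ke00, ke01, mul_left_comm_of ke00, mul_left_comm_of ke01, mul_left_comm_of ke10,
      mul_left_comm_of ke11, mul_smul_comm, smul_mul_assoc, smul_smul, smul_sub]
    match_scalars <;> field_simp
  · simp only [pow_two (k' 0), mul_neg, neg_mul, mul_assoc, kk10, R.k'_comm 1 0, lf00, mul_left_comm_of lf00, mul_left_comm_of lf10, mul_smul_comm, smul_mul_assoc, smul_smul]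
    match_scalars; field_simp
  · simp only [pow_two (k' 0), rootVec_one, imagVec, mul_sub, sub_mul, mul_assoc, le00, le01,
      mul_left_comm_of le00, mul_left_comm_of le01, mul_left_comm_of le10,
      mul_left_comm_of le11, mul_smul_comm, smul_mul_assoc, smul_smul, smul_sub]
    match_scalars <;> field_simp
  · have hb := braidF_mul_self hs hq h2
    have hk : k' 0 * braidF q (f 0) (f 1) = q ^ 2 • (braidF q (f 0) (f 1) * k' 0) := by
      simp only [braidF, mul_add, mul_sub, add_mul, sub_mul, mul_assoc, lf00, lf01, mul_smul_comm,
        smul_mul_assoc, mul_left_comm_of lf00, mul_left_comm_of lf01, smul_smul, smul_add, smul_sub]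
      match_scalars <;> field_simp
    have hk' : braidF q (f 0) (f 1) * k' 0 = (q ^ 2)⁻¹ • (k' 0 * braidF q (f 0) (f 1)) := by
      rw [hk, smul_smul, inv_mul_cancel₀ (pow_ne_zero 2 hq), one_smul]
    rw [mul_neg, neg_mul, ← mul_assoc, hk', smul_mul_assoc, mul_assoc, hb, mul_smul_comm, smul_smul,
      inv_mul_cancel₀ (pow_ne_zero 2 hq), one_smul, mul_assoc]
  · exact braidF_mul_rootVec hq h2 h1 R

end QuantumRel

end BraidAction

/-! ### Nonvanishing of polynomials in q, and small quantum integers -/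

section Parameter

theorem q_ne_zero : q ≠ 0 := RatFunc.X_ne_zero

theorem aeval_q_ne_zero {p : Polynomial ℚ} (hp : p ≠ 0) : Polynomial.aeval q p ≠ 0 := by
  have : Polynomial.aeval q p = algebraMap (Polynomial ℚ) Kq p := by
    rw [q, ← RatFunc.algebraMap_X, Polynomial.aeval_algebraMap_apply, Polynomial.aeval_X_left_apply]
  rw [this]
  exact (map_ne_zero_iff _ (RatFunc.algebraMap_injective ℚ)).2 hp

theorem q_sq_add_one_ne_zero : q ^ 2 + 1 ≠ 0 := by
  have h : (Polynomial.X ^ 2 + 1 : Polynomial ℚ) ≠ 0 := fun h => by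
    simpa using congrArg (Polynomial.eval 0) h
  simpa using aeval_q_ne_zero h

theorem q_sq_sub_one_ne_zero : q ^ 2 - 1 ≠ 0 := by
  have h : (Polynomial.X ^ 2 - 1 : Polynomial ℚ) ≠ 0 := fun h => by
    simpa using congrArg (Polynomial.eval 0) h
  simpa using aeval_q_ne_zero h

theorem q_pow_four_add_one_ne_zero : q ^ 4 + 1 ≠ 0 := by
  have h : (Polynomial.X ^ 4 + 1 : Polynomial ℚ) ≠ 0 := fun h => by
    simpa using congrArg (Polynomial.eval 0) h
  simpa using aeval_q_ne_zero h

theorem q_pow_four_add_sq_add_one_ne_zero : q ^ 4 + q ^ 2 + 1 ≠ 0 := by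
  have h : (Polynomial.X ^ 4 + Polynomial.X ^ 2 + 1 : Polynomial ℚ) ≠ 0 := fun h => by
    simpa using congrArg (Polynomial.eval 0) h
  simpa using aeval_q_ne_zero h

theorem q_add_inv_ne_zero : q + q⁻¹ ≠ 0 := fun h => q_sq_add_one_ne_zero <| by
  have := q_ne_zero
  field_simp at h; linear_combination h

theorem q_sub_inv_ne_zero : q - q⁻¹ ≠ 0 := fun h => q_sq_sub_one_ne_zero <| by
  have := q_ne_zero
  field_simp at h; linear_combination h

theorem q_sq_add_one_add_inv_ne_zero : q ^ 2 + 1 + (q ^ 2)⁻¹ ≠ 0 := fun h =>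
  q_pow_four_add_sq_add_one_ne_zero <| by
  have := q_ne_zero
  field_simp at h; linear_combination h

theorem q_sq_add_inv_ne_zero : q ^ 2 + (q ^ 2)⁻¹ ≠ 0 := fun h => q_pow_four_add_one_ne_zero <| by
  have := q_ne_zero
  field_simp at h; linear_combination h

theorem qInt_one : qInt 1 = 1 := by
  rw [qInt, zpow_one, zpow_neg_one, div_self q_sub_inv_ne_zero]

theorem qInt_two : qInt 2 = q + q⁻¹ := by
  rw [qInt, div_eq_iff q_sub_inv_ne_zero, zpow_neg]
  have := q_ne_zero
  norm_cast
  field_simp; ring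

theorem qInt_three : qInt 3 = q ^ 2 + 1 + (q ^ 2)⁻¹ := by
  rw [qInt, div_eq_iff q_sub_inv_ne_zero, zpow_neg]
  have := q_ne_zero
  norm_cast
  field_simp; ring

end Parameter

/-! ### The root vectors of the quantized enveloping algebra -/

section RootVectorsInUqg

theorem map_imagVec {A B : Type*} [Ring A] [Ring B] [Algebra Kq A] [Algebra Kq B] (φ : A →ₐ[Kq] B)
    (x y : A) : φ (imagVec q x y) = imagVec q (φ x) (φ y) := by
  simp only [imagVec, map_sub, map_mul, map_smul]

theorem map_rootVec {A B : Type*} [Ring A] [Ring B] [Algebra Kq A] [Algebra Kq B] (φ : A →ₐ[Kq] B)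
    (x y : A) (k : ℕ) : φ (rootVec q x y k) = rootVec q (φ x) (φ y) k := by
  induction k with
  | zero => rfl
  | succ k ih => simp only [rootVec, map_smul, map_sub, map_mul, ih, map_imagVec]

theorem map_serreExpr {A B : Type*} [Ring A] [Ring B] [Algebra Kq A] [Algebra Kq B]
    (φ : A →ₐ[Kq] B) (x y : A) : φ (serreExpr q x y) = serreExpr q (φ x) (φ y) := by
  simp only [serreExpr, map_smul, map_sub, map_add, map_mul, map_pow]

theorem serre_eq_serreExpr (x y : FreeUq) : serre x y = serreExpr q x y := by
  rw [serre, serreExpr, qInt_three]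

theorem qFact_zero : qFact 0 = 1 := by simp [qFact]

theorem qFact_one : qFact 1 = 1 := by simp [qFact, qInt_one]

theorem qFact_two : qFact 2 = q + q⁻¹ := by
  simp [qFact, Finset.prod_range_succ, qInt_one, one_add_one_eq_two, qInt_two]

theorem rootVec_one_eq_sum {A : Type*} [Ring A] [Algebra Kq A] (x y : A) :
    ∑ r ∈ Finset.range 3, ((-1) ^ r * q ^ (-(r : ℤ))) •
      (((qFact r)⁻¹ • x ^ r) * y * ((qFact (2 - r))⁻¹ • x ^ (2 - r))) = rootVec q x y 1 := by
  rw [rootVec_one_expand q_ne_zero q_add_inv_ne_zero]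
  simp [Finset.sum_range_succ, qFact_zero, qFact_one, qFact_two, zpow_neg]

theorem braidF_eq_sum {A : Type*} [Ring A] [Algebra Kq A] (x y : A) :
    ∑ r ∈ Finset.range 3, ((-1) ^ r * q ^ (r : ℤ)) •
      (((qFact (2 - r))⁻¹ • x ^ (2 - r)) * y * ((qFact r)⁻¹ • x ^ r)) = braidF q x y := by
  simp [Finset.sum_range_succ, qFact_zero, qFact_one, qFact_two, braidF, pow_two, mul_assoc,
    smul_smul, sub_eq_add_neg]

theorem lusztigT_fE_ne {i j : Fin 2} (h : j ≠ i) :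
    lusztigT i (fE j) = rootVec q (fE i) (fE j) 1 := by
  rw [lusztigT, fE, FreeAlgebra.lift_ι_apply, lusztigTGen, if_neg h]
  exact rootVec_one_eq_sum (fE i) (fE j)

theorem lusztigT_fF_ne {i j : Fin 2} (h : j ≠ i) :
    lusztigT i (fF j) = braidF q (fF i) (fF j) := by
  rw [lusztigT, fF, FreeAlgebra.lift_ι_apply, lusztigTGen, if_neg h]
  exact braidF_eq_sum (fF i) (fF j)

theorem lusztigT_fE_same (i : Fin 2) : lusztigT i (fE i) = -(fKinv i * fF i) := by
  rw [lusztigT, fE, FreeAlgebra.lift_ι_apply]; simp [lusztigTGen]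

/-- `E_i` in `U_q(𝔤)`. -/
noncomputable abbrev gE (i : Fin 2) : Uqg := toUqg (fE i)
/-- `F_i` in `U_q(𝔤)`. -/
noncomputable abbrev gF (i : Fin 2) : Uqg := toUqg (fF i)
/-- `K_i` in `U_q(𝔤)`. -/
noncomputable abbrev gK (i : Fin 2) : Uqg := toUqg (fK i)
/-- `K_i⁻¹` in `U_q(𝔤)`. -/
noncomputable abbrev gKinv (i : Fin 2) : Uqg := toUqg (fKinv i)

theorem toUqg_rel {x y : FreeUq} (h : Rel x y) : toUqg x = toUqg y :=
  RingQuot.mkAlgHom_rel Kq h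

theorem quantumRel_uqg : QuantumRel q gE gF gK gKinv where
  k_comm i j := by simpa only [map_mul] using toUqg_rel (Rel.K_comm i j)
  k_mul_k' i := by simpa only [map_mul, map_one] using toUqg_rel (Rel.K_mul_Kinv i)
  k'_mul_k i := by simpa only [map_mul, map_one] using toUqg_rel (Rel.Kinv_mul_K i)
  k_e i j := by simpa only [map_mul, map_smul] using toUqg_rel (Rel.K_E i j)
  k_f i j := by simpa only [map_mul, map_smul] using toUqg_rel (Rel.K_F i j)
  e_f_same i := by simpa only [map_mul, map_smul, map_sub] using toUqg_rel (Rel.E_F_same i)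
  e_f_ne i j h := by simpa only [map_mul, map_sub, map_zero] using toUqg_rel (Rel.E_F_ne i j h)

theorem serreExpr_gE {i j : Fin 2} (h : i ≠ j) : serreExpr q (gE i) (gE j) = 0 := by
  simpa only [serre_eq_serreExpr, map_serreExpr, map_zero] using toUqg_rel (Rel.serre_E i j h)

theorem serreExpr_gF {i j : Fin 2} (h : i ≠ j) : serreExpr q (gF i) (gF j) = 0 := by
  simpa only [serre_eq_serreExpr, map_serreExpr, map_zero] using toUqg_rel (Rel.serre_F i j h)

theorem lusztigT_fKinv (i j : Fin 2) :
    lusztigT i (fKinv j) = fKinv j * fKpow i (cartan i j) := by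
  rw [lusztigT, fKinv, FreeAlgebra.lift_ι_apply]; rfl

/-- T₁T₂(E₁) is the first bracket formed from T₁(E₂) and T₁(E₁). The imaginary vector of this pair
is again w, so the result is [2]⁻¹[w, v₁] = v₂; the same argument one step further gives v₃. -/
theorem v_eq_rootVec : v = fun i : Fin 4 => rootVec q (gE 0) (gE 1) i := by
  have h01 : lusztigT 0 (fE 1) = rootVec q (fE 0) (fE 1) 1 := lusztigT_fE_ne (by decide)
  have h10 : lusztigT 1 (fE 0) = rootVec q (fE 1) (fE 0) 1 := lusztigT_fE_ne (by decide)
  have e1 : toUqg (lusztigT 0 (fE 1)) = rootVec q (gE 0) (gE 1) 1 := by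
    rw [h01, map_rootVec]
  have e0 : toUqg (lusztigT 0 (fE 0)) = -(gKinv 0 * gF 0) := by
    rw [lusztigT_fE_same, map_neg, map_mul]
  have e2' : toUqg (lusztigT 0 (lusztigT 1 (fE 0))) =
      rootVec q (rootVec q (gE 0) (gE 1) 1) (-(gKinv 0 * gF 0)) 1 := by
    rw [h10, map_rootVec, map_rootVec, e1, e0]
  have e2 : toUqg (lusztigT 0 (lusztigT 1 (fE 0))) = rootVec q (gE 0) (gE 1) 2 := by
    rw [e2', rootVec_one, quantumRel_uqg.imagVec_braid_first q_ne_zero q_add_inv_ne_zero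
      q_sub_inv_ne_zero]
    rfl
  have eF : toUqg (lusztigT 0 (lusztigT 1 (fE 1))) =
      -((gKinv 1 * gKinv 0 ^ 2) * braidF q (gF 0) (gF 1)) := by
    rw [lusztigT_fE_same, map_neg, map_mul, lusztigT_fKinv, lusztigT_fF_ne (by decide)]
    have c01 : cartan 0 1 = -2 := rfl
    have hb : toUqg (braidF q (fF 0) (fF 1)) = braidF q (gF 0) (gF 1) := by
      simp only [braidF, map_add, map_sub, map_smul, map_mul]
    rw [c01, fKpow, map_neg, map_mul, map_mul, hb]
    simp
  have e3 : toUqg (lusztigT 0 (lusztigT 1 (lusztigT 0 (fE 1)))) = rootVec q (gE 0) (gE 1) 3 := by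
    rw [h01, map_rootVec, map_rootVec, map_rootVec, rootVec_one, eF, e2', quantumRel_uqg.imagVec_braid_second
      q_ne_zero q_add_inv_ne_zero q_sub_inv_ne_zero (serreExpr_gF (by decide)), ← e2', e2]
    rfl
  funext i
  fin_cases i
  · rfl
  · exact e1
  · exact e2
  · exact e3

theorem straightening_v : Straightening q v := by
  rw [v_eq_rootVec]
  exact straightening_rootVec q_ne_zero q_add_inv_ne_zero q_sq_add_one_add_inv_ne_zero
    q_sq_add_inv_ne_zero (serreExpr_gE (by decide)) (serreExpr_gE (by decide))

end RootVectorsInUqg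

/-! ### Serre elements against the opposite generators, and in triangular matrices -/

section SerreCommutation

variable {K A : Type*} [Field K] [Ring A] [Algebra K A] {q : K}

theorem commute_serreExpr_left (hq : q ≠ 0) {a b f k k' : A} {c : K}
    (hka : k * a = q ^ 2 • (a * k)) (hkb : k * b = (q ^ 2)⁻¹ • (b * k))
    (hka' : k' * a = (q ^ 2)⁻¹ • (a * k')) (hkb' : k' * b = q ^ 2 • (b * k'))
    (hfa : f * a = a * f + c • (k - k')) (hfb : f * b = b * f) :
    f * serreExpr q a b = serreExpr q a b * f := by
  have a1 := mul_left_comm_of hka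
  have a2 := mul_left_comm_of hkb
  have a3 := mul_left_comm_of hka'
  have a4 := mul_left_comm_of hkb'
  have a5 : ∀ z, f * (b * z) = b * (f * z) := fun z => by rw [← mul_assoc, hfb, mul_assoc]
  have a6 : ∀ z, f * (a * z) = a * (f * z) + c • (k * z - k' * z) := fun z => by
    rw [← mul_assoc, hfa]; simp only [sub_mul, add_mul, smul_mul_assoc, mul_assoc]
  simp only [serreExpr, pow_succ, pow_zero, one_mul, mul_sub, sub_mul, mul_add, add_mul,
    smul_mul_assoc, mul_smul_comm, smul_sub, smul_add, smul_smul, mul_assoc, hka, hkb, hka', hkb',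
    hfa, hfb, a1, a2, a3, a4, a5, a6]
  match_scalars <;> field_simp <;> ring

theorem commute_serreExpr_right (hq : q ≠ 0) {a b f k k' : A} {c : K}
    (hkb : k * b = (q ^ 2)⁻¹ • (b * k)) (hkb' : k' * b = q ^ 2 • (b * k'))
    (hfa : f * a = a * f + c • (k - k')) (hfb : f * b = b * f) :
    f * serreExpr q b a = serreExpr q b a * f := by
  have a2 := mul_left_comm_of hkb
  have a4 := mul_left_comm_of hkb'
  have a5 : ∀ z, f * (b * z) = b * (f * z) := fun z => by rw [← mul_assoc, hfb, mul_assoc]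
  have a6 : ∀ z, f * (a * z) = a * (f * z) + c • (k * z - k' * z) := fun z => by
    rw [← mul_assoc, hfa]; simp only [sub_mul, add_mul, smul_mul_assoc, mul_assoc]
  simp only [serreExpr, pow_succ, pow_zero, one_mul, mul_sub, sub_mul, mul_add, add_mul,
    smul_mul_assoc, mul_smul_comm, smul_sub, smul_add, smul_smul, mul_assoc, hkb, hkb',
    hfa, hfb, a2, a4, a5, a6]
  match_scalars <;> field_simp <;> ring

/-- The Serre elements in the F's are singular: this holds without imposing any Serre relation, and
is what makes them act by zero on the Verma module. -/
theorem QuantumRel.e_mul_serreExpr_f (hq : q ≠ 0) {e f k k' : Fin 2 → A}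
    (R : QuantumRel q e f k k') {i j : Fin 2} (h : i ≠ j) (l : Fin 2) :
    e l * serreExpr q (f i) (f j) = serreExpr q (f i) (f j) * e l := by
  have z2 : q ^ (2 : ℤ) = q ^ 2 := by norm_cast
  have z2' : q ^ (-2 : ℤ) = (q ^ 2)⁻¹ := by rw [zpow_neg, z2]
  have cs : ∀ i, cartan i i = 2 := by decide
  have cn : ∀ i j, i ≠ j → cartan i j = -2 := fun i j h => by
    fin_cases i <;> fin_cases j <;> first | exact absurd rfl h | rfl
  have hef : ∀ i, e i * f i = f i * e i + (-(q - q⁻¹)⁻¹) • (k' i - k i) := fun i => by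
    rw [R.f_mul_e_same]; module
  have hk1 : ∀ i, k' i * f i = q ^ 2 • (f i * k' i) := fun i => by rw [R.k'_mul_f hq, cs, z2]
  have hk2 : ∀ i j, i ≠ j → k' i * f j = (q ^ 2)⁻¹ • (f j * k' i) := fun i j h => by
    rw [R.k'_mul_f hq, cn i j h, z2']
  have hk3 : ∀ i, k i * f i = (q ^ 2)⁻¹ • (f i * k i) := fun i => by rw [R.k_mul_f, cs, z2']
  have hk4 : ∀ i j, i ≠ j → k i * f j = q ^ 2 • (f j * k i) := fun i j h => by
    rw [R.k_mul_f, cn i j h, neg_neg, z2]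
  have hl : l = i ∨ l = j := by omega
  rcases hl with rfl | rfl
  · exact commute_serreExpr_left hq (hk1 _) (hk2 _ _ h) (hk3 _) (hk4 _ _ h) (hef _)
      (R.f_mul_e_ne h).symm
  · exact commute_serreExpr_right hq (hk2 _ _ h.symm) (hk4 _ _ h.symm) (hef _)
      (R.f_mul_e_ne h.symm).symm

/-- A homomorphism to upper triangular matrices is a pair of diagonal homomorphisms together with a
skew derivation in the corner. Vanishing of the corner entry means that the skew derivation respects
the Serre relation. -/
theorem serreExpr_triangular_left (hq : q ≠ 0) {a b : A} {t : K} (ht : t = q ^ 2 ∨ t = (q ^ 2)⁻¹)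
    (h : serreExpr q a b = 0) :
    serreExpr q (!![a, 1; 0, t • a] : Matrix (Fin 2) (Fin 2) A) !![b, 0; 0, t⁻¹ • b] = 0 := by
  have h11 : serreExpr q (t • a) (t⁻¹ • b) = (t ^ 3 * t⁻¹) • serreExpr q a b := by
    simp only [serreExpr, pow_succ, pow_zero, one_mul, smul_mul_assoc, mul_smul_comm, smul_smul,
      smul_add, smul_sub]
    match_scalars <;> ring
  rw [h, smul_zero] at h11
  ext i j
  fin_cases i <;> fin_cases j
  · refine Eq.trans ?_ h
    simp [serreExpr, pow_succ]
  · simp only [serreExpr, pow_succ, pow_zero, one_mul, Fin.zero_eta, Fin.mk_one, Matrix.sub_apply,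
      Matrix.add_apply, Matrix.smul_apply, Matrix.mul_apply, Fin.sum_univ_two, Matrix.of_apply,
      Matrix.cons_val', Matrix.cons_val_zero, Matrix.cons_val_one, Matrix.cons_val_fin_one,
      mul_one, mul_zero, zero_mul, zero_add, smul_mul_assoc, mul_smul_comm, smul_smul,
      smul_add, mul_add, add_mul, mul_assoc, Matrix.zero_apply]
    rcases ht with rfl | rfl <;> match_scalars <;> field_simp <;> ring
  · simp [serreExpr, pow_succ]
  · refine Eq.trans ?_ h11
    simp [serreExpr, pow_succ]
    match_scalars <;> ring

theorem serreExpr_triangular_right (hq : q ≠ 0) {a b : A} {t : K}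
    (ht : t = q ^ 2 ∨ t = (q ^ 2)⁻¹) (h : serreExpr q b a = 0) :
    serreExpr q (!![b, 0; 0, t⁻¹ • b] : Matrix (Fin 2) (Fin 2) A) !![a, 1; 0, t • a] = 0 := by
  have h11 : serreExpr q (t⁻¹ • b) (t • a) = (t⁻¹ ^ 3 * t) • serreExpr q b a := by
    simp only [serreExpr, pow_succ, pow_zero, one_mul, smul_mul_assoc, mul_smul_comm, smul_smul,
      smul_add, smul_sub]
    match_scalars <;> ring
  rw [h, smul_zero] at h11
  ext i j
  fin_cases i <;> fin_cases j
  · refine Eq.trans ?_ h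
    simp [serreExpr, pow_succ]
  · simp only [serreExpr, pow_succ, pow_zero, one_mul, Fin.zero_eta, Fin.mk_one, Matrix.sub_apply,
      Matrix.add_apply, Matrix.smul_apply, Matrix.mul_apply, Fin.sum_univ_two, Matrix.of_apply,
      Matrix.cons_val', Matrix.cons_val_zero, Matrix.cons_val_one, Matrix.cons_val_fin_one,
      mul_one, mul_zero, zero_mul, zero_add, smul_mul_assoc, mul_smul_comm, smul_smul,
      smul_add, mul_add, add_mul, mul_assoc, Matrix.zero_apply]
    rcases ht with rfl | rfl <;> match_scalars <;> field_simp <;> ring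
  · simp [serreExpr, pow_succ]
  · refine Eq.trans ?_ h11
    simp [serreExpr, pow_succ]
    match_scalars <;> ring

end SerreCommutation

/-! ### The algebra of the Serre relations and its embedding through a Verma module -/

section PositivePart

/-- The quantized Serre relations. -/
inductive SerreRel : FreeAlgebra Kq (Fin 2) → FreeAlgebra Kq (Fin 2) → Prop
  | mk (i j : Fin 2) (h : i ≠ j) :
      SerreRel (serreExpr q (FreeAlgebra.ι Kq i) (FreeAlgebra.ι Kq j)) 0

/-- The algebra with two generators and the quantized Serre relations. -/
def PosAlg : Type := RingQuot SerreRel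

noncomputable instance : Ring PosAlg := inferInstanceAs (Ring (RingQuot SerreRel))

noncomputable instance : Algebra Kq PosAlg := inferInstanceAs (Algebra Kq (RingQuot SerreRel))

/-- The quotient map onto `PosAlg`. -/
noncomputable def toPosAlg : FreeAlgebra Kq (Fin 2) →ₐ[Kq] PosAlg := RingQuot.mkAlgHom Kq SerreRel

/-- The generators of `PosAlg`. -/
noncomputable def posGen (i : Fin 2) : PosAlg := toPosAlg (FreeAlgebra.ι Kq i)

theorem serreExpr_posGen {i j : Fin 2} (h : i ≠ j) : serreExpr q (posGen i) (posGen j) = 0 := by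
  have : toPosAlg _ = toPosAlg _ := RingQuot.mkAlgHom_rel Kq (SerreRel.mk i j h)
  rwa [map_serreExpr, map_zero] at this

/-- The universal property of `PosAlg`. -/
noncomputable def posLift {A : Type*} [Ring A] [Algebra Kq A] (a : Fin 2 → A)
    (h : ∀ i j, i ≠ j → serreExpr q (a i) (a j) = 0) : PosAlg →ₐ[Kq] A :=
  RingQuot.liftAlgHom Kq ⟨FreeAlgebra.lift Kq a, fun _ _ r => by
    obtain ⟨i, j, hij⟩ := r
    rw [map_serreExpr, map_zero, FreeAlgebra.lift_ι_apply, FreeAlgebra.lift_ι_apply, h i j hij]⟩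

theorem posLift_gen {A : Type*} [Ring A] [Algebra Kq A] (a : Fin 2 → A)
    (h : ∀ i j, i ≠ j → serreExpr q (a i) (a j) = 0) (i : Fin 2) :
    posLift a h (posGen i) = a i := by
  refine (RingQuot.liftAlgHom_mkAlgHom_apply Kq _ _ _).trans ?_
  rw [FreeAlgebra.lift_ι_apply]

theorem posAlg_induction {p : PosAlg → Prop} (add : ∀ y z, p y → p z → p (y + z))
    (smul : ∀ (c : Kq) y, p y → p (c • y)) (one : p 1)
    (gen_mul : ∀ i y, p y → p (posGen i * y)) (y : PosAlg) : p y := by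
  obtain ⟨y, rfl⟩ : ∃ z, toPosAlg z = y := RingQuot.mkAlgHom_surjective Kq SerreRel y
  -- Stability under left multiplication by y is the statement that passes through products of free
  -- algebra elements.
  suffices h : ∀ z, p z → p (toPosAlg y * z) by simpa using h 1 one
  induction y using FreeAlgebra.induction with
  | grade0 r => intro z hz; rw [AlgHom.commutes, ← Algebra.smul_def]; exact smul _ _ hz
  | grade1 i => intro z hz; exact gen_mul i z hz
  | mul a b ha hb => intro z hz; rw [map_mul, mul_assoc]; exact ha _ (hb _ hz)
  | add a b ha hb => intro z hz; rw [map_add, add_mul]; exact add _ _ (ha _ hz) (hb _ hz)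

theorem posAlg_hom_ext {A : Type*} [Ring A] [Algebra Kq A] {φ ψ : PosAlg →ₐ[Kq] A}
    (h : ∀ i, φ (posGen i) = ψ (posGen i)) : φ = ψ := by
  refine AlgHom.ext fun y => ?_
  induction y using posAlg_induction with
  | add y z hy hz => rw [map_add, map_add, hy, hz]
  | smul c y hy => rw [map_smul, map_smul, hy]
  | one => rw [map_one, map_one]
  | gen_mul i y hy => rw [map_mul, map_mul, h, hy]

theorem serreExpr_smul {A : Type*} [Ring A] [Algebra Kq A] (c d : Kq) (x y : A) :
    serreExpr q (c • x) (d • y) = (c ^ 3 * d) • serreExpr q x y := by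
  simp only [serreExpr, pow_succ, pow_zero, one_mul, smul_mul_assoc, mul_smul_comm, smul_smul,
    smul_add, smul_sub]
  congr! 3
  all_goals ring_nf

/-- The automorphism of `PosAlg` which scales the generators by powers of `q`. -/
noncomputable def posScale (m : Fin 2 → ℤ) : PosAlg →ₐ[Kq] PosAlg :=
  posLift (fun j => q ^ m j • posGen j) fun i j h => by
    rw [serreExpr_smul, serreExpr_posGen h, smul_zero]

theorem posScale_gen (m : Fin 2 → ℤ) (j : Fin 2) : posScale m (posGen j) = q ^ m j • posGen j :=
  posLift_gen _ _ j

theorem posScale_comp (m n : Fin 2 → ℤ) : (posScale m).comp (posScale n) = posScale (m + n) := by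
  refine posAlg_hom_ext fun i => ?_
  rw [AlgHom.comp_apply, posScale_gen, map_smul, posScale_gen, posScale_gen, smul_smul,
    Pi.add_apply, add_comm, zpow_add₀ q_ne_zero]

theorem posScale_zero : posScale 0 = AlgHom.id Kq PosAlg := by
  refine posAlg_hom_ext fun i => ?_
  rw [posScale_gen]; simp

theorem posScale_posScale (m n : Fin 2 → ℤ) (y : PosAlg) :
    posScale m (posScale n y) = posScale (m + n) y := by
  rw [← posScale_comp]; rfl

/-- The homomorphism into triangular matrices whose off-diagonal entry is a skew derivation. -/
noncomputable def posTriangular (i : Fin 2) (ε : ℤˣ) : PosAlg →ₐ[Kq] Matrix (Fin 2) (Fin 2) PosAlg :=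
  posLift (fun j => !![posGen j, if j = i then 1 else 0; 0, q ^ (ε * cartan i j) • posGen j])
    fun j l h => by
      have z2 : q ^ (2 : ℤ) = q ^ 2 := by norm_cast
      have z2' : q ^ (-2 : ℤ) = (q ^ 2)⁻¹ := by rw [zpow_neg, z2]
      have cs : cartan i i = 2 := by revert i; decide
      have cn : ∀ j, i ≠ j → cartan i j = -2 := fun j h => by
        fin_cases i <;> fin_cases j <;> first | exact absurd rfl h | rfl
      have ht : q ^ ((ε : ℤ) * 2) = q ^ 2 ∨ q ^ ((ε : ℤ) * 2) = (q ^ 2)⁻¹ := by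
        rcases Int.units_eq_one_or ε with rfl | rfl <;> simp [z2, zpow_neg]
      have hn : q ^ ((ε : ℤ) * -2) = (q ^ ((ε : ℤ) * 2))⁻¹ := by rw [mul_neg, zpow_neg]
      by_cases hj : j = i
      · subst hj
        simp only [if_true, if_neg h.symm, cs, cn l h, hn]
        exact serreExpr_triangular_left q_ne_zero ht (serreExpr_posGen h)
      · have hl : l = i := by omega
        subst hl
        simp only [if_true, if_neg hj, cs, cn j (Ne.symm hj), hn]
        exact serreExpr_triangular_right q_ne_zero ht (serreExpr_posGen h)

/-- The skew derivations of `PosAlg`. -/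
noncomputable def posDer (i : Fin 2) (ε : ℤˣ) : PosAlg →ₗ[Kq] PosAlg where
  toFun y := posTriangular i ε y 0 1
  map_add' y z := by rw [map_add, Matrix.add_apply]
  map_smul' c y := by rw [map_smul, Matrix.smul_apply, RingHom.id_apply]

theorem posTriangular_diag (i : Fin 2) (ε : ℤˣ) (y : PosAlg) :
    posTriangular i ε y 1 1 = posScale (fun j => ε * cartan i j) y := by
  induction y using posAlg_induction with
  | add y z hy hz => rw [map_add, Matrix.add_apply, hy, hz, map_add]
  | smul c y hy => rw [map_smul, Matrix.smul_apply, hy, map_smul]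
  | one => rw [map_one, map_one, Matrix.one_apply_eq]
  | gen_mul j y hy =>
    rw [map_mul, map_mul, Matrix.mul_apply, Fin.sum_univ_two, hy, posTriangular, posLift_gen,
      posScale_gen]
    simp

theorem posDer_one (i : Fin 2) (ε : ℤˣ) : posDer i ε 1 = 0 := by
  change posTriangular i ε 1 0 1 = 0
  rw [map_one]; simp

theorem posDer_gen_mul (i : Fin 2) (ε : ℤˣ) (j : Fin 2) (y : PosAlg) :
    posDer i ε (posGen j * y) = posGen j * posDer i ε y +
      if j = i then posScale (fun j => ε * cartan i j) y else 0 := by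
  change posTriangular i ε (posGen j * y) 0 1 = posGen j * posTriangular i ε y 0 1 + _
  rw [map_mul, Matrix.mul_apply, Fin.sum_univ_two, posTriangular_diag]
  nth_rw 1 [posTriangular]
  nth_rw 2 [posTriangular]
  rw [posLift_gen]
  split_ifs <;> simp

/-- The skew derivation lowers the weight by the simple root with index i, which accounts for the
power of q; this yields the relation between K and F. -/
theorem posScale_posDer (m : Fin 2 → ℤ) (i : Fin 2) (ε : ℤˣ) (y : PosAlg) :
    posScale m (posDer i ε y) = q ^ (-m i) • posDer i ε (posScale m y) := by
  induction y using posAlg_induction with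
  | add y z hy hz => simp only [map_add, hy, hz, smul_add]
  | smul c y hy => simp only [map_smul, hy, smul_comm c]
  | one => simp [posDer_one]
  | gen_mul j y hy =>
    simp only [posDer_gen_mul, map_add, map_mul, hy, posScale_gen, smul_mul_assoc, map_smul,
      smul_smul, smul_add, mul_smul_comm]
    rw [mul_comm]
    congr 1
    split_ifs with h
    · subst h
      rw [← zpow_add₀ q_ne_zero, add_neg_cancel, zpow_zero, one_smul, posScale_posScale,
        posScale_posScale, add_comm]
    · rw [map_zero, smul_zero]

/-- Left multiplication by the generators of `PosAlg`. -/
noncomputable def vermaE (i : Fin 2) : Module.End Kq PosAlg := Algebra.lmul Kq PosAlg (posGen i)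

/-- The action of `F_i` on `PosAlg`. -/
noncomputable def vermaF (i : Fin 2) : Module.End Kq PosAlg :=
  -((q - q⁻¹)⁻¹ • (posDer i 1 - posDer i (-1)))

/-- The action of `K_i` on `PosAlg`. -/
noncomputable def vermaK (i : Fin 2) : Module.End Kq PosAlg :=
  (posScale fun j => cartan i j).toLinearMap

/-- The action of `K_i⁻¹` on `PosAlg`. -/
noncomputable def vermaKinv (i : Fin 2) : Module.End Kq PosAlg :=
  (posScale fun j => -cartan i j).toLinearMap

theorem vermaE_apply (i : Fin 2) (y : PosAlg) : vermaE i y = posGen i * y := rfl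

theorem vermaK_apply (i : Fin 2) (y : PosAlg) :
    vermaK i y = posScale (fun j => cartan i j) y := rfl

theorem vermaKinv_apply (i : Fin 2) (y : PosAlg) :
    vermaKinv i y = posScale (fun j => -cartan i j) y := rfl

theorem vermaF_apply (i : Fin 2) (y : PosAlg) :
    vermaF i y = -((q - q⁻¹)⁻¹ • (posDer i 1 y - posDer i (-1) y)) := rfl

theorem vermaF_one (i : Fin 2) : vermaF i 1 = 0 := by
  simp [vermaF_apply, posDer_one]

theorem vermaF_gen_mul (i j : Fin 2) (y : PosAlg) :
    vermaF i (posGen j * y) = posGen j * vermaF i y -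
      if j = i then (q - q⁻¹)⁻¹ • (vermaK i y - vermaKinv i y) else 0 := by
  simp only [vermaF_apply, posDer_gen_mul, vermaK_apply, vermaKinv_apply, Units.val_one, one_mul,
    Units.val_neg, neg_mul]
  split_ifs
  · simp only [mul_neg, mul_smul_comm, mul_sub, smul_sub, smul_add]; abel
  · simp only [mul_neg, mul_smul_comm, mul_sub, add_zero, sub_zero]

theorem quantumRel_verma : QuantumRel q vermaE vermaF vermaK vermaKinv where
  k_comm i j := LinearMap.ext fun y => by
    simp only [Module.End.mul_apply, vermaK_apply, posScale_posScale, add_comm]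
  k_mul_k' i := LinearMap.ext fun y => by
    simp only [Module.End.mul_apply, vermaK_apply, vermaKinv_apply, posScale_posScale]
    have : ((fun j => cartan i j) + fun j => -cartan i j) = 0 := by funext j; simp
    rw [this, posScale_zero]; rfl
  k'_mul_k i := LinearMap.ext fun y => by
    simp only [Module.End.mul_apply, vermaK_apply, vermaKinv_apply, posScale_posScale]
    have : ((fun j => -cartan i j) + fun j => cartan i j) = 0 := by funext j; simp
    rw [this, posScale_zero]; rfl
  k_e i j := LinearMap.ext fun y => by
    have : ((fun j => cartan i j) + fun j => -cartan i j) = 0 := by funext j; simp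
    simp only [Module.End.mul_apply, vermaK_apply, vermaKinv_apply, vermaE_apply, map_mul,
      posScale_posScale, posScale_gen, LinearMap.smul_apply, smul_mul_assoc, this, posScale_zero,
      AlgHom.id_apply]
  k_f i j := LinearMap.ext fun y => by
    have : ((fun j => cartan i j) + fun j => -cartan i j) = 0 := by funext j; simp
    simp only [Module.End.mul_apply, vermaK_apply, vermaKinv_apply, vermaF_apply, map_neg,
      map_smul, map_sub, posScale_posDer, posScale_posScale, LinearMap.smul_apply, this,
      posScale_zero, AlgHom.id_apply, ← smul_sub, smul_neg]
    rw [smul_comm]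
  e_f_same i := LinearMap.ext fun y => by
    simp only [LinearMap.sub_apply, Module.End.mul_apply, vermaE_apply, vermaF_gen_mul, if_true,
      LinearMap.smul_apply, sub_sub_cancel]
  e_f_ne i j h := LinearMap.ext fun y => by
    simp only [LinearMap.sub_apply, Module.End.mul_apply, vermaE_apply, vermaF_gen_mul, if_neg h,
      sub_zero, sub_self, LinearMap.zero_apply]

theorem serreExpr_vermaE {i j : Fin 2} (h : i ≠ j) :
    serreExpr q (vermaE i) (vermaE j) = 0 := by
  refine (map_serreExpr (Algebra.lmul Kq PosAlg) _ _).symm.trans ?_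
  rw [serreExpr_posGen h, map_zero]

/-- The operator kills 1, as every F does, and commutes with left multiplication by the generators,
so it kills everything. -/
theorem serreExpr_vermaF {i j : Fin 2} (h : i ≠ j) :
    serreExpr q (vermaF i) (vermaF j) = 0 := by
  refine LinearMap.ext fun y => ?_
  rw [LinearMap.zero_apply]
  induction y using posAlg_induction with
  | add y z hy hz => rw [map_add, hy, hz, add_zero]
  | smul c y hy => rw [map_smul, hy, smul_zero]
  | one => simp [serreExpr, pow_succ, Module.End.mul_apply, vermaF_one]
  | gen_mul l y hy =>
    have := LinearMap.congr_fun (quantumRel_verma.e_mul_serreExpr_f q_ne_zero h l) y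
    rw [Module.End.mul_apply, Module.End.mul_apply, hy, map_zero] at this
    exact this.symm

/-- The values of the generators of `U_q(𝔤)` in its representation on `PosAlg`. -/
noncomputable def vermaGen : Gen → Module.End Kq PosAlg
  | Gen.E i => vermaE i
  | Gen.F i => vermaF i
  | Gen.K i => vermaK i
  | Gen.Kinv i => vermaKinv i

/-- The representation of `U_q(𝔤)` on `PosAlg`, a Verma module. -/
noncomputable def verma : Uqg →ₐ[Kq] Module.End Kq PosAlg :=
  RingQuot.liftAlgHom Kq ⟨FreeAlgebra.lift Kq vermaGen, fun x y r => by
    have R := quantumRel_verma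
    have hE : ∀ i, FreeAlgebra.lift Kq vermaGen (fE i) = vermaE i := fun i =>
      FreeAlgebra.lift_ι_apply _ _
    have hF : ∀ i, FreeAlgebra.lift Kq vermaGen (fF i) = vermaF i := fun i =>
      FreeAlgebra.lift_ι_apply _ _
    have hK : ∀ i, FreeAlgebra.lift Kq vermaGen (fK i) = vermaK i := fun i =>
      FreeAlgebra.lift_ι_apply _ _
    have hK' : ∀ i, FreeAlgebra.lift Kq vermaGen (fKinv i) = vermaKinv i := fun i =>
      FreeAlgebra.lift_ι_apply _ _
    cases r with
    | K_comm i j => simp only [map_mul, hK]; exact R.k_comm i j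
    | K_mul_Kinv i => simp only [map_mul, map_one, hK, hK']; exact R.k_mul_k' i
    | Kinv_mul_K i => simp only [map_mul, map_one, hK, hK']; exact R.k'_mul_k i
    | K_E i j => simp only [map_mul, map_smul, hK, hK', hE]; exact R.k_e i j
    | K_F i j => simp only [map_mul, map_smul, hK, hK', hF]; exact R.k_f i j
    | E_F_same i =>
      simp only [map_mul, map_smul, map_sub, hK, hK', hE, hF]; exact R.e_f_same i
    | E_F_ne i j h => simp only [map_mul, map_sub, map_zero, hE, hF]; exact R.e_f_ne i j h
    | serre_E i j h =>
      rw [serre_eq_serreExpr, map_zero]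
      refine (map_serreExpr (FreeAlgebra.lift Kq vermaGen) _ _).trans ?_
      rw [hE, hE]; exact serreExpr_vermaE h
    | serre_F i j h =>
      rw [serre_eq_serreExpr, map_zero]
      refine (map_serreExpr (FreeAlgebra.lift Kq vermaGen) _ _).trans ?_
      rw [hF, hF]; exact serreExpr_vermaF h⟩

theorem verma_gE (i : Fin 2) : verma (gE i) = vermaE i := by
  rw [verma, gE, toUqg, RingQuot.liftAlgHom_mkAlgHom_apply, fE, FreeAlgebra.lift_ι_apply, vermaGen]

/-- The canonical homomorphism from `PosAlg` to `U_q(𝔤)`. -/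
noncomputable def posToUqg : PosAlg →ₐ[Kq] Uqg := posLift gE fun _ _ h => serreExpr_gE h

theorem posToUqg_gen (i : Fin 2) : posToUqg (posGen i) = gE i := posLift_gen _ _ i

/-- Positive elements act on the Verma module by left multiplication, so they can be recovered from
their value at 1; this is the reason for the injectivity below. -/
theorem verma_posToUqg (y : PosAlg) : verma (posToUqg y) = Algebra.lmul Kq PosAlg y := by
  have : verma.comp posToUqg = Algebra.lmul Kq PosAlg :=
    posAlg_hom_ext (A := Module.End Kq PosAlg) fun i => by rw [AlgHom.comp_apply, posToUqg_gen, verma_gE]; rfl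
  exact DFunLike.congr_fun this y

theorem posToUqg_injective : Function.Injective posToUqg := fun y z h => by
  have := LinearMap.congr_fun (congrArg verma h) 1
  rw [verma_posToUqg, verma_posToUqg] at this
  simpa using this

end PositivePart

/-! ### A realization of the Serre relations in a quantum affine space -/

section QuantumPolynomials

variable {K A : Type*} [Field K] [Ring A] [Algebra K A] {q : K}

/-- The commutation rules of four generators of a quantum affine space. -/
structure QuantumSpace (q : K) (x y₀ y₁ t : A) : Prop where
  mul_0x : y₀ * x = q ^ 2 • (x * y₀)
  mul_1x : y₁ * x = q ^ 2 • (x * y₁)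
  mul_tx : t * x = (q ^ 2)⁻¹ • (x * t)
  mul_10 : y₁ * y₀ = q ^ 2 • (y₀ * y₁)
  mul_t0 : t * y₀ = (1 : K) • (y₀ * t)
  mul_t1 : t * y₁ = q ^ 4 • (y₁ * t)

/-- The element of a quantum affine space which satisfies the Serre relations with `x`. -/
def serrePartner (q : K) (y₀ y₁ t : A) : A := y₀ + y₁ + (q + q⁻¹) • (y₁ * t) + y₁ * (t * t)

namespace QuantumSpace

variable {x y₀ y₁ t : A} (R : QuantumSpace q x y₀ y₁ t)
include R

/-- If zx = c·xz, then the Serre expression of x and z is (1 - [3]c + [3]c² - c³)x³z, which vanishes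
for c = q², 1, q⁻². The summands y₀ and y₁ have c = q², the summand with y₁t has c = 1, and the one
with y₁t² has c = q⁻². -/
theorem serreExpr_left (hq : q ≠ 0) : serreExpr q x (serrePartner q y₀ y₁ t) = 0 := by
  simp only [serreExpr, serrePartner, pow_succ, pow_zero, one_mul, mul_add, add_mul,
    smul_mul_assoc, mul_smul_comm, smul_add, smul_smul, mul_assoc, R.mul_0x, R.mul_1x, R.mul_tx,
    mul_left_comm_of R.mul_0x, mul_left_comm_of R.mul_1x, mul_left_comm_of R.mul_tx]
  match_scalars <;> field_simp <;> ring

theorem imagVec_eq (hq : q ≠ 0) : imagVec q x (serrePartner q y₀ y₁ t) =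
    (q ^ 2 - (q ^ 2)⁻¹) • (x * y₀ + x * y₁ + q⁻¹ • (x * (y₁ * t))) := by
  simp only [imagVec, serrePartner, mul_add, add_mul, smul_mul_assoc, mul_smul_comm, smul_add,
    smul_smul, mul_assoc, R.mul_0x, R.mul_1x, R.mul_tx,
    mul_left_comm_of R.mul_1x, mul_left_comm_of R.mul_tx]
  match_scalars <;> field_simp <;> ring

theorem serreExpr_right (hq : q ≠ 0) : serreExpr q (serrePartner q y₀ y₁ t) x = 0 := by
  set y := serrePartner q y₀ y₁ t with hy
  set w := imagVec q x y with hw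
  -- Factoring the Serre operator leaves the claim that D commutes with y, and D has only two terms.
  set D := q ^ 2 • (w * y) - y * w with hD
  have hDeq : D = ((q ^ 2 - 1) ^ 2 * (q ^ 2 + 1) * (q ^ 2)⁻¹) •
      (q • (x * (y₀ * (y₁ * t))) + x * (y₀ * (y₁ * (t * t)))) := by
    rw [hD, hw, R.imagVec_eq hq, hy, serrePartner]
    simp only [mul_add, add_mul, smul_mul_assoc, mul_smul_comm, smul_add, smul_smul, mul_assoc,
      R.mul_10, R.mul_t0, R.mul_t1,
      mul_left_comm_of R.mul_0x, mul_left_comm_of R.mul_1x, mul_left_comm_of R.mul_tx,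
      mul_left_comm_of R.mul_10, mul_left_comm_of R.mul_t0, mul_left_comm_of R.mul_t1]
    match_scalars <;> field_simp <;> ring
  have hS : serreExpr q y x = D * y - y * D := by
    simp only [serreExpr, hD, hw, imagVec, pow_succ, pow_zero, one_mul, mul_sub, sub_mul,
      smul_mul_assoc, mul_smul_comm, smul_sub, smul_smul, mul_assoc]
    match_scalars <;> field_simp <;> ring
  rw [hS, hDeq, hy, serrePartner]
  simp only [mul_add, add_mul, smul_mul_assoc, mul_smul_comm, smul_add, smul_smul, mul_assoc,
    R.mul_t0, R.mul_t1,
    mul_left_comm_of R.mul_0x, mul_left_comm_of R.mul_1x, mul_left_comm_of R.mul_tx,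
    mul_left_comm_of R.mul_10, mul_left_comm_of R.mul_t0, mul_left_comm_of R.mul_t1]
  match_scalars <;> field_simp <;> ring

/-- Forming w removes the summand of y with c = q⁻², and the bracket with x removes the one with c =
1, so t has disappeared. -/
theorem rootVec_one_eq (hq : q ≠ 0) (h2 : q + q⁻¹ ≠ 0) :
    rootVec q x (serrePartner q y₀ y₁ t) 1 =
      (q⁻¹ * (q ^ 2 - 1) ^ 2) • (x * (x * y₀) + x * (x * y₁)) := by
  have h2' : q ^ 2 + 1 ≠ 0 := fun h => h2 (by field_simp; linear_combination h)
  rw [rootVec_one, R.imagVec_eq hq]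
  simp only [mul_add, add_mul, smul_mul_assoc, mul_smul_comm, smul_add, smul_smul, mul_assoc,
    R.mul_0x, R.mul_1x, R.mul_tx,
    mul_left_comm_of R.mul_1x]
  match_scalars <;> field_simp <;> ring

theorem rootVec_two_eq (hq : q ≠ 0) (h2 : q + q⁻¹ ≠ 0) :
    rootVec q x (serrePartner q y₀ y₁ t) 2 =
      (q ^ 2 - 1) ^ 4 • (q⁻¹ • (x * (x * (x * (y₁ * (y₁ * t))))) +
        (x * (x * (x * (y₁ * y₁))) + (q ^ 2 + 1) • (x * (x * (x * (y₀ * y₁)))) +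
          x * (x * (x * (y₀ * y₀))))) := by
  have h2' : q ^ 2 + 1 ≠ 0 := fun h => h2 (by field_simp; linear_combination h)
  rw [show (2 : ℕ) = 1 + 1 from rfl, rootVec, R.imagVec_eq hq, R.rootVec_one_eq hq h2]
  simp only [mul_add, add_mul, smul_mul_assoc, mul_smul_comm, smul_add, smul_smul, mul_assoc,
    R.mul_10, R.mul_t0, R.mul_t1,
    mul_left_comm_of R.mul_0x, mul_left_comm_of R.mul_1x, mul_left_comm_of R.mul_tx,
    mul_left_comm_of R.mul_10]
  match_scalars <;> field_simp <;> ring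

theorem rootVec_three_eq (hq : q ≠ 0) (h2 : q + q⁻¹ ≠ 0) :
    rootVec q x (serrePartner q y₀ y₁ t) 3 =
      (q ^ 2 - 1) ^ 6 • (q ^ 3 • (x * (x * (x * (x * (y₁ * (y₁ * (y₁ * (t * t)))))))) +
        ((q ^ 2 * (q ^ 2 + 1)) • (x * (x * (x * (x * (y₁ * (y₁ * (y₁ * t))))))) +
        (q ^ 2 * (q ^ 2 + 1)) • (x * (x * (x * (x * (y₀ * (y₁ * (y₁ * t))))))) +
        q ^ 3 • (x * (x * (x * (x * (y₁ * (y₁ * y₁)))))) +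
        (q ^ 3 * (q ^ 4 + q ^ 2 + 1)) • (x * (x * (x * (x * (y₀ * (y₁ * y₁)))))) +
        (q ^ 3 * (q ^ 4 + q ^ 2 + 1)) • (x * (x * (x * (x * (y₀ * (y₀ * y₁)))))) +
        q ^ 3 • (x * (x * (x * (x * (y₀ * (y₀ * y₀)))))))) := by
  have h2' : q ^ 2 + 1 ≠ 0 := fun h => h2 (by field_simp; linear_combination h)
  rw [show (3 : ℕ) = 2 + 1 from rfl, rootVec, R.imagVec_eq hq, R.rootVec_two_eq hq h2]
  simp only [mul_add, add_mul, smul_mul_assoc, mul_smul_comm, smul_add, smul_smul, mul_assoc,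
    R.mul_10, R.mul_t0, R.mul_t1,
    mul_left_comm_of R.mul_0x, mul_left_comm_of R.mul_1x, mul_left_comm_of R.mul_tx,
    mul_left_comm_of R.mul_10, mul_left_comm_of R.mul_t0, mul_left_comm_of R.mul_t1]
  match_scalars <;> field_simp <;> ring

end QuantumSpace

end QuantumPolynomials

/-! ### Leading exponents and independence of the ordered monomials -/

section LeadingTerms

theorem linearIndependent_of_triangular {ι K M : Type*} [Field K] [AddCommGroup M] [Module K M]
    (key : ι → ℕ) (v : ι → M) (f : ι → M →ₗ[K] K) (h₁ : ∀ a, f a (v a) ≠ 0)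
    (h₂ : ∀ a b, b ≠ a → f a (v b) ≠ 0 → key a < key b) : LinearIndependent K v := by
  rw [linearIndependent_iff]
  intro l hl
  by_contra hne
  obtain ⟨a, ha, hmax⟩ := l.support.exists_max_image key (Finsupp.support_nonempty_iff.2 hne)
  have h := congrArg (f a) hl
  rw [Finsupp.linearCombination_apply, Finsupp.sum, map_sum, map_zero,
    Finset.sum_eq_single_of_mem a ha, map_smul, smul_eq_mul] at h
  · exact (mul_ne_zero (Finsupp.mem_support_iff.1 ha) (h₁ a)) h
  · intro b hb hba
    rw [map_smul, smul_eq_mul]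
    by_contra hc
    exact absurd (h₂ a b hba (right_ne_zero_of_mul hc)) (not_lt.2 (hmax b hb))

variable {K : Type*} [Field K]

/-- The weight by which monomials are ordered. -/
def idxWeight (e : Idx) : ℕ := e.2.1 + 3 * e.2.2.2

theorem idxWeight_add (e f : Idx) : idxWeight (e + f) = idxWeight e + idxWeight f := by
  simp only [idxWeight, Prod.snd_add, Prod.fst_add]; ring

/-- Combinations of monomials of weight less than `n`. -/
abbrev lowWeight (K : Type*) [Field K] (n : ℕ) : Submodule K (Idx →₀ K) :=
  Finsupp.supported K K {f | idxWeight f < n}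

theorem lowWeight_mono {m n : ℕ} (h : m ≤ n) : lowWeight K m ≤ lowWeight K n :=
  Finsupp.supported_mono fun _ hf => lt_of_lt_of_le hf h

theorem map_mem_of_lowWeight {T : Module.End K (Idx →₀ K)} {n : ℕ} {N : Submodule K (Idx →₀ K)}
    (h : ∀ f, idxWeight f < n → T (Finsupp.single f 1) ∈ N) {r : Idx →₀ K}
    (hr : r ∈ lowWeight K n) : T r ∈ N := by
  rw [lowWeight, Finsupp.supported_eq_span_single] at hr
  have : Submodule.span K ((fun i => Finsupp.single i (1 : K)) '' {f | idxWeight f < n}) ≤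
      N.comap T := by
    rw [Submodule.span_le]
    rintro _ ⟨f, hf, rfl⟩
    exact h f hf
  exact this hr

/-- The operator raises weights by less than `n`. -/
def RaisesLess (T : Module.End K (Idx →₀ K)) (n : ℕ) : Prop :=
  ∀ e, T (Finsupp.single e 1) ∈ lowWeight K (idxWeight e + n)

/-- Up to terms of smaller weight the operator shifts exponents by `l`. -/
def HasLead (T : Module.End K (Idx →₀ K)) (l : Idx) : Prop :=
  ∀ e, ∃ c : K, c ≠ 0 ∧ T (Finsupp.single e 1) - c • Finsupp.single (e + l) 1 ∈
    lowWeight K (idxWeight e + idxWeight l)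

theorem HasLead.raisesLess {T : Module.End K (Idx →₀ K)} {l : Idx} (h : HasLead T l) {n : ℕ}
    (hn : idxWeight l < n) : RaisesLess T n := fun e => by
  obtain ⟨c, -, hc⟩ := h e
  have h1 : c • Finsupp.single (e + l) (1 : K) ∈ lowWeight K (idxWeight e + n) := by
    refine Submodule.smul_mem _ _ (Finsupp.single_mem_supported _ _ ?_)
    change idxWeight (e + l) < _
    rw [idxWeight_add]; omega
  have := add_mem (lowWeight_mono (show _ ≤ idxWeight e + n by omega) hc) h1
  rwa [sub_add_cancel] at this

theorem RaisesLess.add {T S : Module.End K (Idx →₀ K)} {n : ℕ} (hT : RaisesLess T n)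
    (hS : RaisesLess S n) : RaisesLess (T + S) n := fun e => add_mem (hT e) (hS e)

theorem RaisesLess.smul {T : Module.End K (Idx →₀ K)} {n : ℕ} (hT : RaisesLess T n) (c : K) :
    RaisesLess (c • T) n := fun e => Submodule.smul_mem _ _ (hT e)

theorem HasLead.smul {T : Module.End K (Idx →₀ K)} {l : Idx} (hT : HasLead T l) {c : K}
    (hc : c ≠ 0) : HasLead (c • T) l := fun e => by
  obtain ⟨d, hd, h⟩ := hT e
  refine ⟨c * d, mul_ne_zero hc hd, ?_⟩
  rw [LinearMap.smul_apply, mul_smul, ← smul_sub]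
  exact Submodule.smul_mem _ _ h

theorem HasLead.add {T S : Module.End K (Idx →₀ K)} {l : Idx} (hT : HasLead T l)
    (hS : RaisesLess S (idxWeight l)) : HasLead (T + S) l := fun e => by
  obtain ⟨d, hd, h⟩ := hT e
  refine ⟨d, hd, ?_⟩
  rw [LinearMap.add_apply, add_sub_right_comm]
  exact add_mem h (hS e)

theorem HasLead.one : HasLead (1 : Module.End K (Idx →₀ K)) 0 := fun e =>
  ⟨1, one_ne_zero, by simp⟩

theorem HasLead.mul {T S : Module.End K (Idx →₀ K)} {l m : Idx} (hT : HasLead T l)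
    (hS : HasLead S m) : HasLead (T * S) (l + m) := fun e => by
  obtain ⟨d, hd, h⟩ := hS e
  obtain ⟨c, hc, h'⟩ := hT (e + m)
  refine ⟨d * c, mul_ne_zero hd hc, ?_⟩
  have h1 : T (S (Finsupp.single e 1) - d • Finsupp.single (e + m) 1) ∈
      lowWeight K (idxWeight e + idxWeight (l + m)) := by
    refine map_mem_of_lowWeight (fun f hf => ?_) h
    refine lowWeight_mono ?_ (hT.raisesLess (Nat.lt_succ_self _) f)
    rw [idxWeight_add]; omega
  have h2 : d • (T (Finsupp.single (e + m) 1) - c • Finsupp.single (e + m + l) 1) ∈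
      lowWeight K (idxWeight e + idxWeight (l + m)) := by
    refine Submodule.smul_mem _ _ (lowWeight_mono (le_of_eq ?_) h')
    simp only [idxWeight_add]; omega
  convert add_mem h1 h2 using 1
  rw [Module.End.mul_apply, map_sub, map_smul, smul_sub, smul_smul, add_comm l m, ← add_assoc]
  abel

theorem HasLead.pow {T : Module.End K (Idx →₀ K)} {l : Idx} (hT : HasLead T l) (n : ℕ) :
    HasLead (T ^ n) (n • l) := by
  induction n with
  | zero => rw [pow_zero, zero_smul]; exact HasLead.one
  | succ n ih => rw [pow_succ, succ_nsmul]; exact ih.mul hT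

/-- The operator which multiplies monomials by a monomial, with scalars. -/
noncomputable def shiftOp (c : Idx → K) (l : Idx) : Module.End K (Idx →₀ K) :=
  Finsupp.linearCombination K fun e => c e • Finsupp.single (e + l) 1

theorem shiftOp_single (c : Idx → K) (l e : Idx) :
    shiftOp c l (Finsupp.single e 1) = c e • Finsupp.single (e + l) 1 := by
  rw [shiftOp, Finsupp.linearCombination_single, one_smul]

theorem shiftOp_mul (c d : Idx → K) (l m : Idx) :
    shiftOp c l * shiftOp d m = shiftOp (fun e => d e * c (e + m)) (l + m) := by
  refine Finsupp.lhom_ext' fun e => LinearMap.ext_ring ?_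
  simp only [LinearMap.comp_apply, Finsupp.lsingle_apply, Module.End.mul_apply, shiftOp_single,
    map_smul, smul_smul, add_assoc, add_comm m l]

theorem smul_shiftOp (r : K) (c : Idx → K) (l : Idx) :
    r • shiftOp c l = shiftOp (fun e => r * c e) l := by
  refine Finsupp.lhom_ext' fun e => LinearMap.ext_ring ?_
  simp only [LinearMap.comp_apply, Finsupp.lsingle_apply, LinearMap.smul_apply, shiftOp_single,
    smul_smul]

theorem HasLead.shiftOp {c : Idx → K} (hc : ∀ e, c e ≠ 0) (l : Idx) : HasLead (shiftOp c l) l :=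
  fun e => ⟨c e, hc e, by rw [shiftOp_single, sub_self]; exact zero_mem _⟩

/-- The operator `x` on the quantum polynomials. -/
noncomputable def opX (K : Type*) [Field K] : Module.End K (Idx →₀ K) :=
  shiftOp (fun _ => 1) (1, 0, 0, 0)

/-- The operator `y₀` on the quantum polynomials. -/
noncomputable def opY₀ (q : K) : Module.End K (Idx →₀ K) :=
  shiftOp (fun e => q ^ (2 * e.1)) (0, 1, 0, 0)

/-- The operator `y₁` on the quantum polynomials. -/
noncomputable def opY₁ (q : K) : Module.End K (Idx →₀ K) :=
  shiftOp (fun e => q ^ (2 * e.1 + 2 * e.2.1)) (0, 0, 1, 0)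

/-- The operator `t` on the quantum polynomials. -/
noncomputable def opT (q : K) : Module.End K (Idx →₀ K) :=
  shiftOp (fun e => (q ^ (2 * e.1))⁻¹ * q ^ (4 * e.2.2.1)) (0, 0, 0, 1)

theorem quantumSpace_op {q : K} (hq : q ≠ 0) :
    QuantumSpace q (opX K) (opY₀ q) (opY₁ q) (opT q) := by
  constructor <;> simp only [opX, opY₀, opY₁, opT, shiftOp_mul, smul_shiftOp] <;> congr 1 <;>
    funext e <;> simp [mul_add, pow_add] <;> field_simp

variable {q : K}

theorem hasLead_opX : HasLead (opX K) (1, 0, 0, 0) := .shiftOp (fun _ => one_ne_zero) _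

theorem hasLead_opY₀ (hq : q ≠ 0) : HasLead (opY₀ q) (0, 1, 0, 0) :=
  .shiftOp (fun _ => pow_ne_zero _ hq) _

theorem hasLead_opY₁ (hq : q ≠ 0) : HasLead (opY₁ q) (0, 0, 1, 0) :=
  .shiftOp (fun _ => pow_ne_zero _ hq) _

theorem hasLead_opT (hq : q ≠ 0) : HasLead (opT q) (0, 0, 0, 1) :=
  .shiftOp (fun _ => mul_ne_zero (inv_ne_zero (pow_ne_zero _ hq)) (pow_ne_zero _ hq)) _

/-- The default argument compares two explicit weights by evaluation. -/
theorem RaisesLess.of_hasLead {T : Module.End K (Idx →₀ K)} {l : Idx} {n : ℕ} (h : HasLead T l)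
    (hn : idxWeight l < n := by decide) : RaisesLess T n := h.raisesLess hn

theorem hasLead_rootVec_zero : HasLead (rootVec q (opX K) (serrePartner q (opY₀ q) (opY₁ q) (opT q)) 0)
    (1, 0, 0, 0) := hasLead_opX

theorem hasLead_rootVec_one (hq : q ≠ 0) (h2 : q + q⁻¹ ≠ 0) (h3 : q ^ 2 - 1 ≠ 0) :
    HasLead (rootVec q (opX K) (serrePartner q (opY₀ q) (opY₁ q) (opT q)) 1) (2, 1, 0, 0) := by
  have X := hasLead_opX (K := K)
  have Y := hasLead_opY₁ hq
  rw [(quantumSpace_op hq).rootVec_one_eq hq h2]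
  exact ((X.mul (X.mul (hasLead_opY₀ hq))).add (.of_hasLead (X.mul (X.mul Y)))).smul
    (mul_ne_zero (inv_ne_zero hq) (pow_ne_zero _ h3))

/-- The weight counts t three times and y₀ once, so that y₁²t, of weight 3, beats y₀², of weight 2.
In the next root vector y₁³t², of weight 6, likewise beats all other terms. -/
theorem hasLead_rootVec_two (hq : q ≠ 0) (h2 : q + q⁻¹ ≠ 0) (h3 : q ^ 2 - 1 ≠ 0) :
    HasLead (rootVec q (opX K) (serrePartner q (opY₀ q) (opY₁ q) (opT q)) 2) (3, 0, 2, 1) := by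
  have X := hasLead_opX (K := K)
  have Z := hasLead_opY₀ hq
  have Y := hasLead_opY₁ hq
  have T := hasLead_opT hq
  rw [(quantumSpace_op hq).rootVec_two_eq hq h2]
  refine HasLead.smul (.add ((X.mul (X.mul (X.mul (Y.mul (Y.mul T))))).smul (inv_ne_zero hq))
    (.add (.add (.of_hasLead (X.mul (X.mul (X.mul (Y.mul Y))))) (.smul
    (.of_hasLead (X.mul (X.mul (X.mul (Z.mul Y))))) _))
    (.of_hasLead (X.mul (X.mul (X.mul (Z.mul Z))))))) (pow_ne_zero _ h3)

theorem hasLead_rootVec_three (hq : q ≠ 0) (h2 : q + q⁻¹ ≠ 0) (h3 : q ^ 2 - 1 ≠ 0) :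
    HasLead (rootVec q (opX K) (serrePartner q (opY₀ q) (opY₁ q) (opT q)) 3) (4, 0, 3, 2) := by
  have X := hasLead_opX (K := K)
  have Z := hasLead_opY₀ hq
  have Y := hasLead_opY₁ hq
  have T := hasLead_opT hq
  have hX : ∀ {S : Module.End K (Idx →₀ K)} {l : Idx}, HasLead S l →
      HasLead (opX K * (opX K * (opX K * (opX K * S)))) _ :=
    fun hS => X.mul (X.mul (X.mul (X.mul hS)))
  rw [(quantumSpace_op hq).rootVec_three_eq hq h2]
  refine HasLead.smul (.add ((hX (Y.mul (Y.mul (Y.mul (T.mul T))))).smul (pow_ne_zero _ hq))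
    (.add (.add (.add (.add (.add (.smul ?_ _) (.smul ?_ _)) (.smul ?_ _)) (.smul ?_ _))
      (.smul ?_ _)) (.smul ?_ _))) (pow_ne_zero _ h3)
  · exact .of_hasLead (hX (Y.mul (Y.mul (Y.mul T))))
  · exact .of_hasLead (hX (Z.mul (Y.mul (Y.mul T))))
  · exact .of_hasLead (hX (Y.mul (Y.mul Y)))
  · exact .of_hasLead (hX (Z.mul (Y.mul Y)))
  · exact .of_hasLead (hX (Z.mul (Z.mul Y)))
  · exact .of_hasLead (hX (Z.mul (Z.mul Z)))

/-- The ordered monomials in four elements of an algebra. -/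
def ordMonomial {A : Type*} [Monoid A] (u : Fin 4 → A) (a : Idx) : A :=
  u 3 ^ a.1 * u 2 ^ a.2.1 * u 1 ^ a.2.2.1 * u 0 ^ a.2.2.2

theorem map_ordMonomial {A B F : Type*} [Monoid A] [Monoid B] [FunLike F A B] [MonoidHomClass F A B]
    (φ : F) (u : Fin 4 → A) (a : Idx) : φ (ordMonomial u a) = ordMonomial (fun i => φ (u i)) a := by
  simp only [ordMonomial, map_mul, map_pow]

/-- Applied to the monomial 1, the operators have pairwise distinct leading exponents, so their
values are triangular with respect to the weight. -/
theorem linearIndependent_of_hasLead {ι : Type*} (T : ι → Module.End K (Idx →₀ K))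
    (lam : ι → Idx) (hlam : Function.Injective lam) (hT : ∀ a, HasLead (T a) (lam a)) :
    LinearIndependent K T := by
  have h0 : idxWeight 0 = 0 := rfl
  refine LinearIndependent.of_comp (LinearMap.applyₗ (Finsupp.single (0 : Idx) (1 : K))) <|
    linearIndependent_of_triangular (fun a => idxWeight (lam a)) _
      (fun a => Finsupp.lapply (lam a)) (fun a => ?_) fun a b hba h => ?_
  · obtain ⟨c, hc, h'⟩ := hT a 0
    have h1 := (Finsupp.mem_supported' _ _).1 h' (lam a) (by simp [h0])
    rw [Finsupp.sub_apply, Finsupp.smul_apply, zero_add, Finsupp.single_eq_same, sub_eq_zero] at h1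
    change T a (Finsupp.single 0 1) (lam a) ≠ 0
    rw [h1, smul_eq_mul, mul_one]; exact hc
  · obtain ⟨c, hc, h'⟩ := hT b 0
    by_contra hcon
    have h1 := (Finsupp.mem_supported' _ _).1 h' (lam a) (by simpa [h0] using hcon)
    rw [Finsupp.sub_apply, Finsupp.smul_apply, zero_add,
      Finsupp.single_eq_of_ne (fun e => hba (hlam e.symm)), smul_zero, sub_zero] at h1
    exact h h1

/-- The exponent of the leading term of an ordered monomial in the root vectors. -/
def leadExponent (a : Idx) : Idx :=
  (4 * a.1 + 3 * a.2.1 + 2 * a.2.2.1 + a.2.2.2, a.2.2.1, 3 * a.1 + 2 * a.2.1, 2 * a.1 + a.2.1)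

/-- The four exponent vectors form a matrix of determinant ±1: the last two entries determine the
first two multiplicities, and the rest follow. -/
theorem leadExponent_injective : Function.Injective leadExponent := by
  rintro ⟨a, b, c, d⟩ ⟨a', b', c', d'⟩ h
  simp only [leadExponent, Prod.mk.injEq] at h ⊢
  omega

theorem leadExponent_eq (a : Idx) : leadExponent a = a.1 • ((4, 0, 3, 2) : Idx) +
    a.2.1 • ((3, 0, 2, 1) : Idx) + a.2.2.1 • ((2, 1, 0, 0) : Idx) +
      a.2.2.2 • ((1, 0, 0, 0) : Idx) := by
  simp only [leadExponent, Prod.smul_mk, Prod.mk_add_mk, smul_eq_mul, Prod.mk.injEq]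
  refine ⟨?_, ?_, ?_, ?_⟩ <;> ring

theorem hasLead_ordMonomial {V : Fin 4 → Module.End K (Idx →₀ K)} (h0 : HasLead (V 0) (1, 0, 0, 0))
    (h1 : HasLead (V 1) (2, 1, 0, 0)) (h2 : HasLead (V 2) (3, 0, 2, 1))
    (h3 : HasLead (V 3) (4, 0, 3, 2)) (a : Idx) : HasLead (ordMonomial V a) (leadExponent a) := by
  rw [leadExponent_eq]
  exact (((h3.pow a.1).mul (h2.pow a.2.1)).mul (h1.pow a.2.2.1)).mul (h0.pow a.2.2.2)

theorem linearIndependent_ordMonomial_op (hq : q ≠ 0) (h2 : q + q⁻¹ ≠ 0) (h3 : q ^ 2 - 1 ≠ 0) :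
    LinearIndependent K (ordMonomial fun i : Fin 4 =>
      rootVec q (opX K) (serrePartner q (opY₀ q) (opY₁ q) (opT q)) i) :=
  linearIndependent_of_hasLead _ leadExponent leadExponent_injective <| hasLead_ordMonomial
    hasLead_rootVec_zero (hasLead_rootVec_one hq h2 h3) (hasLead_rootVec_two hq h2 h3)
    (hasLead_rootVec_three hq h2 h3)

end LeadingTerms

/-! ### Independence in the quantized enveloping algebra, and the rescaled generators -/

section Independence

/-- The monomials come from the presented algebra, which embeds by `posToUqg_injective`; there they
are independent because their images as operators on quantum polynomials are. -/
theorem linearIndependent_ordMonomial_v : LinearIndependent Kq (ordMonomial v) := by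
  have S := quantumSpace_op (K := Kq) q_ne_zero
  let φ : PosAlg →ₐ[Kq] Module.End Kq (Idx →₀ Kq) :=
    posLift ![opX Kq, serrePartner q (opY₀ q) (opY₁ q) (opT q)] fun i j h => by
      fin_cases i <;> fin_cases j
      · exact absurd rfl h
      · exact S.serreExpr_left q_ne_zero
      · exact S.serreExpr_right q_ne_zero
      · exact absurd rfl h
  have h1 : LinearIndependent Kq
      (ordMonomial fun i : Fin 4 => rootVec q (posGen 0) (posGen 1) i) := by
    refine LinearIndependent.of_comp φ.toLinearMap ?_
    have e : φ.toLinearMap ∘ (ordMonomial fun i : Fin 4 => rootVec q (posGen 0) (posGen 1) i) =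
        ordMonomial fun i : Fin 4 =>
          rootVec q (opX Kq) (serrePartner q (opY₀ q) (opY₁ q) (opT q)) i := ?_
    · rw [e]
      exact linearIndependent_ordMonomial_op q_ne_zero q_add_inv_ne_zero q_sq_sub_one_ne_zero
    funext a
    refine (map_ordMonomial φ _ a).trans ?_
    congr 1
    funext i
    have h := map_rootVec (B := Module.End Kq (Idx →₀ Kq)) φ (posGen 0) (posGen 1) i
    rw [posLift_gen, posLift_gen] at h
    exact h
  have h2 : ordMonomial v = posToUqg.toLinearMap ∘
      (ordMonomial fun i : Fin 4 => rootVec q (posGen 0) (posGen 1) i) := by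
    funext a
    refine Eq.trans ?_ (map_ordMonomial posToUqg _ a).symm
    rw [v_eq_rootVec]
    congr 1
    funext i
    rw [map_rootVec, posToUqg_gen, posToUqg_gen]
  rw [h2]
  exact h1.map' _ (LinearMap.ker_eq_bot.2 posToUqg_injective)

/-- The scalar relating `u i` to `v i` is a power of this one. -/
noncomputable def rescale : Kq := ((1 - q ^ (-2 : ℤ)) ^ 2)⁻¹

theorem rescale_ne_zero : rescale ≠ 0 := by
  refine inv_ne_zero (pow_ne_zero _ fun h => q_sq_sub_one_ne_zero ?_)
  have := q_ne_zero
  rw [zpow_neg] at h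
  norm_cast at h
  field_simp at h
  linear_combination h

theorem coe_u (i : Fin 4) : (u i : Uqg) = rescale ^ (i : ℕ) • v i := by
  rw [u, rescale, inv_pow, ← pow_mul]; rfl

theorem ordMonomial_smul {K A : Type*} [Field K] [Ring A] [Algebra K A] (c : Fin 4 → K)
    (w : Fin 4 → A) (a : Idx) :
    ordMonomial (fun i => c i • w i) a = ordMonomial c a • ordMonomial w a := by
  simp only [ordMonomial, smul_pow, smul_mul_smul_comm]

theorem ordMonomial_ne_zero {K : Type*} [Field K] {c : Fin 4 → K} (hc : ∀ i, c i ≠ 0) (a : Idx) :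
    ordMonomial c a ≠ 0 :=
  mul_ne_zero (mul_ne_zero (mul_ne_zero (pow_ne_zero _ (hc _)) (pow_ne_zero _ (hc _)))
    (pow_ne_zero _ (hc _))) (pow_ne_zero _ (hc _))

theorem linearIndependent_ordMonomial_u : LinearIndependent Kq (ordMonomial u) := by
  refine LinearIndependent.of_comp UqPlus.val.toLinearMap ?_
  have h : UqPlus.val.toLinearMap ∘ ordMonomial u = fun a =>
      (Units.mk0 _ (ordMonomial_ne_zero (fun i : Fin 4 => pow_ne_zero (i : ℕ) rescale_ne_zero) a)) •
        ordMonomial v a := by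
    funext a
    refine (map_ordMonomial UqPlus.val u a).trans ?_
    have : (fun i => UqPlus.val (u i)) = fun i : Fin 4 => rescale ^ (i : ℕ) • v i :=
      funext coe_u
    rw [this]
    exact ordMonomial_smul (fun i : Fin 4 => rescale ^ (i : ℕ)) v a
  rw [h]
  exact linearIndependent_ordMonomial_v.units_smul _

theorem Straightening.smul {K A : Type*} [Field K] [Ring A] [Algebra K A] {q : K} {w : Fin 4 → A}
    (h : Straightening q w) (d : K) : Straightening q fun i => d ^ (i : ℕ) • w i where
  mul_10 := by simp only [smul_mul_smul_comm, h.mul_10, Fin.val_zero, Fin.val_one]; module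
  mul_21 := by simp only [smul_mul_smul_comm, h.mul_21, Fin.val_two, Fin.val_one]; module
  mul_32 := by
    simp only [smul_mul_smul_comm, h.mul_32, Fin.val_two, show ((3 : Fin 4) : ℕ) = 3 from rfl]
    module
  mul_20 := by simp only [smul_mul_smul_comm, h.mul_20, Fin.val_zero, Fin.val_one, Fin.val_two]; module
  mul_31 := by
    simp only [smul_mul_smul_comm, h.mul_31, Fin.val_one, Fin.val_two,
      show ((3 : Fin 4) : ℕ) = 3 from rfl]
    module
  mul_30 := by
    simp only [smul_mul_smul_comm, h.mul_30, Fin.val_zero, Fin.val_one, Fin.val_two,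
      show ((3 : Fin 4) : ℕ) = 3 from rfl]
    module

theorem Straightening.of_injective {K A B : Type*} [Field K] [Ring A] [Algebra K A] [Ring B]
    [Algebra K B] {q : K} {w : Fin 4 → A} (φ : A →ₐ[K] B) (hφ : Function.Injective φ)
    (h : Straightening q fun i => φ (w i)) : Straightening q w := by
  constructor <;> apply hφ <;> simp only [map_add, map_mul, map_smul]
  exacts [h.mul_10, h.mul_21, h.mul_32, h.mul_20, h.mul_31, h.mul_30]

theorem straightening_u : Straightening q u := by
  refine Straightening.of_injective UqPlus.val Subtype.val_injective ?_
  have : (fun i => UqPlus.val (u i)) = fun i : Fin 4 => rescale ^ (i : ℕ) • v i := funext coe_u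
  rw [this]
  exact straightening_v.smul rescale

theorem uqPlus_induction {p : UqPlus → Prop} (scalar : ∀ c, p (algebraMap Kq UqPlus c))
    (gen : ∀ i, p (u i)) (add : ∀ x y, p x → p y → p (x + y))
    (mul : ∀ x y, p x → p y → p (x * y)) (x : UqPlus) : p x := by
  obtain ⟨x, hx⟩ := x
  refine Algebra.adjoin_induction (p := fun x hx => p ⟨x, hx⟩) ?_ scalar
    (fun x y hx hy => add ⟨x, hx⟩ ⟨y, hy⟩) (fun x y hx hy => mul ⟨x, hx⟩ ⟨y, hy⟩) hx
  rintro _ ⟨i, rfl⟩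
  have : (⟨v i, Algebra.subset_adjoin ⟨i, rfl⟩⟩ : UqPlus) =
      algebraMap Kq UqPlus (rescale ^ (i : ℕ))⁻¹ * u i := by
    apply Subtype.ext
    change v i = algebraMap Kq Uqg _ * (u i : Uqg)
    rw [← Algebra.smul_def, coe_u, inv_smul_smul₀ (pow_ne_zero _ rescale_ne_zero)]
  rw [this]
  exact mul _ _ (scalar _) (gen i)

end Independence

/-! ### Construction of the anti-automorphism σ -/

section AntiInvolution

/-- This makes the substitution q ↦ q⁻¹ extend from polynomials to rational functions. -/
theorem transcendental_q_inv : Transcendental ℚ q⁻¹ := fun h => by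
  obtain ⟨p, hp, h'⟩ := IsAlgebraic.inv_iff.1 h
  exact aeval_q_ne_zero hp h'

theorem nonZeroDivisors_le_comap_eval₂ : nonZeroDivisors (Polynomial ℚ) ≤ (nonZeroDivisors Kq).comap
    (Polynomial.eval₂RingHom (algebraMap ℚ Kq) q⁻¹) := fun _ hp =>
  Submonoid.mem_comap.2 <| mem_nonZeroDivisors_of_ne_zero fun h =>
    transcendental_q_inv ⟨_, nonZeroDivisors.ne_zero hp, h⟩

/-- The automorphism `q ↦ q⁻¹` of the base field. -/
noncomputable def bar : Kq →+* Kq :=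
  RatFunc.liftRingHom (Polynomial.eval₂RingHom (algebraMap ℚ Kq) q⁻¹) nonZeroDivisors_le_comap_eval₂

theorem bar_q : bar q = q⁻¹ := by
  refine (RatFunc.liftRingHom_X _ _).trans ?_
  simp

theorem bar_bar (c : Kq) : bar (bar c) = c := by
  have h : (bar.comp bar).comp (algebraMap (Polynomial ℚ) Kq) = algebraMap (Polynomial ℚ) Kq := by
    refine Polynomial.ringHom_ext' (RingHom.ext_rat _ _) ?_
    rw [RingHom.comp_apply, RatFunc.algebraMap_X, RingHom.comp_apply]
    rw [show (RatFunc.X : Kq) = q from rfl, bar_q, map_inv₀, bar_q, inv_inv]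
  obtain ⟨n, d, hd, rfl⟩ := IsFractionRing.div_surjective (A := Polynomial ℚ) c
  rw [map_div₀, map_div₀]
  exact congrArg₂ _ (RingHom.congr_fun h n) (RingHom.congr_fun h d)

theorem bar_q_zpow (n : ℤ) : bar (q ^ n) = q ^ (-n) := by
  rw [map_zpow₀, bar_q, inv_zpow, zpow_neg]

theorem bar_rescale : bar rescale = q ^ (-4 : ℤ) * rescale := by
  rw [rescale, map_inv₀, map_pow, map_sub, map_one, bar_q_zpow, neg_neg, zpow_neg, zpow_neg,
    ← mul_inv, inv_inj, show (q ^ (4 : ℤ)) = q ^ 4 by norm_cast,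
    show (q ^ (2 : ℤ)) = q ^ 2 by norm_cast]
  have := q_ne_zero
  field_simp
  ring

/-- The opposite algebra of `PosAlg` with scalars acting through `bar`. -/
def PosAlgBar : Type := PosAlgᵐᵒᵖ

noncomputable instance : Ring PosAlgBar := inferInstanceAs (Ring PosAlgᵐᵒᵖ)

noncomputable instance : Algebra Kq PosAlgBar :=
  ((algebraMap Kq PosAlgᵐᵒᵖ).comp bar).toAlgebra' fun c x =>
    Algebra.commutes (A := PosAlgᵐᵒᵖ) (bar c) x

/-- The identity map to the opposite algebra. -/
def toPosAlgBar (x : PosAlg) : PosAlgBar := MulOpposite.op x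

theorem toPosAlgBar_mul (x y : PosAlg) :
    toPosAlgBar x * toPosAlgBar y = toPosAlgBar (y * x) := rfl

theorem toPosAlgBar_sub (x y : PosAlg) :
    toPosAlgBar x - toPosAlgBar y = toPosAlgBar (x - y) := rfl

theorem toPosAlgBar_add (x y : PosAlg) :
    toPosAlgBar x + toPosAlgBar y = toPosAlgBar (x + y) := rfl

theorem toPosAlgBar_pow (x : PosAlg) (n : ℕ) : toPosAlgBar x ^ n = toPosAlgBar (x ^ n) := rfl

theorem smul_toPosAlgBar (c : Kq) (x : PosAlg) :
    c • toPosAlgBar x = toPosAlgBar (bar c • x) := by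
  rw [Algebra.smul_def, Algebra.smul_def, Algebra.commutes (bar c) x]
  rfl

theorem serreExpr_toPosAlgBar (x y : PosAlg) :
    serreExpr q (toPosAlgBar x) (toPosAlgBar y) = toPosAlgBar (-serreExpr q x y) := by
  have h : bar (q ^ 2 + 1 + (q ^ 2)⁻¹) = q ^ 2 + 1 + (q ^ 2)⁻¹ := by
    rw [map_add, map_add, map_inv₀, map_pow, bar_q, map_one, inv_pow, inv_inv]; ring
  simp only [serreExpr, toPosAlgBar_pow, toPosAlgBar_mul, smul_toPosAlgBar, toPosAlgBar_sub,
    toPosAlgBar_add, h, mul_assoc]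
  congr 1
  abel

theorem imagVec_toPosAlgBar (x y : PosAlg) :
    imagVec q (toPosAlgBar x) (toPosAlgBar y) = toPosAlgBar (-(q ^ 2 • imagVec q x y)) := by
  have h : bar (q ^ 2)⁻¹ = q ^ 2 := by rw [map_inv₀, map_pow, bar_q, inv_pow, inv_inv]
  simp only [imagVec, toPosAlgBar_mul, smul_toPosAlgBar, toPosAlgBar_sub, h, smul_sub,
    smul_inv_smul₀ (pow_ne_zero 2 q_ne_zero), neg_sub]

/-- The anti-automorphism that fixes both generators and inverts q sends w to -q²w. Reversing the
commutator cancels the sign, so each bracket contributes q². -/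
theorem rootVec_toPosAlgBar (x y : PosAlg) (k : ℕ) :
    rootVec q (toPosAlgBar x) (toPosAlgBar y) k = toPosAlgBar (q ^ (2 * k) • rootVec q x y k) := by
  have h : bar (q + q⁻¹)⁻¹ = (q + q⁻¹)⁻¹ := by
    rw [map_inv₀, map_add, map_inv₀, bar_q, inv_inv, add_comm]
  induction k with
  | zero => rw [mul_zero, pow_zero, one_smul]; rfl
  | succ k ih =>
    rw [rootVec, ih, imagVec_toPosAlgBar]
    simp only [toPosAlgBar_mul, smul_toPosAlgBar, toPosAlgBar_sub, h, rootVec, neg_mul, mul_neg,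
      smul_mul_smul_comm]
    congr 1
    rw [smul_comm (q ^ (2 * (k + 1))), smul_sub (q ^ (2 * (k + 1))), ← pow_add, ← pow_add,
      add_comm (2 * k) 2, show 2 * (k + 1) = 2 + 2 * k by ring]
    congr 1
    abel

theorem rootVec_smul_right {K A : Type*} [Field K] [Ring A] [Algebra K A] (q c : K) (x y : A)
    (k : ℕ) : rootVec q x (c • y) k = c ^ k • rootVec q x y k := by
  have h : imagVec q x (c • y) = c • imagVec q x y := by
    simp only [imagVec, smul_mul_assoc, mul_smul_comm, smul_sub, smul_comm c]
  induction k with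
  | zero => rw [pow_zero, one_smul]; rfl
  | succ k ih =>
    rw [rootVec, rootVec, h, ih, smul_mul_smul_comm, smul_mul_smul_comm, ← pow_succ', ← pow_succ,
      ← smul_sub, smul_comm]

/-- The semilinear anti-endomorphism of `PosAlg` with `E₁ ↦ E₁` and `E₂ ↦ q⁴ E₂`. -/
noncomputable def posAnti : PosAlg →ₐ[Kq] PosAlgBar :=
  posLift ![toPosAlgBar (posGen 0), toPosAlgBar (q ^ 4 • posGen 1)] fun i j h => by
    fin_cases i <;> fin_cases j
    · exact absurd rfl h
    · change serreExpr q (toPosAlgBar _) (toPosAlgBar _) = 0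
      rw [← one_smul Kq (posGen 0), serreExpr_toPosAlgBar, serreExpr_smul,
        serreExpr_posGen (by decide), smul_zero, neg_zero]
      rfl
    · change serreExpr q (toPosAlgBar _) (toPosAlgBar _) = 0
      rw [← one_smul Kq (posGen 0), serreExpr_toPosAlgBar, serreExpr_smul,
        serreExpr_posGen (by decide), smul_zero, neg_zero]
      rfl
    · exact absurd rfl h

/-- Of the exponent 6k, reversal gives 2k and the factor q⁴ on E₂ gives 4k. The latter compensates
for `bar_rescale`, which contributes q⁻⁴ for each factor `rescale`, and so σ multiplies `u k` by
q^(2k). -/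
theorem posAnti_rootVec (k : ℕ) : posAnti (rootVec q (posGen 0) (posGen 1) k) =
    toPosAlgBar (q ^ (6 * k) • rootVec q (posGen 0) (posGen 1) k) := by
  rw [map_rootVec, posAnti, posLift_gen, posLift_gen]
  change rootVec q (toPosAlgBar _) (toPosAlgBar _) k = _
  rw [rootVec_toPosAlgBar, rootVec_smul_right, smul_smul, ← pow_mul, ← pow_add]
  congr 3
  ring

theorem v_mem_range (i : Fin 4) : v i ∈ posToUqg.range :=
  ⟨rootVec q (posGen 0) (posGen 1) i, by
    change posToUqg _ = _
    rw [map_rootVec, posToUqg_gen, posToUqg_gen, v_eq_rootVec]⟩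

theorem uqPlus_le_range : UqPlus ≤ posToUqg.range :=
  Algebra.adjoin_le (by rintro _ ⟨i, rfl⟩; exact v_mem_range i)

/-- The embedding of `U_q⁺(w)` into `PosAlg`. -/
noncomputable def uqPlusToPos : UqPlus →ₐ[Kq] PosAlg :=
  (AlgEquiv.ofInjective posToUqg posToUqg_injective).symm.toAlgHom.comp
    (Subalgebra.inclusion uqPlus_le_range)

theorem posToUqg_uqPlusToPos (x : UqPlus) : posToUqg (uqPlusToPos x) = x :=
  congrArg Subtype.val
    ((AlgEquiv.ofInjective posToUqg posToUqg_injective).apply_symm_apply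
      (Subalgebra.inclusion uqPlus_le_range x))

theorem uqPlusToPos_u (i : Fin 4) :
    uqPlusToPos (u i) = rescale ^ (i : ℕ) • rootVec q (posGen 0) (posGen 1) i := by
  apply posToUqg_injective
  rw [posToUqg_uqPlusToPos, coe_u, map_smul, map_rootVec, posToUqg_gen, posToUqg_gen, v_eq_rootVec]

/-- The anti-homomorphism from `U_q⁺(w)` to `U_q(𝔤)` which is to be restricted. -/
noncomputable def uqPlusAnti : UqPlus →+* Uqgᵐᵒᵖ :=
  (RingHom.op posToUqg.toRingHom).comp (posAnti.toRingHom.comp uqPlusToPos.toRingHom)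

theorem uqPlusAnti_algebraMap (c : Kq) :
    (uqPlusAnti (algebraMap Kq UqPlus c)).unop = algebraMap Kq UqPlus (bar c) := by
  change posToUqg (MulOpposite.unop (posAnti (uqPlusToPos (algebraMap Kq UqPlus c)))) = _
  rw [AlgHom.commutes, AlgHom.commutes]
  exact posToUqg.commutes (bar c)

theorem uqPlusAnti_u (i : Fin 4) : (uqPlusAnti (u i)).unop = (q ^ (2 * (i : ℕ)) • u i : UqPlus) := by
  change posToUqg (MulOpposite.unop (posAnti (uqPlusToPos (u i)))) = _
  rw [uqPlusToPos_u, map_smul, posAnti_rootVec, smul_toPosAlgBar]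
  change posToUqg (bar _ • _) = _
  have e := coe_u i
  rw [map_smul, map_smul, map_rootVec, posToUqg_gen, posToUqg_gen, Subalgebra.coe_smul, e,
    v_eq_rootVec, smul_smul, smul_smul, map_pow, bar_rescale, mul_pow]
  congr 1
  rw [zpow_neg, show (q ^ (4 : ℤ)) = q ^ 4 by norm_cast, inv_pow, ← pow_mul,
    show 6 * (i : ℕ) = 4 * i + 2 * i by ring, pow_add]
  have := pow_ne_zero (4 * (i : ℕ)) q_ne_zero
  field_simp

theorem uqPlusAnti_mem (x : UqPlus) : (uqPlusAnti x).unop ∈ UqPlus := by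
  induction x using uqPlus_induction with
  | scalar c => rw [uqPlusAnti_algebraMap]; exact SetLike.coe_mem _
  | gen i => rw [uqPlusAnti_u]; exact SetLike.coe_mem _
  | add x y hx hy => rw [map_add]; exact add_mem hx hy
  | mul x y hx hy => rw [map_mul]; exact mul_mem hy hx

/-- The anti-endomorphism `σ` of `U_q⁺(w)`. -/
noncomputable def sigmaHom : UqPlus →+* UqPlusᵐᵒᵖ where
  toFun x := MulOpposite.op ⟨(uqPlusAnti x).unop, uqPlusAnti_mem x⟩
  map_one' := MulOpposite.unop_injective <| Subtype.ext <|
    congrArg MulOpposite.unop (map_one uqPlusAnti)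
  map_mul' x y := MulOpposite.unop_injective <| Subtype.ext <|
    congrArg MulOpposite.unop (map_mul uqPlusAnti x y)
  map_zero' := MulOpposite.unop_injective <| Subtype.ext <|
    congrArg MulOpposite.unop (map_zero uqPlusAnti)
  map_add' x y := MulOpposite.unop_injective <| Subtype.ext <|
    congrArg MulOpposite.unop (map_add uqPlusAnti x y)

theorem sigmaHom_algebraMap (c : Kq) :
    (sigmaHom (algebraMap Kq UqPlus c)).unop = algebraMap Kq UqPlus (bar c) :=
  Subtype.ext (uqPlusAnti_algebraMap c)

theorem sigmaHom_u (i : Fin 4) : (sigmaHom (u i)).unop = q ^ (2 * (i : ℕ)) • u i :=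
  Subtype.ext (uqPlusAnti_u i)

theorem sigmaHom_sigmaHom (x : UqPlus) : (sigmaHom (sigmaHom x).unop).unop = x := by
  induction x using uqPlus_induction with
  | scalar c => rw [sigmaHom_algebraMap, sigmaHom_algebraMap, bar_bar]
  | gen i =>
    rw [sigmaHom_u, Algebra.smul_def, map_mul, MulOpposite.unop_mul, sigmaHom_algebraMap,
      sigmaHom_u, ← Algebra.commutes, ← Algebra.smul_def, smul_smul, map_pow, bar_q, inv_pow,
      inv_mul_cancel₀ (pow_ne_zero _ q_ne_zero), one_smul]
  | add x y hx hy => simp only [map_add, MulOpposite.unop_add, hx, hy]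
  | mul x y hx hy => simp only [map_mul, MulOpposite.unop_mul, hx, hy]

/-- The anti-automorphism `σ` of `U_q⁺(w)`. -/
noncomputable def sigmaEquiv : UqPlus ≃+* UqPlusᵐᵒᵖ :=
  { sigmaHom with
    invFun := fun y => (sigmaHom y.unop).unop
    left_inv := sigmaHom_sigmaHom
    right_inv := fun y => MulOpposite.unop_injective (sigmaHom_sigmaHom y.unop) }

theorem isSigma_sigmaEquiv : IsSigma sigmaEquiv := by
  refine ⟨?_, sigmaHom_u⟩
  rw [← bar_q]
  exact sigmaHom_algebraMap q

end AntiInvolution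

/-! ### Additive spans with prescribed exponents of q -/

section Span

variable {K A ι : Type*} [Field K] [AddCommGroup A] [Module K A] {q : K} {E : ι → A}

/-- The additive subgroup generated by the multiples `q ^ k • E b` with `(k, b)` in `P`. -/
def qSpan (q : K) (E : ι → A) (P : Set (ℤ × ι)) : AddSubgroup A :=
  AddSubgroup.closure ((fun p : ℤ × ι => q ^ p.1 • E p.2) '' P)

theorem zpow_smul_mem_qSpan {P : Set (ℤ × ι)} {k : ℤ} {b : ι} (h : (k, b) ∈ P) :
    q ^ k • E b ∈ qSpan q E P :=
  AddSubgroup.subset_closure ⟨(k, b), h, rfl⟩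

theorem mem_qSpan {P : Set (ℤ × ι)} {b : ι} (h : (0, b) ∈ P) : E b ∈ qSpan q E P := by
  simpa using zpow_smul_mem_qSpan (q := q) (E := E) h

theorem qSpan_mono {P Q : Set (ℤ × ι)} (h : P ⊆ Q) : qSpan q E P ≤ qSpan q E Q :=
  AddSubgroup.closure_mono (Set.image_mono h)

theorem map_mem_of_mem_qSpan {B : Type*} [AddCommGroup B] {P : Set (ℤ × ι)} (T : A →+ B)
    {N : AddSubgroup B} (h : ∀ k b, (k, b) ∈ P → T (q ^ k • E b) ∈ N) {x : A}
    (hx : x ∈ qSpan q E P) : T x ∈ N := by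
  have : qSpan q E P ≤ N.comap T := by
    rw [qSpan, AddSubgroup.closure_le]
    rintro _ ⟨p, hp, rfl⟩
    exact h p.1 p.2 hp
  exact this hx

theorem zpow_smul_mem_qSpan_of_mem (hq : q ≠ 0) {P Q : Set (ℤ × ι)} {x : A} (j : ℤ)
    (h : ∀ k b, (k, b) ∈ P → (j + k, b) ∈ Q) (hx : x ∈ qSpan q E P) :
    q ^ j • x ∈ qSpan q E Q :=
  map_mem_of_mem_qSpan (DistribSMul.toAddMonoidHom A (q ^ j)) (fun k b hk => by
    change q ^ j • q ^ k • E b ∈ _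
    rw [smul_smul, ← zpow_add₀ hq]
    exact zpow_smul_mem_qSpan (h k b hk)) hx

theorem qSpan_le_span {P : Set (ℤ × ι)} {x : A} (hx : x ∈ qSpan q E P) :
    x ∈ Submodule.span K (E '' (Prod.snd '' P)) :=
  map_mem_of_mem_qSpan (AddMonoidHom.id A)
    (N := (Submodule.span K (E '' (Prod.snd '' P))).toAddSubgroup) (fun k b hk =>
    Submodule.smul_mem _ _ (Submodule.subset_span ⟨b, ⟨(k, b), hk, rfl⟩, rfl⟩)) hx

/-- Combinations of the `E b` with `b` in `P`, with coefficients Laurent polynomials in `q`. -/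
abbrev qSpanOn (q : K) (E : ι → A) (P : Set ι) : AddSubgroup A := qSpan q E {p | p.2 ∈ P}

theorem zpow_smul_mem_qSpanOn (hq : q ≠ 0) {P : Set ι} {x : A} (j : ℤ)
    (hx : x ∈ qSpanOn q E P) : q ^ j • x ∈ qSpanOn q E P :=
  zpow_smul_mem_qSpan_of_mem hq j (fun _ _ h => h) hx

theorem qSpanOn_zpow_smul (hq : q ≠ 0) (n : ι → ℤ) (P : Set ι) :
    qSpanOn q (fun b => q ^ n b • E b) P = qSpanOn q E P := by
  refine le_antisymm (AddSubgroup.closure_le _ |>.2 ?_) (AddSubgroup.closure_le _ |>.2 ?_)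
  · rintro _ ⟨⟨k, b⟩, h, rfl⟩
    change q ^ k • q ^ n b • E b ∈ _
    rw [smul_smul, ← zpow_add₀ hq]
    exact zpow_smul_mem_qSpan h
  · rintro _ ⟨⟨k, b⟩, h, rfl⟩
    change q ^ k • E b ∈ _
    have := zpow_smul_mem_qSpan (q := q) (E := fun b => q ^ n b • E b) (P := {p | p.2 ∈ P})
      (k := k - n b) (b := b) h
    rwa [smul_smul, ← zpow_add₀ hq, sub_add_cancel] at this

end Span

/-! ### The partial order on exponents -/

section Order

theorem idxLE_iff {a b : Idx} : idxLE a b ↔ ∃ s r : ℕ, (b.1 : ℤ) = a.1 - s ∧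
    (b.2.1 : ℤ) = a.2.1 + 2 * s - r ∧ (b.2.2.1 : ℤ) = a.2.2.1 - s + 2 * r ∧
      (b.2.2.2 : ℤ) = a.2.2.2 - r := Iff.rfl

theorem idxLE_refl (a : Idx) : idxLE a a := idxLE_iff.2 ⟨0, 0, by simp⟩

theorem idxLE_trans {a b c : Idx} (h : idxLE a b) (h' : idxLE b c) : idxLE a c := by
  obtain ⟨s, r, h₁, h₂, h₃, h₄⟩ := idxLE_iff.1 h
  obtain ⟨s', r', h₁', h₂', h₃', h₄'⟩ := idxLE_iff.1 h'
  refine idxLE_iff.2 ⟨s + s', r + r', ?_, ?_, ?_, ?_⟩ <;> push_cast <;> omega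

theorem idxLE_add_right {a b : Idx} (h : idxLE a b) (c : Idx) : idxLE (a + c) (b + c) := by
  obtain ⟨s, r, h₁, h₂, h₃, h₄⟩ := idxLE_iff.1 h
  refine idxLE_iff.2 ⟨s, r, ?_, ?_, ?_, ?_⟩ <;>
    simp only [Prod.fst_add, Prod.snd_add] <;> push_cast <;> omega

/-- The statistic which decreases along the partial order. -/
def idxKey (a : Idx) : ℕ := a.1 + a.2.2.2

/-- Each of the two generating steps lowers exactly one of the outer entries, by one. -/
theorem idxKey_lt {a b : Idx} (h : b ∈ idxAbove a) : idxKey b < idxKey a := by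
  obtain ⟨h, hne⟩ := h
  obtain ⟨s, r, h₁, h₂, h₃, h₄⟩ := idxLE_iff.1 h
  unfold idxKey
  by_contra hc
  exact hne (by ext <;> omega)

theorem idxAbove_of_le_of_above {a b c : Idx} (h : idxLE a b) (h' : c ∈ idxAbove b) :
    c ∈ idxAbove a := by
  refine ⟨idxLE_trans h h'.1, fun e => ?_⟩
  subst e
  have h1 := idxKey_lt h'
  rcases eq_or_ne a b with e | hne
  · exact h'.2 e.symm
  · have := idxKey_lt (a := a) ⟨h, hne⟩; omega

theorem idxAbove_of_above_of_le {a b c : Idx} (h : b ∈ idxAbove a) (h' : idxLE b c) :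
    c ∈ idxAbove a := by
  refine ⟨idxLE_trans h.1 h', fun e => ?_⟩
  subst e
  have h1 := idxKey_lt h
  rcases eq_or_ne b a with e | hne
  · exact h.2 e.symm
  · have := idxKey_lt (a := b) ⟨h', hne⟩; omega

theorem idxAbove_add_right {a b : Idx} (h : b ∈ idxAbove a) (c : Idx) :
    b + c ∈ idxAbove (a + c) :=
  ⟨idxLE_add_right h.1 c, fun e => h.2 (add_right_cancel e)⟩

theorem idxAbove_subset (a : Idx) : idxAbove a ⊆ {b | idxLE a b} := fun _ h => h.1

/-- Both generating steps preserve the sum of the entries, which therefore bounds every entry. -/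
theorem finite_idxLE (a : Idx) : {b | idxLE a b}.Finite := by
  refine ((Set.finite_Iic (a.1 + a.2.1 + a.2.2.1 + a.2.2.2)).prod
    ((Set.finite_Iic (a.1 + a.2.1 + a.2.2.1 + a.2.2.2)).prod
      ((Set.finite_Iic (a.1 + a.2.1 + a.2.2.1 + a.2.2.2)).prod
        (Set.finite_Iic (a.1 + a.2.1 + a.2.2.1 + a.2.2.2))))).subset ?_
  intro b h
  obtain ⟨s, r, h₁, h₂, h₃, h₄⟩ := idxLE_iff.1 h
  simp only [Set.mem_prod, Set.mem_Iic]
  omega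

/-- Both generating steps preserve the sum of the entries and the sum weighted by 7, 5, 3, 1. Hence
a single scaled version of σ serves all indices above a given one. -/
theorem normN_eq_of_idxLE {a b : Idx} (h : idxLE a b) : normN b = normN a := by
  obtain ⟨s, r, h₁, h₂, h₃, h₄⟩ := idxLE_iff.1 h
  obtain ⟨a₃, a₂, a₁, a₀⟩ := a
  obtain ⟨b₃, b₂, b₁, b₀⟩ := b
  dsimp only at h₁ h₂ h₃ h₄
  simp only [normN, h₁, h₂, h₃, h₄]
  ring

theorem bExp_two_mul (a : Idx) : 2 * (bExp a : ℤ) = (a.1 : ℤ) ^ 2 - a.1 + (a.2.1 ^ 2 - a.2.1) +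
    (a.2.2.1 ^ 2 - a.2.2.1) + (a.2.2.2 ^ 2 - a.2.2.2) := by
  have h : ∀ n : ℕ, 2 * (n.choose 2 : ℤ) = (n : ℤ) ^ 2 - n := fun n => by
    induction n with
    | zero => simp
    | succ n ih =>
      rw [Nat.choose_succ_succ' n 1, Nat.choose_one_right]; push_cast; linear_combination ih
  obtain ⟨a₃, a₂, a₁, a₀⟩ := a
  simp only [bExp]
  push_cast
  linear_combination h a₃ + h a₂ + h a₁ + h a₀

end Order

/-! ### Reordering monomials is triangular -/

section Triangularity

variable {K A : Type*} [Field K] [Ring A] [Algebra K A] {q : K} {u : Fin 4 → A}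

/-- The unit vectors. -/
def idxUnit : Fin 4 → Idx := ![(0, 0, 0, 1), (0, 0, 1, 0), (0, 1, 0, 0), (1, 0, 0, 0)]

/-- The sum of the entries belonging to indices larger than `i`. -/
def idxTail (i : Fin 4) (b : Idx) : ℤ :=
  (![b.1 + b.2.1 + b.2.2.1, b.1 + b.2.1, b.1, 0] : Fin 4 → ℕ) i

theorem pow_mul_comm_of {x y : A} {c : K} (h : x * y = c • (y * x)) (n : ℕ) :
    x * y ^ n = c ^ n • (y ^ n * x) := by
  induction n with
  | zero => simp
  | succ n ih =>
    rw [pow_succ, ← mul_assoc, ih, smul_mul_assoc, mul_assoc, h, mul_smul_comm, smul_smul,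
      ← pow_succ, mul_assoc]

theorem u_three_mul (b : Idx) : u 3 * ordMonomial u b = ordMonomial u (b + idxUnit 3) := by
  simp only [ordMonomial, idxUnit, ← mul_assoc, ← pow_succ']
  simp

theorem u_mul_mem {i : Fin 4} {P Q : Set Idx} (h : ∀ b ∈ P, u i * ordMonomial u b ∈
    qSpanOn q (ordMonomial u) Q) (hq : q ≠ 0) {x : A} (hx : x ∈ qSpanOn q (ordMonomial u) P) :
    u i * x ∈ qSpanOn q (ordMonomial u) Q :=
  map_mem_of_mem_qSpan (AddMonoidHom.mulLeft (u i)) (fun k b hb => by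
    rw [AddMonoidHom.coe_mulLeft, mul_smul_comm]
    exact zpow_smul_mem_qSpanOn hq _ (h b hb)) hx

/-- The element has the leading term `q ^ k • ordMonomial u b`. -/
def HasTop (q : K) (u : Fin 4 → A) (x : A) (b : Idx) (k : ℤ) : Prop :=
  x - q ^ k • ordMonomial u b ∈ qSpanOn q (ordMonomial u) (idxAbove b)

theorem HasTop.mem {x : A} {b : Idx} {k : ℤ} (h : HasTop q u x b k) :
    x ∈ qSpanOn q (ordMonomial u) {c | idxLE b c} := by
  have h1 := qSpan_mono (fun p hp => (idxAbove_subset b hp : p ∈ {p : ℤ × Idx | idxLE b p.2})) h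
  have h2 : q ^ k • ordMonomial u b ∈ qSpanOn q (ordMonomial u) {c | idxLE b c} :=
    zpow_smul_mem_qSpan (idxLE_refl b)
  have := add_mem h1 h2
  rwa [sub_add_cancel] at this

theorem HasTop.mul (hq : q ≠ 0) {i : Fin 4}
    (hi : ∀ b, HasTop q u (u i * ordMonomial u b) (b + idxUnit i) (-2 * idxTail i b))
    {x : A} {b : Idx} {k : ℤ} (h : HasTop q u x b k) :
    HasTop q u (u i * x) (b + idxUnit i) (k - 2 * idxTail i b) := by
  have h1 : u i * (x - q ^ k • ordMonomial u b) ∈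
      qSpanOn q (ordMonomial u) (idxAbove (b + idxUnit i)) := by
    refine u_mul_mem (fun c hc => ?_) hq h
    refine qSpan_mono (fun p hp => ?_) (hi c).mem
    exact idxAbove_of_above_of_le (idxAbove_add_right hc _) hp
  have h2 := zpow_smul_mem_qSpanOn hq k (hi b)
  unfold HasTop
  convert add_mem h1 h2 using 1
  rw [mul_sub, mul_smul_comm, smul_sub, smul_smul, ← zpow_add₀ hq, neg_mul, ← sub_eq_add_neg]
  abel

theorem hasTop_three (b : Idx) : HasTop q u (u 3 * ordMonomial u b) (b + idxUnit 3)
    (-2 * idxTail 3 b) := by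
  rw [HasTop, u_three_mul]
  simp [idxTail]

theorem HasTop.of_add (hq : q ≠ 0) {x y : A} {b c : Idx} {k : ℤ} (h : HasTop q u x b k)
    (hy : y ∈ qSpanOn q (ordMonomial u) {d | idxLE c d}) (hc : c ∈ idxAbove b) (m : ℤ) :
    HasTop q u (q ^ (-2 : ℤ) • x - (1 - q ^ m) • y) b (k - 2) := by
  have h1 := zpow_smul_mem_qSpanOn hq (-2) h
  have h2 : y ∈ qSpanOn q (ordMonomial u) (idxAbove b) :=
    qSpan_mono (fun p hp => idxAbove_of_above_of_le hc hp) hy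
  have h3 := zpow_smul_mem_qSpanOn hq m h2
  unfold HasTop
  convert add_mem (sub_mem h1 h2) h3 using 1
  rw [smul_sub, smul_smul, ← zpow_add₀ hq, show -2 + k = k - 2 by ring]
  module

namespace Straightening

variable (R : Straightening q u) (hq : q ≠ 0)
include R hq

theorem mul_01 : u 0 * u 1 = (q ^ 2)⁻¹ • (u 1 * u 0) := by
  rw [R.mul_10, inv_smul_smul₀ (pow_ne_zero 2 hq)]

theorem mul_12 : u 1 * u 2 = (q ^ 2)⁻¹ • (u 2 * u 1) := by
  rw [R.mul_21, inv_smul_smul₀ (pow_ne_zero 2 hq)]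

theorem mul_23 : u 2 * u 3 = (q ^ 2)⁻¹ • (u 3 * u 2) := by
  rw [R.mul_32, inv_smul_smul₀ (pow_ne_zero 2 hq)]

theorem mul_02 : u 0 * u 2 = (q ^ 2)⁻¹ • (u 2 * u 0) - (1 - (q ^ 2)⁻¹) • (u 1 * u 1) := by
  rw [R.mul_20]; match_scalars <;> field_simp; ring

theorem mul_13 : u 1 * u 3 = (q ^ 2)⁻¹ • (u 3 * u 1) - (1 - (q ^ 2)⁻¹) • (u 2 * u 2) := by
  rw [R.mul_31]; match_scalars <;> field_simp; ring

theorem mul_03 : u 0 * u 3 = (q ^ 2)⁻¹ • (u 3 * u 0) - (1 - (q ^ 4)⁻¹) • (u 2 * u 1) := by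
  rw [R.mul_30, R.mul_21]; match_scalars <;> field_simp; ring

theorem u_two_mul (b : Idx) :
    u 2 * ordMonomial u b = q ^ (-2 * (b.1 : ℤ)) • ordMonomial u (b + idxUnit 2) := by
  have h := pow_mul_comm_of (R.mul_23 hq) b.1
  simp only [ordMonomial]
  rw [← mul_assoc, ← mul_assoc, ← mul_assoc, h, smul_mul_assoc, smul_mul_assoc, smul_mul_assoc,
    mul_assoc (u 3 ^ b.1), ← pow_succ']
  simp [idxUnit, zpow_mul, zpow_neg]

theorem hasTop_two (b : Idx) : HasTop q u (u 2 * ordMonomial u b) (b + idxUnit 2)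
    (-2 * idxTail 2 b) := by
  rw [HasTop, R.u_two_mul hq]
  simp [idxTail]

theorem hasTop_one_of_first_eq_zero (b : Idx) (hb : b.1 = 0) :
    HasTop q u (u 1 * ordMonomial u b) (b + idxUnit 1) (-2 * idxTail 1 b) := by
  have h := pow_mul_comm_of (R.mul_12 hq) b.2.1
  have e : u 1 * ordMonomial u b = q ^ (-2 * (b.2.1 : ℤ)) • ordMonomial u (b + idxUnit 1) := by
    simp only [ordMonomial, hb, pow_zero, one_mul, ← mul_assoc]
    rw [h, smul_mul_assoc, smul_mul_assoc, mul_assoc (u 2 ^ b.2.1), ← pow_succ']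
    simp [idxUnit, hb, zpow_mul, zpow_neg]
  rw [HasTop, e]
  simp [idxTail, hb]

/-- Moving `u 1` past `u 3` costs q⁻² and creates a correction in which `u 3` and `u 1` are replaced
by two factors `u 2`. Its exponent is strictly higher by one generating step. Moving `u 0` below
follows the same pattern. -/
theorem hasTop_one (b : Idx) : HasTop q u (u 1 * ordMonomial u b) (b + idxUnit 1)
    (-2 * idxTail 1 b) := by
  obtain ⟨n, b₂, b₁, b₀⟩ := b
  induction n with
  | zero => exact R.hasTop_one_of_first_eq_zero hq _ rfl
  | succ n ih =>
    have h1 := ih.mul hq (hasTop_three)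
    have h2 := (R.hasTop_two hq (n, b₂, b₁, b₀)).mul hq (R.hasTop_two hq)
    have e : u 1 * ordMonomial u (n + 1, b₂, b₁, b₀) =
        q ^ (-2 : ℤ) • (u 3 * (u 1 * ordMonomial u (n, b₂, b₁, b₀))) -
          (1 - q ^ (-2 : ℤ)) • (u 2 * (u 2 * ordMonomial u (n, b₂, b₁, b₀))) := by
      rw [show ((n + 1, b₂, b₁, b₀) : Idx) = (n, b₂, b₁, b₀) + idxUnit 3 by simp [idxUnit],
        ← u_three_mul, ← mul_assoc, R.mul_13 hq, sub_mul, smul_mul_assoc, smul_mul_assoc,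
        mul_assoc, mul_assoc, zpow_neg]
      norm_cast
    rw [e]
    convert h1.of_add hq h2.mem ?_ (-2) using 1
    · simp [idxUnit]
    · simp [idxTail]; ring
    · refine ⟨idxLE_iff.2 ⟨1, 0, ?_, ?_, ?_, ?_⟩, ?_⟩ <;> simp [idxUnit, add_assoc]

theorem hasTop_zero_of_first_eq_zero (b : Idx) (hb : b.1 = 0) :
    HasTop q u (u 0 * ordMonomial u b) (b + idxUnit 0) (-2 * idxTail 0 b) := by
  obtain ⟨b₃, n, b₁, b₀⟩ := b
  obtain rfl : b₃ = 0 := hb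
  induction n with
  | zero =>
    have h := pow_mul_comm_of (R.mul_01 hq) b₁
    have e : u 0 * ordMonomial u (0, 0, b₁, b₀) =
        q ^ (-2 * (b₁ : ℤ)) • ordMonomial u ((0, 0, b₁, b₀) + idxUnit 0) := by
      simp only [ordMonomial, pow_zero, one_mul, ← mul_assoc]
      rw [h, smul_mul_assoc, mul_assoc (u 1 ^ b₁), ← pow_succ']
      simp [idxUnit, zpow_mul, zpow_neg]
    rw [HasTop, e]
    simp [idxTail]
  | succ n ih =>
    have h1 := ih.mul hq (R.hasTop_two hq)
    have h2 := (R.hasTop_one hq (0, n, b₁, b₀)).mul hq (R.hasTop_one hq)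
    have e' : ordMonomial u (0, n + 1, b₁, b₀) = u 2 * ordMonomial u (0, n, b₁, b₀) := by
      rw [R.u_two_mul hq]; simp [idxUnit]
    have e : u 0 * ordMonomial u (0, n + 1, b₁, b₀) =
        q ^ (-2 : ℤ) • (u 2 * (u 0 * ordMonomial u (0, n, b₁, b₀))) -
          (1 - q ^ (-2 : ℤ)) • (u 1 * (u 1 * ordMonomial u (0, n, b₁, b₀))) := by
      rw [e', ← mul_assoc, R.mul_02 hq, sub_mul, smul_mul_assoc, smul_mul_assoc,
        mul_assoc, mul_assoc, zpow_neg]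
      norm_cast
    rw [e]
    convert h1.of_add hq h2.mem ?_ (-2) using 1
    · simp [idxUnit]
    · simp [idxTail, idxUnit]; ring
    · refine ⟨idxLE_iff.2 ⟨0, 1, ?_, ?_, ?_, ?_⟩, ?_⟩ <;> simp [idxUnit, add_assoc]

theorem hasTop_zero (b : Idx) : HasTop q u (u 0 * ordMonomial u b) (b + idxUnit 0)
    (-2 * idxTail 0 b) := by
  obtain ⟨n, b₂, b₁, b₀⟩ := b
  induction n with
  | zero => exact R.hasTop_zero_of_first_eq_zero hq _ rfl
  | succ n ih =>
    have h1 := ih.mul hq (hasTop_three)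
    have h2 := (R.hasTop_one hq (n, b₂, b₁, b₀)).mul hq (R.hasTop_two hq)
    have e : u 0 * ordMonomial u (n + 1, b₂, b₁, b₀) =
        q ^ (-2 : ℤ) • (u 3 * (u 0 * ordMonomial u (n, b₂, b₁, b₀))) -
          (1 - q ^ (-4 : ℤ)) • (u 2 * (u 1 * ordMonomial u (n, b₂, b₁, b₀))) := by
      rw [show ((n + 1, b₂, b₁, b₀) : Idx) = (n, b₂, b₁, b₀) + idxUnit 3 by simp [idxUnit],
        ← u_three_mul, ← mul_assoc, R.mul_03 hq, sub_mul, smul_mul_assoc, smul_mul_assoc,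
        mul_assoc, mul_assoc, zpow_neg, zpow_neg]
      norm_cast
    rw [e]
    convert h1.of_add hq h2.mem ?_ (-4) using 1
    · simp [idxUnit]
    · simp [idxTail]; ring
    -- Replacing `u 3` and `u 0` by `u 2` and `u 1` is the sum of the two generating steps.
    · refine ⟨idxLE_iff.2 ⟨1, 1, ?_, ?_, ?_, ?_⟩, ?_⟩ <;> simp [idxUnit] <;> omega

theorem hasTop_mul (i : Fin 4) (b : Idx) : HasTop q u (u i * ordMonomial u b) (b + idxUnit i)
    (-2 * idxTail i b) := by
  fin_cases i
  exacts [R.hasTop_zero hq b, R.hasTop_one hq b, R.hasTop_two hq b, hasTop_three b]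

theorem hasTop_pow_mul (i : Fin 4) {x : A} {b : Idx} {k : ℤ} (h : HasTop q u x b k) (n : ℕ) :
    HasTop q u (u i ^ n * x) (b + n • idxUnit i) (k - n * (2 * idxTail i b)) := by
  induction n with
  | zero => simpa using h
  | succ n ih =>
    rw [pow_succ', mul_assoc]
    convert ih.mul hq (R.hasTop_mul hq i) using 1
    · rw [succ_nsmul, add_assoc]
    · have : idxTail i (b + n • idxUnit i) = idxTail i b := by
        fin_cases i <;> simp [idxTail, idxUnit]
      rw [this]; push_cast; ring

/-- The leading term of the monomials in the opposite order. -/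
theorem hasTop_reverse (a : Idx) :
    HasTop q u (u 0 ^ a.2.2.2 * (u 1 ^ a.2.2.1 * (u 2 ^ a.2.1 * u 3 ^ a.1))) a
      (-2 * (a.2.1 * a.1 + a.2.2.1 * (a.1 + a.2.1) + a.2.2.2 * (a.1 + a.2.1 + a.2.2.1) : ℤ)) := by
  have h3 : HasTop q u (u 3 ^ a.1) (a.1, 0, 0, 0) 0 := by simp [HasTop, ordMonomial]
  convert R.hasTop_pow_mul hq 0 (R.hasTop_pow_mul hq 1 (R.hasTop_pow_mul hq 2 h3 a.2.1) a.2.2.1)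
    a.2.2.2 using 1
  · simp [idxUnit]
  · simp [idxUnit, idxTail]; ring

end Straightening

end Triangularity

/-! ### The action of σ on the dual PBW elements -/

section Sigma

variable {K A : Type*} [Field K] [Ring A] [Algebra K A] {q : K} {u : Fin 4 → A}

/-- The dual PBW elements. -/
def pbw (q : K) (u : Fin 4 → A) (a : Idx) : A := q ^ bExp a • ordMonomial u a

theorem pbw_eq_zpow (q : K) (u : Fin 4 → A) :
    pbw q u = fun a => q ^ (bExp a : ℤ) • ordMonomial u a :=
  funext fun a => by rw [pbw, zpow_natCast]

theorem qSpanOn_pbw (hq : q ≠ 0) (P : Set Idx) :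
    qSpanOn q (pbw q u) P = qSpanOn q (ordMonomial u) P := by
  rw [pbw_eq_zpow, qSpanOn_zpow_smul hq]

/-- The properties of the anti-automorphism `σ`. -/
structure IsAnti (q : K) (u : Fin 4 → A) (σ : A →+ A) : Prop where
  map_one : σ 1 = 1
  map_mul (x y : A) : σ (x * y) = σ y * σ x
  map_smul (x : A) : σ (q • x) = q⁻¹ • σ x
  map_u (i : Fin 4) : σ (u i) = q ^ (2 * (i : ℕ)) • u i

namespace IsAnti

variable {σ : A →+ A} (hσ : IsAnti q u σ)
include hσ

theorem map_pow (x : A) (n : ℕ) : σ (x ^ n) = σ x ^ n := by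
  induction n with
  | zero => rw [pow_zero, pow_zero, hσ.map_one]
  | succ n ih => rw [pow_succ, pow_succ', hσ.map_mul, ih]

theorem map_zpow_smul (hq : q ≠ 0) (k : ℤ) (x : A) : σ (q ^ k • x) = q ^ (-k) • σ x := by
  have h2 : ∀ x, σ (q⁻¹ • x) = q • σ x := fun x => by
    have := hσ.map_smul (q⁻¹ • x)
    rw [smul_inv_smul₀ hq] at this
    rw [this, smul_inv_smul₀ hq]
  induction k using Int.induction_on with
  | zero => simp
  | succ n ih =>
    rw [add_comm, zpow_add₀ hq, zpow_one, mul_smul, hσ.map_smul, ih, smul_smul, ← zpow_neg_one,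
      ← zpow_add₀ hq]
    congr 2; ring
  | pred n ih =>
    rw [sub_eq_add_neg, add_comm, zpow_add₀ hq, zpow_neg_one, mul_smul, h2, ih, smul_smul]
    nth_rw 1 [← zpow_one q]
    rw [← zpow_add₀ hq]
    congr 2; ring

theorem map_pow_smul (hq : q ≠ 0) (k : ℕ) (x : A) : σ (q ^ k • x) = (q ^ k)⁻¹ • σ x := by
  rw [← zpow_natCast, hσ.map_zpow_smul hq, zpow_neg]

theorem map_ordMonomial (a : Idx) : σ (ordMonomial u a) =
    q ^ (6 * a.1 + 4 * a.2.1 + 2 * a.2.2.1) •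
      (u 0 ^ a.2.2.2 * (u 1 ^ a.2.2.1 * (u 2 ^ a.2.1 * u 3 ^ a.1))) := by
  simp only [ordMonomial, hσ.map_mul, hσ.map_pow, hσ.map_u, smul_pow, smul_mul_assoc,
    mul_smul_comm, smul_smul, ← pow_mul, ← pow_add]
  congr 2
  simp only [Fin.val_zero, Fin.val_one, Fin.val_two, show ((3 : Fin 4) : ℕ) = 3 from rfl]
  ring

/-- Applying σ reverses the monomial, and `hasTop_reverse` restores its order up to higher terms.
The norm is exactly the exponent that makes the leading coefficient one. -/
theorem map_pbw (hq : q ≠ 0) (R : Straightening q u) (a : Idx) :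
    q ^ normN a • σ (pbw q u a) - pbw q u a ∈ qSpanOn q (pbw q u) (idxAbove a) := by
  have h := zpow_smul_mem_qSpanOn hq
    (normN a - bExp a + (6 * a.1 + 4 * a.2.1 + 2 * a.2.2.1 : ℕ)) (R.hasTop_reverse hq a)
  rw [qSpanOn_pbw hq]
  convert h using 1
  rw [congrFun (pbw_eq_zpow q u) a, hσ.map_zpow_smul hq, hσ.map_ordMonomial, ← zpow_natCast, smul_smul, smul_smul,
    smul_sub, smul_smul, ← zpow_add₀ hq, ← zpow_add₀ hq, ← zpow_add₀ hq]
  congr 3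
  have := bExp_two_mul a
  obtain ⟨a₃, a₂, a₁, a₀⟩ := a
  simp only [normN]
  push_cast
  linear_combination this

end IsAnti

end Sigma

/-! ### The Kazhdan-Lusztig argument for unitriangular involutions -/

section LaurentEval

variable {K A ι : Type*} [Field K] [AddCommGroup A] [Module K A] {q : K} {E : ι → A}

/-- The value at `q` of a Laurent polynomial with integral coefficients. -/
noncomputable def laurentEval (q : K) : (ℤ →₀ ℤ) →+ K :=
  Finsupp.liftAddHom fun k => (AddMonoidHom.mulRight (q ^ k)).comp (Int.castAddHom K)

theorem laurentEval_single (k n : ℤ) : laurentEval q (Finsupp.single k n) = n * q ^ k := by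
  simp [laurentEval]

/-- The involution `q ↦ q⁻¹` of Laurent polynomials. -/
noncomputable def laurentBar : (ℤ →₀ ℤ) ≃+ (ℤ →₀ ℤ) := Finsupp.domCongr (Equiv.neg ℤ)

theorem laurentBar_apply (f : ℤ →₀ ℤ) (k : ℤ) : laurentBar f k = f (-k) := rfl

theorem laurentBar_single (k n : ℤ) :
    laurentBar (Finsupp.single k n) = Finsupp.single (-k) n :=
  Finsupp.equivMapDomain_single _ _ _

theorem laurentEval_smul_eq (k n : ℤ) (x : A) :
    laurentEval q (Finsupp.single k n) • x = n • q ^ k • x := by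
  rw [laurentEval_single, mul_smul, Int.cast_smul_eq_zsmul]

theorem map_laurentEval_smul (τ : A →+ A) (hτ : ∀ (k : ℤ) x, τ (q ^ k • x) = q ^ (-k) • τ x)
    (f : ℤ →₀ ℤ) (x : A) : τ (laurentEval q f • x) = laurentEval q (laurentBar f) • τ x := by
  induction f using Finsupp.induction_linear with
  | zero => simp
  | add f g hf hg => simp only [map_add, add_smul, hf, hg]
  | single k n => rw [laurentBar_single, laurentEval_smul_eq, laurentEval_smul_eq, map_zsmul, hτ]

theorem laurentEval_smul_mem {b : ι} (f : ℤ →₀ ℤ) {P : Set (ℤ × ι)}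
    (h : ∀ k, f k ≠ 0 → (k, b) ∈ P) : laurentEval q f • E b ∈ qSpan q E P := by
  rw [← Finsupp.sum_single f, Finsupp.sum, map_sum, Finset.sum_smul]
  refine sum_mem fun k hk => ?_
  rw [laurentEval_smul_eq]
  exact zsmul_mem (zpow_smul_mem_qSpan (h k (Finsupp.mem_support_iff.1 hk))) _

theorem laurentEval_smul_mem_qSpanOn (hq : q ≠ 0) (f : ℤ →₀ ℤ) {P : Set ι} {x : A}
    (hx : x ∈ qSpanOn q E P) : laurentEval q f • x ∈ qSpanOn q E P := by
  rw [← Finsupp.sum_single f, Finsupp.sum, map_sum, Finset.sum_smul]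
  refine sum_mem fun k hk => ?_
  rw [laurentEval_smul_eq]
  exact zsmul_mem (zpow_smul_mem_qSpanOn hq k hx) _

theorem exists_of_mem_qSpan_insert {Q : Set ℤ} {b : ι} {P : Set ι} {x : A}
    (hx : x ∈ qSpan q E {p | p.1 ∈ Q ∧ p.2 ∈ insert b P}) :
    ∃ f : ℤ →₀ ℤ, (∀ k, f k ≠ 0 → k ∈ Q) ∧ ∃ y ∈ qSpan q E {p | p.1 ∈ Q ∧ p.2 ∈ P},
      x = laurentEval q f • E b + y := by
  induction hx using AddSubgroup.closure_induction with
  | mem x hx =>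
    obtain ⟨⟨k, c⟩, ⟨hk, hc⟩, rfl⟩ := hx
    rcases hc with rfl | hc
    · refine ⟨Finsupp.single k 1, fun j hj => ?_, 0, zero_mem _, ?_⟩
      · rw [Finsupp.single_apply] at hj
        by_cases h : k = j
        · exact h ▸ hk
        · simp [h] at hj
      · rw [laurentEval_smul_eq, one_smul, add_zero]
    · exact ⟨0, fun _ h => absurd rfl h, _, zpow_smul_mem_qSpan ⟨hk, hc⟩, by simp⟩
  | zero => exact ⟨0, fun _ h => absurd rfl h, 0, zero_mem _, by simp⟩
  | add x y _ _ hx hy =>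
    obtain ⟨f, hf, x', hx', rfl⟩ := hx
    obtain ⟨g, hg, y', hy', rfl⟩ := hy
    refine ⟨f + g, fun k hk => ?_, x' + y', add_mem hx' hy', by rw [map_add, add_smul]; abel⟩
    by_contra hkQ
    exact hk (by rw [Finsupp.add_apply, not_imp_comm.1 (hf k) hkQ, not_imp_comm.1 (hg k) hkQ,
      add_zero])
  | neg x _ hx =>
    obtain ⟨f, hf, x', hx', rfl⟩ := hx
    exact ⟨-f, fun k hk => hf k (by simpa using hk), -x', neg_mem hx',
      by rw [map_neg, neg_smul, neg_add]⟩

theorem eq_zero_of_smul_mem (hE : LinearIndependent K E) {b : ι} {P : Set ι} (hb : b ∉ P) {c : K}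
    (h : c • E b ∈ qSpanOn q E P) : c = 0 := by
  by_contra hc
  have h1 := Submodule.span_mono (Set.image_mono (by
    rintro _ ⟨p, hp, rfl⟩; exact hp : Prod.snd '' {p : ℤ × ι | p.2 ∈ P} ⊆ P)) (qSpan_le_span h)
  rw [Submodule.smul_mem_iff _ hc] at h1
  exact hE.notMem_span_image hb h1

/-- A unitriangular semilinear involution has no anti-invariants except the obvious ones. -/
theorem exists_sub_eq_of_antiinvariant (hq : q ≠ 0) (hE : LinearIndependent K E)
    (hev : Function.Injective (laurentEval q)) (key : ι → ℕ) (τ : A →+ A)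
    (hτ : ∀ (k : ℤ) x, τ (q ^ k • x) = q ^ (-k) • τ x) (hττ : ∀ x, τ (τ x) = x) (P : Finset ι) :
    (∀ b ∈ P, τ (E b) - E b ∈ qSpanOn q E {c | c ∈ P ∧ key c < key b}) →
    ∀ y ∈ qSpanOn q E {b | b ∈ P}, τ y = -y →
      ∃ w ∈ qSpan q E {p | 0 < p.1 ∧ p.2 ∈ P}, w - τ w = y := by
  classical
  refine Finset.induction_on_max_value key P ?_ ?_
  · intro _ y hy _
    have : y ∈ (⊥ : AddSubgroup A) :=
      map_mem_of_mem_qSpan (AddMonoidHom.id A) (fun k b h => absurd h (by simp)) hy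
    exact ⟨0, zero_mem _, by simpa using (AddSubgroup.mem_bot.1 this).symm⟩
  · intro b P hb hmax ih hP y hy hτy
    have hP' : ∀ c ∈ P, τ (E c) - E c ∈ qSpanOn q E {d | d ∈ P ∧ key d < key c} := fun c hc => by
      refine qSpan_mono (fun p hp => ?_) (hP c (Finset.mem_insert_of_mem hc))
      obtain ⟨h1, h2⟩ := hp
      refine ⟨(Finset.mem_insert.1 h1).resolve_left fun e => ?_, h2⟩
      have := hmax c hc
      rw [e] at h2; omega
    have hPb : τ (E b) - E b ∈ qSpanOn q E {c | c ∈ P} := by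
      refine qSpan_mono (fun p hp => ?_) (hP b (Finset.mem_insert_self b P))
      obtain ⟨h1, h2⟩ := hp
      exact (Finset.mem_insert.1 h1).resolve_left fun e => by rw [e] at h2; omega
    have hτP : ∀ x ∈ qSpanOn q E {c | c ∈ P}, τ x ∈ qSpanOn q E {c | c ∈ P} := fun x hx =>
      map_mem_of_mem_qSpan τ (fun k c hc => by
        rw [hτ]
        refine zpow_smul_mem_qSpanOn hq _ ?_
        have h1 := qSpan_mono (fun p hp => hp.1) (hP' c hc)
        have h2 : E c ∈ qSpanOn q E {c | c ∈ P} := mem_qSpan hc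
        have := add_mem h1 h2
        rwa [sub_add_cancel] at this) hx
    obtain ⟨f, -, y', hy', rfl⟩ := exists_of_mem_qSpan_insert (Q := Set.univ) (b := b)
      (P := {c | c ∈ P}) (qSpan_mono (fun p hp => And.intro trivial (by simpa using hp)) hy)
    replace hy' : y' ∈ qSpanOn q E {c | c ∈ P} := qSpan_mono (fun p hp => hp.2) hy'
    -- The coefficient at an index of maximal key receives no contribution from the other indices
    -- under τ, so it is itself antisymmetric.
    have hf : laurentBar f = -f := by
      rw [eq_neg_iff_add_eq_zero]
      refine hev ?_
      rw [map_zero, map_add]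
      refine eq_zero_of_smul_mem (q := q) (P := {c | c ∈ P}) hE hb ?_
      have e : (laurentEval q (laurentBar f) + laurentEval q f) • E b =
          -(laurentEval q (laurentBar f) • (τ (E b) - E b)) - τ y' - y' := by
        rw [map_add, map_laurentEval_smul τ hτ] at hτy
        rw [add_smul, smul_sub]
        linear_combination (norm := module) hτy
      rw [e]
      exact sub_mem (sub_mem (neg_mem (laurentEval_smul_mem_qSpanOn hq _ hPb)) (hτP _ hy')) hy'
    -- An antisymmetric Laurent polynomial has no constant term, hence it equals its part of
    -- positive degree minus the mirror image of that part, without any division by two.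
    set g := f.filter (0 < ·) with hg
    have hgf : g - laurentBar g = f := by
      ext k
      have h1 : f (-k) = -f k := by
        rw [← laurentBar_apply, hf]; rfl
      rw [Finsupp.sub_apply, laurentBar_apply, hg, Finsupp.filter_apply, Finsupp.filter_apply]
      rcases lt_trichotomy k 0 with h | rfl | h
      · rw [if_neg (by omega), if_pos (by omega), h1]; ring
      · simp only [neg_zero] at h1 ⊢; simp; omega
      · rw [if_pos h, if_neg (by omega), sub_zero]
    set w := laurentEval q g • E b with hw
    have hfg : laurentEval q f = laurentEval q g - laurentEval q (laurentBar g) := by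
      rw [← map_sub, hgf]
    have hy1 : laurentEval q f • E b + y' - (w - τ w) =
        y' + laurentEval q (laurentBar g) • (τ (E b) - E b) := by
      rw [hw, map_laurentEval_smul τ hτ, hfg]; module
    -- Subtracting w - τ w removes the index b and keeps anti-invariance, because τ is an
    -- involution.
    obtain ⟨w', hw', h⟩ := ih hP' (laurentEval q f • E b + y' - (w - τ w))
      (by rw [hy1]; exact add_mem hy' (laurentEval_smul_mem_qSpanOn hq _ hPb))
      (by rw [map_sub, hτy, map_sub, hττ]; abel)
    refine ⟨w + w', add_mem ?_ ?_, ?_⟩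
    · refine laurentEval_smul_mem g fun k hk => ⟨?_, Finset.mem_insert_self b P⟩
      by_contra hk'
      exact hk (Finsupp.filter_apply_neg _ _ hk')
    · exact qSpan_mono (fun p hp => And.intro hp.1 (Finset.mem_insert_of_mem hp.2)) hw'
    · rw [map_add]; linear_combination (norm := abel) h

/-- The uniqueness half: the coefficient at an index of maximal key would be symmetric under q ↦ q⁻¹
and have only positive exponents. -/
theorem eq_zero_of_invariant (hq : q ≠ 0) (hE : LinearIndependent K E)
    (hev : Function.Injective (laurentEval q)) (key : ι → ℕ) (τ : A →+ A)
    (hτ : ∀ (k : ℤ) x, τ (q ^ k • x) = q ^ (-k) • τ x) (P : Finset ι) :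
    (∀ b ∈ P, τ (E b) - E b ∈ qSpanOn q E {c | c ∈ P ∧ key c < key b}) →
    ∀ w ∈ qSpan q E {p | 0 < p.1 ∧ p.2 ∈ P}, τ w = w → w = 0 := by
  classical
  refine Finset.induction_on_max_value key P ?_ ?_
  · intro _ y hy _
    have : y ∈ (⊥ : AddSubgroup A) :=
      map_mem_of_mem_qSpan (AddMonoidHom.id A) (fun k b h => absurd h (by simp)) hy
    exact AddSubgroup.mem_bot.1 this
  · intro b P hb hmax ih hP y hy hτy
    have hP' : ∀ c ∈ P, τ (E c) - E c ∈ qSpanOn q E {d | d ∈ P ∧ key d < key c} := fun c hc => by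
      refine qSpan_mono (fun p hp => ?_) (hP c (Finset.mem_insert_of_mem hc))
      obtain ⟨h1, h2⟩ := hp
      refine ⟨(Finset.mem_insert.1 h1).resolve_left fun e => ?_, h2⟩
      have := hmax c hc
      rw [e] at h2; omega
    have hPb : τ (E b) - E b ∈ qSpanOn q E {c | c ∈ P} := by
      refine qSpan_mono (fun p hp => ?_) (hP b (Finset.mem_insert_self b P))
      obtain ⟨h1, h2⟩ := hp
      exact (Finset.mem_insert.1 h1).resolve_left fun e => by rw [e] at h2; omega
    have hτP : ∀ x ∈ qSpanOn q E {c | c ∈ P}, τ x ∈ qSpanOn q E {c | c ∈ P} := fun x hx =>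
      map_mem_of_mem_qSpan τ (fun k c hc => by
        rw [hτ]
        refine zpow_smul_mem_qSpanOn hq _ ?_
        have h1 := qSpan_mono (fun p hp => hp.1) (hP' c hc)
        have h2 : E c ∈ qSpanOn q E {c | c ∈ P} := mem_qSpan hc
        have := add_mem h1 h2
        rwa [sub_add_cancel] at this) hx
    obtain ⟨f, hfpos, y', hy'', rfl⟩ := exists_of_mem_qSpan_insert (Q := {k | 0 < k}) (b := b)
      (P := {c | c ∈ P}) (qSpan_mono (fun p hp => And.intro hp.1 (by simpa using hp.2)) hy)
    have hy' : y' ∈ qSpanOn q E {c | c ∈ P} := qSpan_mono (fun p hp => hp.2) hy''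
    have hf : laurentBar f = f := by
      rw [← sub_eq_zero]
      refine hev ?_
      rw [map_zero, map_sub]
      refine eq_zero_of_smul_mem (q := q) (P := {c | c ∈ P}) hE hb ?_
      have e : (laurentEval q (laurentBar f) - laurentEval q f) • E b =
          -(laurentEval q (laurentBar f) • (τ (E b) - E b)) - τ y' + y' := by
        rw [map_add, map_laurentEval_smul τ hτ] at hτy
        rw [sub_smul, smul_sub]
        linear_combination (norm := module) hτy
      rw [e]
      exact add_mem (sub_mem (neg_mem (laurentEval_smul_mem_qSpanOn hq _ hPb)) (hτP _ hy')) hy'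
    obtain rfl : f = 0 := by
      ext k
      by_contra hk
      have h1 := hfpos k hk
      have h2 := hfpos (-k) (by rw [← laurentBar_apply, hf]; exact hk)
      simp only [Set.mem_ofPred_eq] at h1 h2
      omega
    rw [map_zero, zero_smul, zero_add] at hτy ⊢
    exact ih hP' y' hy'' hτy

/-- After multiplication by a power of q that clears the negative exponents, this is the
transcendence of q. -/
theorem laurentEval_q_injective : Function.Injective (laurentEval KroneckerQuantum.q) := by
  rw [injective_iff_map_eq_zero]
  intro f hf
  obtain ⟨n, hn⟩ : ∃ n : ℕ, ∀ k ∈ f.support, -(n : ℤ) ≤ k := by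
    refine ⟨∑ k ∈ f.support, k.natAbs, fun k hk => ?_⟩
    have := Finset.single_le_sum (f := Int.natAbs) (fun _ _ => Nat.zero_le _) hk
    omega
  set p : Polynomial ℚ := ∑ k ∈ f.support, Polynomial.monomial (k + n).toNat (f k : ℚ) with hp
  have h0 : Polynomial.aeval KroneckerQuantum.q p =
      KroneckerQuantum.q ^ n * laurentEval KroneckerQuantum.q f := by
    conv_rhs => rw [← Finsupp.sum_single f, Finsupp.sum, map_sum, Finset.mul_sum]
    rw [hp, map_sum]
    refine Finset.sum_congr rfl fun k hk => ?_
    have := hn k hk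
    rw [Polynomial.aeval_monomial, laurentEval_single, map_intCast, ← zpow_natCast, ← zpow_natCast,
      Int.toNat_of_nonneg (by omega), zpow_add₀ q_ne_zero]
    ring
  have hp0 : p = 0 := by
    by_contra h
    exact aeval_q_ne_zero h (by rw [h0, hf, mul_zero])
  ext k
  by_contra hk
  have hk' : k ∈ f.support := Finsupp.mem_support_iff.2 hk
  have h1 : p.coeff (k + n).toNat = f k := by
    rw [hp, Polynomial.finsetSum_coeff, Finset.sum_eq_single_of_mem k hk']
    · rw [Polynomial.coeff_monomial, if_pos rfl]
    · intro j hj hjk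
      have := hn k hk'
      have := hn j hj
      rw [Polynomial.coeff_monomial, if_neg (by omega)]
  rw [hp0, Polynomial.coeff_zero] at h1
  exact hk (by exact_mod_cast h1.symm)

end LaurentEval

/-! ### Existence and uniqueness of dual canonical elements -/

section DualCanonical

variable {K A : Type*} [Field K] [Ring A] [Algebra K A] {q : K} {u : Fin 4 → A}

/-- The conditions which characterize the element `B[a]` of the dual canonical basis. -/
def IsDualCanonicalElement (q : K) (u : Fin 4 → A) (σ : A →+ A) (a : Idx) (x : A) : Prop :=
  x - pbw q u a ∈ qSpan q (pbw q u) {p | 0 < p.1 ∧ p.2 ∈ idxAbove a} ∧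
    σ x = q ^ (-normN a) • x

theorem aeval_smul_mem_qSpan [Algebra ℤ K] {ι : Type*} {E : ι → A} (b : ι) (p : Polynomial ℤ)
    (hp : Polynomial.X ∣ p) {P : Set ι} (hb : b ∈ P) :
    Polynomial.aeval q p • E b ∈ qSpan q E {p | 0 < p.1 ∧ p.2 ∈ P} := by
  obtain ⟨r, rfl⟩ := hp
  induction r using Polynomial.induction_on' with
  | add f g hf hg => rw [mul_add, map_add, add_smul]; exact add_mem hf hg
  | monomial n c =>
    have : Polynomial.aeval q (Polynomial.X * Polynomial.monomial n c) • E b =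
        c • q ^ ((n : ℤ) + 1) • E b := by
      rw [Polynomial.X_mul_monomial, Polynomial.aeval_monomial, mul_smul]
      rw [← zpow_natCast, eq_intCast, Int.cast_smul_eq_zsmul, Nat.cast_succ]
    rw [this]
    exact zsmul_mem (zpow_smul_mem_qSpan (show _ ∧ _ from ⟨by dsimp only; omega, hb⟩)) c

/-- Translates coefficients in qℤ[q], as in the definition of the basis, into spans with positive
exponents. -/
theorem mem_qSpan_iff_exists [Algebra ℤ K] {ι : Type*} {E : ι → A} (x : A) (P : Set ι) :
    x ∈ qSpan q E {p | 0 < p.1 ∧ p.2 ∈ P} ↔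
      ∃ c : ι →₀ Polynomial ℤ, (∀ b ∈ c.support, b ∈ P) ∧ (∀ b, Polynomial.X ∣ c b) ∧
        x = c.sum fun b p => Polynomial.aeval q p • E b := by
  classical
  constructor
  · intro hx
    induction hx using AddSubgroup.closure_induction with
    | mem x hx =>
      obtain ⟨⟨k, b⟩, ⟨hk, hb⟩, rfl⟩ := hx
      refine ⟨Finsupp.single b (Polynomial.X ^ k.toNat), fun c hc => ?_, fun c => ?_, ?_⟩
      · rw [Finset.mem_singleton.1 (Finsupp.support_single_subset hc)]; exact hb
      · rw [Finsupp.single_apply]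
        split_ifs
        · exact dvd_pow_self _ (by simp only at hk; omega)
        · exact dvd_zero _
      · rw [Finsupp.sum_single_index (by simp), map_pow, Polynomial.aeval_X, ← zpow_natCast,
          Int.toNat_of_nonneg (le_of_lt hk)]
    | zero => exact ⟨0, by simp, by simp, by simp⟩
    | add x y _ _ hx hy =>
      obtain ⟨c, h1, h2, rfl⟩ := hx
      obtain ⟨d, h3, h4, rfl⟩ := hy
      refine ⟨c + d, fun b hb => ?_, fun b => dvd_add (h2 b) (h4 b), ?_⟩
      · exact (Finset.mem_union.1 (Finsupp.support_add hb)).elim (h1 b) (h3 b)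
      · rw [Finsupp.sum_add_index' (by simp) (by intros; rw [map_add, add_smul])]
    | neg x _ hx =>
      obtain ⟨c, h1, h2, rfl⟩ := hx
      refine ⟨-c, fun b hb => h1 b (by simpa using hb), fun b => (dvd_neg).2 (h2 b), ?_⟩
      rw [Finsupp.sum_neg_index (by simp), Finsupp.sum, Finsupp.sum, ← Finset.sum_neg_distrib]
      simp only [map_neg, neg_smul]
  · rintro ⟨c, h1, h2, rfl⟩
    exact sum_mem fun b hb => aeval_smul_mem_qSpan b _ (h2 b) (h1 b hb)

/-- The finite set of indices above a given one. -/
noncomputable def idxAboveFinset (a : Idx) : Finset Idx :=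
  ((finite_idxLE a).subset (idxAbove_subset a)).toFinset

theorem mem_idxAboveFinset {a b : Idx} : b ∈ idxAboveFinset a ↔ b ∈ idxAbove a := by
  simp [idxAboveFinset]

/-- The structure needed for the construction of the dual canonical basis. -/
structure IsQuantumPBW (q : K) (u : Fin 4 → A) : Prop where
  ne_zero : q ≠ 0
  straightening : Straightening q u
  linearIndependent : LinearIndependent K (ordMonomial u)
  span_eq_top : Submodule.span K (Set.range (ordMonomial u)) = ⊤
  laurentEval_injective : Function.Injective (laurentEval q)

/-- The additive map `σ` multiplied by a power of `q`. -/
def scaledMap (q : K) (σ : A →+ A) (n : ℤ) : A →+ A :=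
  (DistribSMul.toAddMonoidHom A (q ^ n)).comp σ

theorem scaledMap_apply (q : K) (σ : A →+ A) (n : ℤ) (x : A) :
    scaledMap q σ n x = q ^ n • σ x := rfl

variable {σ σ' : A →+ A}

theorem IsAnti.scaledMap_zpow_smul (hσ : IsAnti q u σ) (hq : q ≠ 0) (n k : ℤ) (x : A) :
    scaledMap q σ n (q ^ k • x) = q ^ (-k) • scaledMap q σ n x := by
  rw [scaledMap_apply, scaledMap_apply, hσ.map_zpow_smul hq, smul_comm]

namespace IsQuantumPBW

variable (H : IsQuantumPBW q u)
include H

theorem linearIndependent_pbw : LinearIndependent K (pbw q u) :=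
  H.linearIndependent.units_smul fun a => Units.mk0 _ (pow_ne_zero (bExp a) H.ne_zero)

theorem span_pbw : Submodule.span K (Set.range (pbw q u)) = ⊤ := by
  rw [eq_top_iff, ← H.span_eq_top, Submodule.span_le]
  rintro _ ⟨b, rfl⟩
  rw [← inv_smul_smul₀ (pow_ne_zero (bExp b) H.ne_zero) (ordMonomial u b)]
  exact Submodule.smul_mem _ _ (Submodule.subset_span ⟨b, rfl⟩)

theorem scaledMap_pbw (hσ : IsAnti q u σ) {a b : Idx} (h : idxLE a b) :
    scaledMap q σ (normN a) (pbw q u b) - pbw q u b ∈ qSpanOn q (pbw q u) (idxAbove b) := by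
  rw [← normN_eq_of_idxLE h]
  exact hσ.map_pbw H.ne_zero H.straightening b

theorem scaledMap_triangular (hσ : IsAnti q u σ) (a : Idx) :
    ∀ b ∈ idxAboveFinset a, scaledMap q σ (normN a) (pbw q u b) - pbw q u b ∈
      qSpanOn q (pbw q u) {c | c ∈ idxAboveFinset a ∧ idxKey c < idxKey b} := fun b hb => by
  rw [mem_idxAboveFinset] at hb
  exact qSpan_mono (fun p hp => And.intro
    (mem_idxAboveFinset.2 (idxAbove_of_le_of_above hb.1 hp)) (idxKey_lt hp)) (H.scaledMap_pbw hσ hb.1)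

/-- Two anti-automorphisms with the prescribed values agree on integral Laurent combinations of the
PBW elements. This suffices for uniqueness of the basis even though the definition lets σ vary. -/
theorem anti_eq (hσ : IsAnti q u σ) (hσ' : IsAnti q u σ') {P : Set (ℤ × Idx)} {x : A}
    (hx : x ∈ qSpan q (pbw q u) P) : σ x = σ' x := by
  have : σ x - σ' x ∈ (⊥ : AddSubgroup A) :=
    map_mem_of_mem_qSpan (σ - σ') (fun k b _ => by
      have e : q ^ k • pbw q u b = q ^ (k + bExp b) • ordMonomial u b := by
        rw [pbw, zpow_add₀ H.ne_zero, zpow_natCast, smul_smul]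
      rw [AddSubgroup.mem_bot, AddMonoidHom.sub_apply, e, hσ.map_zpow_smul H.ne_zero,
        hσ'.map_zpow_smul H.ne_zero, hσ.map_ordMonomial, hσ'.map_ordMonomial, sub_self]) hx
  exact sub_eq_zero.1 (AddSubgroup.mem_bot.1 this)

theorem eq_of_isDualCanonicalElement (hσ : IsAnti q u σ) (hσ' : IsAnti q u σ') {a : Idx} {x y : A}
    (hx : IsDualCanonicalElement q u σ a x) (hy : IsDualCanonicalElement q u σ' a y) : x = y := by
  have hy' : y ∈ qSpan q (pbw q u) Set.univ := by
    have := add_mem (qSpan_mono (Set.subset_univ _) hy.1)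
      (mem_qSpan (Set.mem_univ (0, a)) : pbw q u a ∈ qSpan q (pbw q u) Set.univ)
    rwa [sub_add_cancel] at this
  rw [← sub_eq_zero]
  refine eq_zero_of_invariant H.ne_zero H.linearIndependent_pbw H.laurentEval_injective idxKey
    (scaledMap q σ (normN a)) (hσ.scaledMap_zpow_smul H.ne_zero _) (idxAboveFinset a)
    (H.scaledMap_triangular hσ a) _ ?_ ?_
  · have := sub_mem hx.1 hy.1
    rw [sub_sub_sub_cancel_right] at this
    exact qSpan_mono (fun p hp => And.intro hp.1 (mem_idxAboveFinset.2 hp.2)) this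
  · rw [map_sub, scaledMap_apply, scaledMap_apply, hx.2, H.anti_eq hσ hσ' hy', hy.2, smul_smul,
      smul_smul, ← zpow_add₀ H.ne_zero, add_neg_cancel, zpow_zero, one_smul, one_smul]

/-- The defect τ(E[a]) - E[a] is anti-invariant, hence of the form w - τ(w) with positive exponents
in w, and E[a] + w is invariant. -/
theorem exists_isDualCanonicalElement (hσ : IsAnti q u σ) (hσσ : ∀ x, σ (σ x) = x) (a : Idx) :
    ∃ x, IsDualCanonicalElement q u σ a x := by
  set τ := scaledMap q σ (normN a) with hτ
  have hττ : ∀ x, τ (τ x) = x := fun x => by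
    rw [hτ, scaledMap_apply _ _ _ x, hσ.scaledMap_zpow_smul H.ne_zero, scaledMap_apply, smul_smul,
      ← zpow_add₀ H.ne_zero, neg_add_cancel, zpow_zero, one_smul, hσσ]
  obtain ⟨w, hw, h⟩ := exists_sub_eq_of_antiinvariant H.ne_zero H.linearIndependent_pbw
    H.laurentEval_injective idxKey τ (hσ.scaledMap_zpow_smul H.ne_zero _) hττ (idxAboveFinset a)
    (H.scaledMap_triangular hσ a) (τ (pbw q u a) - pbw q u a)
    (qSpan_mono (fun p hp => mem_idxAboveFinset.2 hp) (H.scaledMap_pbw hσ (idxLE_refl a)))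
    (by rw [map_sub, hττ]; abel)
  have hinv : τ (pbw q u a + w) = pbw q u a + w := by
    rw [map_add]; linear_combination (norm := abel) -h
  refine ⟨pbw q u a + w, ?_, ?_⟩
  · rw [add_sub_cancel_left]
    exact qSpan_mono (fun p hp => And.intro hp.1 (mem_idxAboveFinset.1 hp.2)) hw
  · conv_rhs => rw [← hinv]
    rw [hτ, scaledMap_apply, smul_smul, ← zpow_add₀ H.ne_zero, neg_add_cancel, zpow_zero, one_smul]

/-- The dual PBW basis. -/
noncomputable def pbwBasis : Module.Basis Idx K A :=
  Module.Basis.mk H.linearIndependent_pbw H.span_pbw.ge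

theorem pbwBasis_apply (a : Idx) : H.pbwBasis a = pbw q u a := by
  rw [pbwBasis, Module.Basis.mk_apply]

theorem pbwBasis_coord_eq_zero {P : Set (ℤ × Idx)} {x : A} (hx : x ∈ qSpan q (pbw q u) P)
    {b : Idx} (hb : ∀ k, (k, b) ∉ P) : H.pbwBasis.coord b x = 0 := by
  have h := qSpan_le_span hx
  rw [← funext H.pbwBasis_apply, Module.Basis.mem_span_image] at h
  by_contra hc
  obtain ⟨⟨k, _⟩, hp, rfl⟩ := h (Finsupp.mem_support_iff.2 hc)
  exact hb k hp

/-- The coordinates in the PBW basis form a unitriangular matrix with respect to the key. -/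
theorem linearIndependent_of_isDualCanonicalElement {B : Idx → A}
    (hB : ∀ a, IsDualCanonicalElement q u σ a (B a)) : LinearIndependent K B := by
  refine linearIndependent_of_triangular idxKey B (fun a => H.pbwBasis.coord a)
    (fun a => ?_) fun a b hba h => ?_
  · have h := H.pbwBasis_coord_eq_zero (hB a).1 (b := a) fun k hk => hk.2.2 rfl
    rw [map_sub, sub_eq_zero, ← H.pbwBasis_apply, Module.Basis.coord_apply (i := a)
      (x := H.pbwBasis a), Module.Basis.repr_self, Finsupp.single_eq_same] at h
    rw [h]; exact one_ne_zero
  · by_contra hlt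
    refine h ?_
    have h := H.pbwBasis_coord_eq_zero (hB b).1 (b := a) fun k hk => hlt (idxKey_lt hk.2)
    rw [map_sub, sub_eq_zero, ← H.pbwBasis_apply, Module.Basis.coord_apply (i := a)
      (x := H.pbwBasis b), Module.Basis.repr_self, Finsupp.single_eq_of_ne (Ne.symm hba)] at h
    exact h

theorem span_of_isDualCanonicalElement {B : Idx → A}
    (hB : ∀ a, IsDualCanonicalElement q u σ a (B a)) : Submodule.span K (Set.range B) = ⊤ := by
  have key : ∀ n a, idxKey a < n → pbw q u a ∈ Submodule.span K (Set.range B) := fun n => by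
    induction n with
    | zero => intro a h; omega
    | succ n ih =>
      intro a ha
      have h1 := map_mem_of_mem_qSpan (AddMonoidHom.id A)
        (N := (Submodule.span K (Set.range B)).toAddSubgroup)
        (fun k b hb => Submodule.smul_mem _ _
          (ih b (by have h : _ < _ := idxKey_lt hb.2; dsimp only at h; omega))) (hB a).1
      have := sub_mem (Submodule.subset_span ⟨a, rfl⟩ : B a ∈ Submodule.span K (Set.range B)) h1
      rwa [AddMonoidHom.id_apply, sub_sub_cancel] at this
  rw [eq_top_iff, ← H.span_pbw, Submodule.span_le]
  rintro _ ⟨a, rfl⟩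
  exact key _ a (Nat.lt_succ_self _)

end IsQuantumPBW

end DualCanonical

/-! ### The dual canonical basis -/

section Basis

/-- The span contains 1 and, by `hasTop_mul`, is stable under left multiplication by every
generator. -/
theorem span_ordMonomial_u : Submodule.span Kq (Set.range (ordMonomial u)) = ⊤ := by
  set M := Submodule.span Kq (Set.range (ordMonomial u)) with hM
  have hu : ∀ i, ∀ y ∈ M, u i * y ∈ M := fun i y hy => by
    have : M ≤ M.comap (LinearMap.mulLeft Kq (u i)) := by
      rw [hM, Submodule.span_le]
      rintro _ ⟨b, rfl⟩
      have h1 := qSpan_le_span (straightening_u.hasTop_mul q_ne_zero i b).mem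
      exact Submodule.span_mono (Set.image_subset_range _ _) h1
    exact this hy
  have h : ∀ x : UqPlus, ∀ y ∈ M, x * y ∈ M := fun x => by
    induction x using uqPlus_induction with
    | scalar c => intro y hy; rw [← Algebra.smul_def]; exact M.smul_mem c hy
    | gen i => exact hu i
    | add x y hx hy => intro z hz; rw [add_mul]; exact add_mem (hx z hz) (hy z hz)
    | mul x y hx hy => intro z hz; rw [mul_assoc]; exact hx _ (hy z hz)
  refine eq_top_iff.2 fun x _ => ?_
  rw [← mul_one x]
  exact h x 1 (Submodule.subset_span ⟨0, by simp [ordMonomial]⟩)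

theorem isQuantumPBW_u : IsQuantumPBW q u where
  ne_zero := q_ne_zero
  straightening := straightening_u
  linearIndependent := linearIndependent_ordMonomial_u
  span_eq_top := span_ordMonomial_u
  laurentEval_injective := laurentEval_q_injective

/-- The anti-automorphism as an additive map from the algebra to itself. -/
noncomputable def antiMap (σ : UqPlus ≃+* UqPlusᵐᵒᵖ) : UqPlus →+ UqPlus :=
  (MulOpposite.opAddEquiv.symm : UqPlusᵐᵒᵖ ≃+ UqPlus).toAddMonoidHom.comp
    (σ : UqPlus →+* UqPlusᵐᵒᵖ).toAddMonoidHom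

theorem antiMap_apply (σ : UqPlus ≃+* UqPlusᵐᵒᵖ) (x : UqPlus) : antiMap σ x = (σ x).unop := rfl

theorem isAnti_antiMap {σ : UqPlus ≃+* UqPlusᵐᵒᵖ} (hσ : IsSigma σ) : IsAnti q u (antiMap σ) where
  map_one := by rw [antiMap_apply, map_one, MulOpposite.unop_one]
  map_mul x y := by simp only [antiMap_apply, map_mul, MulOpposite.unop_mul]
  map_smul x := by
    rw [Algebra.smul_def, antiMap_apply, map_mul, MulOpposite.unop_mul, hσ.1, ← Algebra.commutes,
      ← Algebra.smul_def]
    rfl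
  map_u := hσ.2

theorem isDualCanonicalBasis_iff (B : Module.Basis Idx Kq UqPlus) : IsDualCanonicalBasis B ↔
    ∃ σ, IsSigma σ ∧ ∀ a, IsDualCanonicalElement q u (antiMap σ) a (B a) := by
  simp only [IsDualCanonicalBasis, IsDualCanonicalElement, mem_qSpan_iff_exists]
  rfl

theorem existsUnique_isDualCanonicalBasis :
    ∃! B : Module.Basis Idx Kq UqPlus, IsDualCanonicalBasis B := by
  have H := isQuantumPBW_u
  have hσ := isAnti_antiMap isSigma_sigmaEquiv
  choose B hB using H.exists_isDualCanonicalElement hσ sigmaHom_sigmaHom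
  refine ⟨Module.Basis.mk (H.linearIndependent_of_isDualCanonicalElement hB)
    (H.span_of_isDualCanonicalElement hB).ge, ?_, fun B' hB' => ?_⟩
  · simp only [isDualCanonicalBasis_iff, Module.Basis.mk_apply]
    exact ⟨_, isSigma_sigmaEquiv, hB⟩
  · obtain ⟨σ, hσ', h⟩ := (isDualCanonicalBasis_iff B').1 hB'
    refine Module.Basis.eq_of_apply_eq fun a => ?_
    rw [Module.Basis.mk_apply]
    exact H.eq_of_isDualCanonicalElement (isAnti_antiMap hσ') hσ (h a) (hB a)

end Basis

/-! ### Quantum minors and the Chebyshev-type recursions -/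

section Minors

variable {K A : Type*} [Field K] [Ring A] [Algebra K A]

/-- The first quantum minor of consecutive root vectors. -/
def minor₀ (q : K) (u : Fin 4 → A) : A := u 2 * u 0 - q ^ 2 • (u 1 * u 1)

/-- The last quantum minor of consecutive root vectors. -/
def minor₁ (q : K) (u : Fin 4 → A) : A := u 3 * u 1 - q ^ 2 • (u 2 * u 2)

/-- The middle quantum minor. -/
def minorZ (q : K) (u : Fin 4 → A) : A := u 3 * u 0 - q ^ 2 • (u 2 * u 1)

/-- The product of the two outer minors. -/
def minorP (q : K) (u : Fin 4 → A) : A := minor₀ q u * minor₁ q u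

variable {q : K} {u : Fin 4 → A}

theorem mul_left_comm_sub {a b x y : A} {c d : K} (h : a * b = c • (b * a) - d • (x * y)) (w : A) :
    a * (b * w) = c • (b * (a * w)) - d • (x * (y * w)) := by
  rw [← mul_assoc, h, sub_mul, smul_mul_assoc, smul_mul_assoc, mul_assoc, mul_assoc]

namespace Straightening

variable (R : Straightening q u) (hq : q ≠ 0)
include R hq

/-- This and the following lemmas show that the outer minors commute up to powers of q with every `u
i`. The middle minor does not, and its products with the `u i` acquire correction terms. -/
theorem minor₀_mul_one : minor₀ q u * u 1 = u 1 * minor₀ q u := by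
  simp only [minor₀, mul_sub, sub_mul, smul_mul_assoc, mul_smul_comm, mul_assoc, R.mul_01 hq, mul_left_comm_of (R.mul_12 hq)]


theorem minor₀_mul_two : minor₀ q u * u 2 = (q ^ 2)⁻¹ • (u 2 * minor₀ q u) := by
  simp only [minor₀, mul_sub, sub_mul, smul_mul_assoc, mul_smul_comm, smul_sub, smul_smul,
    mul_assoc, R.mul_02 hq, R.mul_12 hq, mul_left_comm_of (R.mul_12 hq)]
  match_scalars <;> field_simp; ring

theorem minor₀_mul_three : minor₀ q u * u 3 = (q ^ 4)⁻¹ • (u 3 * minor₀ q u) := by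
  simp only [minor₀, mul_sub, sub_mul, smul_mul_assoc, mul_smul_comm, smul_sub, smul_smul,
    mul_assoc, R.mul_03 hq, R.mul_13 hq, R.mul_12 hq, mul_left_comm_of (R.mul_12 hq),
    mul_left_comm_of (R.mul_23 hq), mul_left_comm_sub (R.mul_13 hq)]
  match_scalars <;> field_simp <;> ring

theorem minor₁_mul_two : minor₁ q u * u 2 = u 2 * minor₁ q u := by
  simp only [minor₁, mul_sub, sub_mul, smul_mul_assoc, mul_smul_comm, mul_assoc, R.mul_12 hq, mul_left_comm_of (R.mul_23 hq)]

theorem minor₁_mul_three : minor₁ q u * u 3 = (q ^ 2)⁻¹ • (u 3 * minor₁ q u) := by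
  simp only [minor₁, mul_sub, sub_mul, smul_mul_assoc, mul_smul_comm, smul_sub, smul_smul,
    mul_assoc, R.mul_13 hq, R.mul_23 hq, mul_left_comm_of (R.mul_23 hq)]
  match_scalars <;> field_simp; ring

theorem minor₀_mul_minor₁ :
    minor₀ q u * minor₁ q u = (q ^ 4)⁻¹ • (minor₁ q u * minor₀ q u) := by
  have h1 := R.minor₀_mul_one hq
  have h2 := R.minor₀_mul_two hq
  have h3 := R.minor₀_mul_three hq
  generalize minor₀ q u = p at *
  simp only [minor₁, mul_sub, sub_mul, smul_mul_assoc, mul_smul_comm, smul_sub, smul_smul,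
    mul_assoc, h1, h2, mul_left_comm_of h2, mul_left_comm_of h3]
  match_scalars <;> field_simp

theorem minorZ_mul_three : minorZ q u * u 3 =
    (q ^ 2)⁻¹ • (u 3 * minorZ q u) - (1 - (q ^ 2)⁻¹) • (minor₁ q u * u 2) := by
  simp only [minorZ, minor₁, mul_sub, sub_mul, smul_mul_assoc, mul_smul_comm, smul_sub, smul_smul,
    mul_assoc, R.mul_03 hq, R.mul_13 hq, R.mul_12 hq, mul_left_comm_of (R.mul_23 hq)]
  match_scalars <;> field_simp <;> ring

theorem minorZ_mul_two : minorZ q u * u 2 =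
    (q ^ 2)⁻¹ • (u 2 * minorZ q u) + ((q ^ 2)⁻¹ - (q ^ 4)⁻¹) • (u 3 * minor₀ q u) := by
  simp only [minorZ, minor₀, mul_sub, sub_mul, smul_mul_assoc, mul_smul_comm, smul_sub, smul_smul,
    mul_assoc, R.mul_02 hq, R.mul_12 hq, mul_left_comm_of (R.mul_23 hq)]
  match_scalars <;> field_simp <;> ring

theorem zero_mul_minorZ : u 0 * minorZ q u =
    (q ^ 2)⁻¹ • (minorZ q u * u 0) - (1 - (q ^ 2)⁻¹) • (minor₀ q u * u 1) := by
  simp only [minorZ, minor₀, mul_sub, sub_mul, smul_mul_assoc, mul_smul_comm, smul_sub, smul_smul,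
    mul_assoc, R.mul_01 hq, mul_left_comm_sub (R.mul_02 hq), mul_left_comm_sub (R.mul_03 hq)]
  match_scalars <;> field_simp <;> ring

theorem one_mul_minorZ : u 1 * minorZ q u =
    (q ^ 2)⁻¹ • (minorZ q u * u 1) + ((q ^ 2)⁻¹ - (q ^ 4)⁻¹) • (minor₁ q u * u 0) := by
  simp only [minorZ, minor₁, mul_sub, sub_mul, smul_mul_assoc, mul_smul_comm, smul_sub, smul_smul,
    mul_assoc, R.mul_01 hq, mul_left_comm_of (R.mul_12 hq), mul_left_comm_sub (R.mul_13 hq)]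
  match_scalars <;> field_simp <;> ring

theorem minor₀_mul_zero : minor₀ q u * u 0 = q ^ 2 • (u 0 * minor₀ q u) := by
  simp only [minor₀, mul_sub, sub_mul, smul_mul_assoc, mul_smul_comm, smul_sub, smul_smul,
    mul_assoc, R.mul_01 hq, mul_left_comm_of (R.mul_01 hq), mul_left_comm_sub (R.mul_02 hq)]
  match_scalars <;> field_simp; ring

theorem minor₁_mul_one : minor₁ q u * u 1 = q ^ 2 • (u 1 * minor₁ q u) := by
  simp only [minor₁, mul_sub, sub_mul, smul_mul_assoc, mul_smul_comm, smul_sub, smul_smul,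
    mul_assoc, R.mul_12 hq, mul_left_comm_of (R.mul_12 hq), mul_left_comm_sub (R.mul_13 hq)]
  match_scalars <;> field_simp; ring

theorem minor₁_mul_zero : minor₁ q u * u 0 = q ^ 4 • (u 0 * minor₁ q u) := by
  simp only [minor₁, mul_sub, sub_mul, smul_mul_assoc, mul_smul_comm, smul_sub, smul_smul,
    mul_assoc, R.mul_01 hq, R.mul_02 hq, mul_left_comm_of (R.mul_12 hq), R.mul_12 hq,
    mul_left_comm_sub (R.mul_02 hq), mul_left_comm_sub (R.mul_03 hq)]
  match_scalars <;> field_simp <;> ring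

theorem minor₀_mul_minorZ : minor₀ q u * minorZ q u = (q ^ 2)⁻¹ • (minorZ q u * minor₀ q u) := by
  have h0 := R.minor₀_mul_zero hq
  have h1 := R.minor₀_mul_one hq
  have h2 := R.minor₀_mul_two hq
  have h3 := R.minor₀_mul_three hq
  generalize minor₀ q u = p at *
  simp only [minorZ, mul_sub, sub_mul, smul_mul_assoc, mul_smul_comm, smul_sub, smul_smul,
    mul_assoc, h0, h1, mul_left_comm_of h2, mul_left_comm_of h3]
  match_scalars <;> field_simp

theorem minor₁_mul_minorZ : minor₁ q u * minorZ q u = q ^ 2 • (minorZ q u * minor₁ q u) := by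
  have h0 := R.minor₁_mul_zero hq
  have h1 := R.minor₁_mul_one hq
  have h2 : ∀ x, minor₁ q u * (u 2 * x) = u 2 * (minor₁ q u * x) := fun x => by
    rw [← mul_assoc, R.minor₁_mul_two hq, mul_assoc]
  have h3 := R.minor₁_mul_three hq
  generalize minor₁ q u = p at *
  simp only [minorZ, mul_sub, sub_mul, smul_mul_assoc, mul_smul_comm, smul_sub, smul_smul,
    mul_assoc, h0, h1, h2, mul_left_comm_of h3]
  match_scalars <;> field_simp

/-- The two outer minors commute with the middle one up to opposite powers of q, which cancel in the
product. -/
theorem minorP_mul_minorZ : minorP q u * minorZ q u = minorZ q u * minorP q u := by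
  rw [minorP, mul_assoc, R.minor₁_mul_minorZ hq, mul_smul_comm, ← mul_assoc,
    R.minor₀_mul_minorZ hq, smul_mul_assoc, smul_inv_smul₀ (pow_ne_zero 2 hq), mul_assoc]

theorem minorP_mul_three : minorP q u * u 3 = (q ^ 6)⁻¹ • (u 3 * minorP q u) := by
  rw [minorP, mul_assoc, R.minor₁_mul_three hq, mul_smul_comm, ← mul_assoc,
    R.minor₀_mul_three hq, smul_mul_assoc, smul_smul, mul_assoc]
  congr 1; field_simp

theorem minorP_mul_two : minorP q u * u 2 = (q ^ 2)⁻¹ • (u 2 * minorP q u) := by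
  rw [minorP, mul_assoc, R.minor₁_mul_two hq, ← mul_assoc, R.minor₀_mul_two hq, smul_mul_assoc,
    mul_assoc]

theorem minorP_mul_minor₁ : minorP q u * minor₁ q u = (q ^ 4)⁻¹ • (minor₁ q u * minorP q u) := by
  rw [minorP, R.minor₀_mul_minor₁ hq, smul_mul_assoc, mul_assoc, R.minor₀_mul_minor₁ hq]

theorem minor₀_mul_minorP : minor₀ q u * minorP q u = (q ^ 4)⁻¹ • (minorP q u * minor₀ q u) := by
  rw [minorP, mul_assoc, ← mul_smul_comm, ← R.minor₀_mul_minor₁ hq]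

end Straightening

/-- The elements `B[n,0,0,n]`, shifted by one. -/
def evenSeq (q : K) (u : Fin 4 → A) : ℕ → A
  | 0 => 0
  | 1 => 1
  | n + 2 => q ^ (4 * n) • (evenSeq q u (n + 1) * minorZ q u) -
      (q ^ (8 * n) * (q ^ 2)⁻¹) • (minorP q u * evenSeq q u n)

/-- The elements `B[n+1,0,0,n]`. -/
def oddSeq (q : K) (u : Fin 4 → A) (n : ℕ) : A :=
  q ^ n • (u 3 * evenSeq q u (n + 1)) -
    (q ^ (5 * n) * (q ^ 2)⁻¹) • (minor₁ q u * (u 2 * evenSeq q u n))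

theorem evenSeq_succ_succ (n : ℕ) : evenSeq q u (n + 2) =
    q ^ (4 * n) • (evenSeq q u (n + 1) * minorZ q u) -
      (q ^ (8 * n) * (q ^ 2)⁻¹) • (minorP q u * evenSeq q u n) := by rw [evenSeq]

theorem oddSeq_zero : oddSeq q u 0 = u 3 := by simp [oddSeq, evenSeq]

theorem evenSeq_mul_minorZ (hq : q ≠ 0) (n : ℕ) : evenSeq q u (n + 1) * minorZ q u =
    (q ^ (4 * n))⁻¹ • evenSeq q u (n + 2) +
      (q ^ (4 * n) * (q ^ 2)⁻¹) • (minorP q u * evenSeq q u n) := by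
  rw [evenSeq_succ_succ]
  match_scalars <;> field_simp; ring

theorem evenSeq_two : evenSeq q u 2 = q ^ 0 • (oddSeq q u 0 * u 0) - q ^ 2 • u 2 * u 1 := by
  simp [evenSeq, oddSeq_zero, minorZ]

theorem oddSeq_zero_mul_minorZ (hq : q ≠ 0) : oddSeq q u 0 * minorZ q u =
    q⁻¹ • oddSeq q u 1 + q ^ 2 • (minor₁ q u * u 2) := by
  simp only [oddSeq, evenSeq]
  simp
  match_scalars <;> field_simp
  ring

namespace Straightening

variable (R : Straightening q u) (hq : q ≠ 0)
include R hq

theorem minorP_mul_evenSeq (n : ℕ) :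
    minorP q u * evenSeq q u n = evenSeq q u n * minorP q u := by
  induction n using Nat.twoStepInduction with
  | zero => simp [evenSeq]
  | one => simp [evenSeq]
  | more n ih1 ih2 =>
    rw [evenSeq_succ_succ, mul_sub, sub_mul, mul_smul_comm, mul_smul_comm, smul_mul_assoc,
      smul_mul_assoc, ← mul_assoc, ih2, mul_assoc, R.minorP_mul_minorZ hq, mul_assoc,
      mul_assoc _ (evenSeq q u n), ih1]

/-- The sequence consists of polynomials in the two commuting elements `minorZ` and `minorP`. This
is the commutation that the conjecture would forbid. -/
theorem minorZ_mul_evenSeq (n : ℕ) :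
    minorZ q u * evenSeq q u n = evenSeq q u n * minorZ q u := by
  induction n using Nat.twoStepInduction with
  | zero => simp [evenSeq]
  | one => simp [evenSeq]
  | more n ih1 ih2 =>
    rw [evenSeq_succ_succ, mul_sub, sub_mul, mul_smul_comm, mul_smul_comm, smul_mul_assoc,
      smul_mul_assoc, ← mul_assoc, ih2, ← mul_assoc (minorZ q u), ← R.minorP_mul_minorZ hq,
      mul_assoc (minorP q u), ih1, mul_assoc (minorP q u)]

theorem evenSeq_mul_minor₀ (n : ℕ) :
    evenSeq q u (n + 1) * minor₀ q u = q ^ (2 * n) • (minor₀ q u * evenSeq q u (n + 1)) := by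
  induction n using Nat.twoStepInduction with
  | zero => simp [evenSeq]
  | one =>
    simp only [evenSeq, R.minor₀_mul_minorZ hq, one_mul, mul_zero, smul_zero, sub_zero, mul_one,
      pow_zero, one_smul, smul_inv_smul₀ (pow_ne_zero 2 hq)]
  | more n ih1 ih2 =>
    have hz : minorZ q u * minor₀ q u = q ^ 2 • (minor₀ q u * minorZ q u) := by
      rw [R.minor₀_mul_minorZ hq, smul_inv_smul₀ (pow_ne_zero 2 hq)]
    have hP : minorP q u * minor₀ q u = q ^ 4 • (minor₀ q u * minorP q u) := by
      rw [R.minor₀_mul_minorP hq, smul_inv_smul₀ (pow_ne_zero 4 hq)]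
    rw [show n + 2 + 1 = n + 1 + 2 by ring, evenSeq_succ_succ, mul_sub, sub_mul, mul_smul_comm,
      mul_smul_comm, smul_mul_assoc, smul_mul_assoc, mul_assoc, hz, mul_smul_comm, ← mul_assoc, ih2,
      mul_assoc (minorP q u), ih1, mul_smul_comm, ← mul_assoc (minorP q u), hP]
    simp only [smul_mul_assoc, smul_smul, mul_assoc]
    match_scalars <;> ring

theorem evenSeq_mul_minor₁ (n : ℕ) :
    evenSeq q u (n + 1) * minor₁ q u = (q ^ (2 * n))⁻¹ • (minor₁ q u * evenSeq q u (n + 1)) := by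
  induction n using Nat.twoStepInduction with
  | zero => simp [evenSeq]
  | one =>
    simp only [evenSeq, R.minor₁_mul_minorZ hq, one_mul, mul_zero, smul_zero, sub_zero, mul_one,
      pow_zero, one_smul, inv_smul_smul₀ (pow_ne_zero 2 hq)]
  | more n ih1 ih2 =>
    have hz : minorZ q u * minor₁ q u = (q ^ 2)⁻¹ • (minor₁ q u * minorZ q u) := by
      rw [R.minor₁_mul_minorZ hq, inv_smul_smul₀ (pow_ne_zero 2 hq)]
    have hP := R.minorP_mul_minor₁ hq
    rw [show n + 2 + 1 = n + 1 + 2 by ring, evenSeq_succ_succ, mul_sub, sub_mul, mul_smul_comm,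
      mul_smul_comm, smul_mul_assoc, smul_mul_assoc, mul_assoc, hz, mul_smul_comm, ← mul_assoc, ih2,
      mul_assoc (minorP q u), ih1, mul_smul_comm, ← mul_assoc (minorP q u), hP]
    simp only [smul_mul_assoc, smul_smul, mul_assoc]
    match_scalars <;> field_simp <;> ring

theorem oddSeq_mul_minor₀ (n : ℕ) :
    oddSeq q u n * minor₀ q u = q ^ (2 * n + 4) • (minor₀ q u * oddSeq q u n) := by
  cases n with
  | zero => rw [oddSeq_zero, R.minor₀_mul_three hq, smul_inv_smul₀ (pow_ne_zero _ hq)]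
  | succ n =>
    have h2 := R.minor₀_mul_two hq
    have h3 := R.minor₀_mul_three hq
    have h4 := R.minor₀_mul_minor₁ hq
    simp only [oddSeq, sub_mul, mul_sub, smul_mul_assoc, mul_smul_comm, mul_assoc,
      R.evenSeq_mul_minor₀ hq, mul_left_comm_of h2, mul_left_comm_of h3, mul_left_comm_of h4,
      smul_smul, smul_sub]
    match_scalars <;> field_simp <;> ring

theorem oddSeq_mul_minor₁ (n : ℕ) :
    oddSeq q u n * minor₁ q u = (q ^ 2 * (q ^ (2 * n))⁻¹) • (minor₁ q u * oddSeq q u n) := by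
  cases n with
  | zero =>
    rw [oddSeq_zero, R.minor₁_mul_three hq, mul_zero, pow_zero, inv_one, mul_one,
      smul_inv_smul₀ (pow_ne_zero _ hq)]
  | succ n =>
    have h2 : ∀ x, minor₁ q u * (u 2 * x) = u 2 * (minor₁ q u * x) := fun x => by
      rw [← mul_assoc, R.minor₁_mul_two hq, mul_assoc]
    have h3 := R.minor₁_mul_three hq
    simp only [oddSeq, sub_mul, mul_sub, smul_mul_assoc, mul_smul_comm, mul_assoc,
      R.evenSeq_mul_minor₁ hq, h2, mul_left_comm_of h3, smul_smul, smul_sub]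
    match_scalars <;> field_simp <;> ring

theorem minorP_mul_oddSeq (n : ℕ) :
    minorP q u * oddSeq q u n = (q ^ 6)⁻¹ • (oddSeq q u n * minorP q u) := by
  rw [minorP, ← mul_assoc, R.oddSeq_mul_minor₀ hq, smul_mul_assoc, mul_assoc, mul_assoc,
    R.oddSeq_mul_minor₁ hq, mul_smul_comm, smul_smul, smul_smul]
  match_scalars; field_simp; ring

/-- The companion sequence inherits the recursion through its two terms, because the minors in front
commute with P up to powers of q. At index 0 the product of `minor₁` and `u 2` replaces the missing
predecessor. -/
theorem oddSeq_mul_minorZ (n : ℕ) : oddSeq q u (n + 1) * minorZ q u =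
    (q ^ (4 * n + 5))⁻¹ • oddSeq q u (n + 2) +
      q ^ (4 * n + 9) • (minorP q u * oddSeq q u n) := by
  have h2 := R.minorP_mul_two hq
  have h3 := R.minorP_mul_three hq
  have h4 := R.minorP_mul_minor₁ hq
  simp only [oddSeq, sub_mul, mul_sub, smul_mul_assoc, mul_smul_comm, mul_assoc,
    evenSeq_mul_minorZ hq, mul_add, mul_left_comm_of h2, mul_left_comm_of h3, mul_left_comm_of h4,
    smul_smul, smul_sub, smul_add]
  match_scalars <;> field_simp <;> ring

theorem minorZ_mul_oddSeq_zero : minorZ q u * oddSeq q u 0 =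
    (q ^ 3)⁻¹ • oddSeq q u 1 + (q ^ 2)⁻¹ • (minor₁ q u * u 2) := by
  rw [oddSeq_zero, R.minorZ_mul_three hq, ← oddSeq_zero (q := q) (u := u),
    oddSeq_zero_mul_minorZ hq]
  match_scalars <;> field_simp <;> ring

theorem minorZ_mul_oddSeq (n : ℕ) : minorZ q u * oddSeq q u (n + 1) =
    (q ^ (4 * n + 7))⁻¹ • oddSeq q u (n + 2) +
      q ^ (4 * n + 5) • (minorP q u * oddSeq q u n) := by
  have hz : minorZ q u * minor₁ q u = (q ^ 2)⁻¹ • (minor₁ q u * minorZ q u) := by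
    rw [R.minor₁_mul_minorZ hq, inv_smul_smul₀ (pow_ne_zero 2 hq)]
  have h2 : ∀ x, minorZ q u * (u 2 * x) = (q ^ 2)⁻¹ • (u 2 * (minorZ q u * x)) +
      ((q ^ 2)⁻¹ - (q ^ 4)⁻¹) • (u 3 * (minor₀ q u * x)) := fun x => by
    rw [← mul_assoc, R.minorZ_mul_two hq, add_mul, smul_mul_assoc, smul_mul_assoc, mul_assoc,
      mul_assoc]
  have h3 : ∀ x, minorZ q u * (u 3 * x) = (q ^ 2)⁻¹ • (u 3 * (minorZ q u * x)) -
      (1 - (q ^ 2)⁻¹) • (minor₁ q u * (u 2 * x)) := fun x => by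
    rw [← mul_assoc, R.minorZ_mul_three hq, sub_mul, smul_mul_assoc, smul_mul_assoc, mul_assoc,
      mul_assoc]
  have h4 : ∀ x, minor₁ q u * (minor₀ q u * x) = q ^ 4 • (minorP q u * x) := fun x => by
    rw [minorP, R.minor₀_mul_minor₁ hq, smul_mul_assoc, smul_inv_smul₀ (pow_ne_zero 4 hq),
      mul_assoc]
  have h5 := R.minor₁_mul_three hq
  have h6 := R.minorP_mul_three hq
  have h7 := R.minorP_mul_two hq
  have h8 := R.minorP_mul_minor₁ hq
  simp only [oddSeq, mul_sub, mul_add, mul_smul_comm, h3, h2, mul_left_comm_of hz,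
    R.minorZ_mul_evenSeq hq, evenSeq_mul_minorZ hq, smul_sub, smul_add, smul_smul,
    mul_left_comm_of h5, h4, mul_left_comm_of h6, mul_left_comm_of h7, mul_left_comm_of h8]
  match_scalars <;> field_simp <;> ring

/-- The inductive step in the proof of `evenSeq_eq_oddSeq`. -/
theorem evenSeq_eq_oddSeq_step {n : ℕ} {X Y : A}
    (h : evenSeq q u (n + 3) = q ^ (n + 1) • (oddSeq q u (n + 1) * u 0) -
      q ^ (7 * n + 8) • (minor₀ q u * (oddSeq q u n * u 1)))
    (h' : evenSeq q u (n + 2) = q ^ n • (oddSeq q u n * u 0) - Y * u 1)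
    (hX : oddSeq q u n * minorZ q u = (q ^ (4 * n + 1))⁻¹ • (oddSeq q u (n + 1) + X))
    (hXY : minor₀ q u * X = q ^ (n + 1) • (minorP q u * Y)) :
    evenSeq q u (n + 4) = q ^ (n + 2) • (oddSeq q u (n + 2) * u 0) -
      q ^ (7 * n + 15) • (minor₀ q u * (oddSeq q u (n + 1) * u 1)) := by
  have e0 := R.zero_mul_minorZ hq
  have e1 := R.one_mul_minorZ hq
  -- The recursion multiplies by Z on the right, so Z has to pass `u 0` and `u 1`. The corrections
  -- that arise contain the outer minors and recombine into the next term.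
  have a1 : oddSeq q u (n + 1) * (u 0 * minorZ q u) =
      (q ^ 2)⁻¹ • ((q ^ (4 * n + 5))⁻¹ • (oddSeq q u (n + 2) * u 0) +
        q ^ (4 * n + 9) • (minorP q u * (oddSeq q u n * u 0))) -
      ((1 - (q ^ 2)⁻¹) * q ^ (2 * n + 6)) • (minor₀ q u * (oddSeq q u (n + 1) * u 1)) := by
    rw [e0, mul_sub, mul_smul_comm, mul_smul_comm, ← mul_assoc, ← mul_assoc,
      R.oddSeq_mul_minorZ hq, R.oddSeq_mul_minor₀ hq, add_mul, smul_mul_assoc, smul_mul_assoc,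
      smul_mul_assoc, mul_assoc, mul_assoc, smul_smul ((1 : K) - _),
      show 2 * (n + 1) + 4 = 2 * n + 6 by ring]
  have a2 : minor₀ q u * (oddSeq q u n * (u 1 * minorZ q u)) =
      ((q ^ 2)⁻¹ * (q ^ (4 * n + 1))⁻¹) • (minor₀ q u * (oddSeq q u (n + 1) * u 1) +
        q ^ (n + 1) • (minorP q u * (Y * u 1))) +
      (((q ^ 2)⁻¹ - (q ^ 4)⁻¹) * (q ^ 2 * (q ^ (2 * n))⁻¹)) •
        (minorP q u * (oddSeq q u n * u 0)) := by
    rw [e1, mul_add, mul_smul_comm, mul_smul_comm, ← mul_assoc (oddSeq q u n), hX,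
      ← mul_assoc (oddSeq q u n), R.oddSeq_mul_minor₁ hq, smul_mul_assoc, smul_mul_assoc, add_mul,
      mul_add, mul_smul_comm, mul_smul_comm, mul_smul_comm, mul_smul_comm, mul_add,
      ← mul_assoc (minor₀ q u) X, hXY, minorP]
    simp only [smul_mul_assoc, mul_assoc, smul_smul, smul_add]
  rw [show n + 4 = (n + 2) + 2 by ring, evenSeq_succ_succ, show n + 2 + 1 = n + 3 by ring, h, h']
  simp only [sub_mul, mul_sub, smul_mul_assoc, mul_assoc, a1, a2, mul_smul_comm]
  match_scalars <;> field_simp <;> ring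

theorem evenSeq_three : evenSeq q u 3 = q • (oddSeq q u 1 * u 0) -
    q ^ 8 • (minor₀ q u * (oddSeq q u 0 * u 1)) := by
  have h1 : evenSeq q u 3 = q ^ 4 • (minorZ q u * minorZ q u) - q ^ 6 • minorP q u := by
    simp [evenSeq]
    match_scalars; field_simp
  have h2 : oddSeq q u 1 = q • (u 3 * minorZ q u) - q ^ 3 • (minor₁ q u * u 2) := by
    simp [oddSeq, evenSeq]
    match_scalars; field_simp
  rw [h1, h2, oddSeq_zero]
  simp only [minorZ, minorP, minor₀, minor₁, mul_sub, sub_mul, smul_mul_assoc, mul_smul_comm,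
    smul_sub, smul_smul, mul_assoc, R.mul_01 hq, R.mul_12 hq, R.mul_02 hq, mul_left_comm_of (R.mul_12 hq),
    mul_left_comm_of (R.mul_23 hq), mul_left_comm_sub (R.mul_02 hq),
    mul_left_comm_sub (R.mul_03 hq), mul_left_comm_sub (R.mul_13 hq)]
  match_scalars <;> field_simp <;> ring

/-- In the defining recursion the first term contains an unwanted basis element B[m,1,1,m] with
coefficient one, which only the subtracted term cancels. In the form here both terms can be expanded
with visibly positive exponents. -/
theorem evenSeq_eq_oddSeq (n : ℕ) : evenSeq q u (n + 3) =
    q ^ (n + 1) • (oddSeq q u (n + 1) * u 0) -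
      q ^ (7 * n + 8) • (minor₀ q u * (oddSeq q u n * u 1)) := by
  induction n using Nat.twoStepInduction with
  | zero => simpa using R.evenSeq_three hq
  | one =>
    -- The first step is exceptional: the term containing P and the preceding odd element does not
    -- exist, which is why the inductive step is stated for general X and Y.
    refine R.evenSeq_eq_oddSeq_step hq (n := 0) (X := q ^ 3 • (minor₁ q u * u 2))
      (by simpa using R.evenSeq_three hq) (evenSeq_two) ?_ ?_
    · rw [oddSeq_zero_mul_minorZ hq]
      simp only [mul_zero, zero_add, pow_one]
      match_scalars <;> field_simp
    · rw [minorP, mul_smul_comm, mul_smul_comm, smul_smul, mul_assoc]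
      congr 1; ring
  | more n ih1 ih2 =>
    refine R.evenSeq_eq_oddSeq_step hq (n := n + 1)
      (X := q ^ (8 * n + 14) • (minorP q u * oddSeq q u n))
      (Y := q ^ (7 * n + 8) • (minor₀ q u * oddSeq q u n)) ih2 ?_ ?_ ?_
    · rw [smul_mul_assoc, mul_assoc]; exact ih1
    · rw [R.oddSeq_mul_minorZ hq]
      match_scalars <;> field_simp <;> ring
    · rw [mul_smul_comm, mul_smul_comm, ← mul_assoc, ← mul_assoc, R.minor₀_mul_minorP hq, smul_mul_assoc,
        mul_assoc]
      match_scalars; field_simp; ring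

end Straightening

end Minors

/-! ### Multiplication of dual PBW elements by generators and minors -/

section Multiplication

variable {K A : Type*} [Field K] [Ring A] [Algebra K A] {q : K} {u : Fin 4 → A}

theorem pow_mul_of_mul_comm {x y : A} {c : K} (h : x * y = c • (y * x)) (n : ℕ) :
    x ^ n * y = c ^ n • (y * x ^ n) := by
  induction n with
  | zero => simp
  | succ n ih =>
    rw [pow_succ, mul_assoc, h, mul_smul_comm, ← mul_assoc, ih, smul_mul_assoc, smul_smul,
      mul_assoc, ← pow_succ']

theorem choose_succ_two (n : ℕ) : (n + 1).choose 2 = n.choose 2 + n := by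
  rw [Nat.choose_succ_succ' n 1, Nat.choose_one_right, add_comm]

theorem u_three_mul_pbw (hq : q ≠ 0) (a₃ a₂ a₁ a₀ : ℕ) : u 3 * pbw q u (a₃, a₂, a₁, a₀) =
    q ^ (-(a₃ : ℤ)) • pbw q u (a₃ + 1, a₂, a₁, a₀) := by
  simp only [pbw, ordMonomial, bExp, choose_succ_two, mul_smul_comm, pow_succ', mul_assoc]
  match_scalars
  simp only [mul_one, zpow_neg, zpow_natCast]
  field_simp
  ring

theorem pbw_mul_zero (hq : q ≠ 0) (a₃ a₂ a₁ a₀ : ℕ) : pbw q u (a₃, a₂, a₁, a₀) * u 0 =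
    q ^ (-(a₀ : ℤ)) • pbw q u (a₃, a₂, a₁, a₀ + 1) := by
  simp only [pbw, ordMonomial, bExp, choose_succ_two, smul_mul_assoc, pow_succ, mul_assoc]
  match_scalars
  simp only [mul_one, zpow_neg, zpow_natCast]
  field_simp
  ring

namespace Straightening

variable (R : Straightening q u) (hq : q ≠ 0)
include R hq

theorem u_two_mul_pbw (a₃ a₂ a₁ a₀ : ℕ) : u 2 * pbw q u (a₃, a₂, a₁, a₀) =
    q ^ (-2 * (a₃ : ℤ) - a₂) • pbw q u (a₃, a₂ + 1, a₁, a₀) := by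
  have h := R.u_two_mul hq (a₃, a₂, a₁, a₀)
  simp only [idxUnit] at h
  simp only [pbw, mul_smul_comm, h, bExp, choose_succ_two, smul_smul, ← zpow_natCast,
    ← zpow_add₀ hq]
  simp
  congr 2
  ring

theorem pbw_mul_one (a₃ a₂ a₁ a₀ : ℕ) : pbw q u (a₃, a₂, a₁, a₀) * u 1 =
    q ^ (-2 * (a₀ : ℤ) - a₁) • pbw q u (a₃, a₂, a₁ + 1, a₀) := by
  have h := pow_mul_of_mul_comm (R.mul_01 hq) a₀
  simp only [pbw, ordMonomial, bExp, choose_succ_two, smul_mul_assoc, mul_assoc, h,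
    mul_smul_comm, pow_succ, smul_smul]
  match_scalars
  rw [zpow_sub₀ hq, zpow_mul, zpow_natCast, zpow_natCast]
  simp only [inv_pow, zpow_neg, mul_one]
  norm_cast
  field_simp
  ring

theorem minor₀_mul_pbw (a₃ a₂ a₁ a₀ : ℕ) : minor₀ q u * pbw q u (a₃, a₂, a₁, a₀) =
    q ^ (-4 * (a₃ : ℤ) - 3 * a₂ - 2 * a₁ - a₀) • pbw q u (a₃, a₂ + 1, a₁, a₀ + 1) -
      q ^ (-4 * (a₃ : ℤ) - 2 * a₂ - 2 * a₁ + 1) • pbw q u (a₃, a₂, a₁ + 2, a₀) := by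
  have h3 := pow_mul_comm_of (R.minor₀_mul_three hq) a₃
  have h2 := pow_mul_comm_of (R.minor₀_mul_two hq) a₂
  have h0 := pow_mul_comm_of (R.mul_01 hq) a₁
  simp only [pbw, ordMonomial, bExp, choose_succ_two, mul_smul_comm, mul_assoc,
    mul_left_comm_of h3, mul_left_comm_of h2, smul_smul]
  simp only [minor₀, sub_mul, mul_sub, smul_mul_assoc, mul_smul_comm, mul_assoc,
    mul_left_comm_of h0, smul_sub, smul_smul, pow_succ (u 2) a₂, pow_succ' (u 1), pow_succ' (u 0)]
  match_scalars
  · simp only [zpow_sub₀ hq, zpow_mul, zpow_natCast, inv_pow, ← pow_mul, zpow_neg, mul_one]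
    norm_cast
    field_simp
    ring
  · simp only [zpow_sub₀ hq, zpow_add₀ hq, zpow_mul, zpow_natCast, inv_pow, ← pow_mul, zpow_neg,
      mul_one]
    norm_cast
    field_simp
    ring

theorem minor₁_mul_pbw (a₃ a₂ a₁ a₀ : ℕ) : minor₁ q u * pbw q u (a₃, a₂, a₁, a₀) =
    q ^ (-3 * (a₃ : ℤ) - 2 * a₂ - a₁) • pbw q u (a₃ + 1, a₂, a₁ + 1, a₀) -
      q ^ (-2 * (a₃ : ℤ) - 2 * a₂ + 1) • pbw q u (a₃, a₂ + 2, a₁, a₀) := by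
  have h3 := pow_mul_comm_of (R.minor₁_mul_three hq) a₃
  have h0 := pow_mul_comm_of (R.mul_12 hq) a₂
  simp only [pbw, ordMonomial, bExp, choose_succ_two, mul_smul_comm, mul_assoc,
    mul_left_comm_of h3, smul_smul]
  simp only [minor₁, sub_mul, mul_sub, smul_mul_assoc, mul_smul_comm, mul_assoc,
    mul_left_comm_of h0, smul_sub, smul_smul, pow_succ (u 3) a₃, pow_succ' (u 2), pow_succ' (u 1)]
  match_scalars
  · simp only [zpow_sub₀ hq, zpow_mul, zpow_natCast, inv_pow, ← pow_mul, zpow_neg, mul_one]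
    norm_cast
    field_simp
    ring
  · simp only [zpow_sub₀ hq, zpow_add₀ hq, zpow_mul, zpow_natCast, inv_pow, ← pow_mul, zpow_neg,
      mul_one]
    norm_cast
    field_simp
    ring

theorem minorP_mul_pbw (a₃ a₂ a₁ a₀ : ℕ) : minorP q u * pbw q u (a₃, a₂, a₁, a₀) =
    q ^ (-7 * (a₃ : ℤ) - 5 * a₂ - 3 * a₁ - a₀ - 6) •
      pbw q u (a₃ + 1, a₂ + 1, a₁ + 1, a₀ + 1) -
    q ^ (-7 * (a₃ : ℤ) - 4 * a₂ - 3 * a₁ - 5) • pbw q u (a₃ + 1, a₂, a₁ + 3, a₀) -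
    q ^ (-6 * (a₃ : ℤ) - 5 * a₂ - 2 * a₁ - a₀ - 5) • pbw q u (a₃, a₂ + 3, a₁, a₀ + 1) +
    q ^ (-6 * (a₃ : ℤ) - 4 * a₂ - 2 * a₁ - 2) • pbw q u (a₃, a₂ + 2, a₁ + 2, a₀) := by
  rw [minorP, mul_assoc, R.minor₁_mul_pbw hq, mul_sub, mul_smul_comm, mul_smul_comm,
    R.minor₀_mul_pbw hq, R.minor₀_mul_pbw hq, smul_sub, smul_sub, smul_smul, smul_smul, smul_smul,
    smul_smul, ← zpow_add₀ hq, ← zpow_add₀ hq, ← zpow_add₀ hq, ← zpow_add₀ hq, ← sub_add,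
    add_assoc a₂ 2 1, add_assoc a₁ 1 2]
  push_cast
  congr 1
  · congr 1
    · congr 1
      · congr 2; ring
      · congr 2; ring
    · congr 2; ring
  · congr 2; ring

end Straightening

end Multiplication

/-! ### Positivity of the exponents in the PBW expansions -/

section Triangular

/-- The exponents and indices which may occur in `evenSeq q u (n + 1)`. -/
def evenSupport (n : ℕ) : Set (ℤ × Idx) :=
  {p | p.2.1 ≤ n ∧ p.2.2.2.2 ≤ n ∧ p.2.2.1 + 2 * p.2.1 = n + p.2.2.2.2 ∧
    p.2.2.2.1 + 2 * p.2.2.2.2 = n + p.2.1 ∧ 2 * (n : ℤ) ≤ p.1 + p.2.1 + p.2.2.2.2}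

/-- The exponents and indices which may occur in `oddSeq q u n`. -/
def oddSupport (n : ℕ) : Set (ℤ × Idx) :=
  {p | p.2.1 ≤ n + 1 ∧ p.2.2.2.2 ≤ n ∧ p.2.2.1 + 2 * p.2.1 = n + 2 + p.2.2.2.2 ∧
    p.2.2.2.1 + 2 * p.2.2.2.2 + 1 = n + p.2.1 ∧ 2 * (n : ℤ) ≤ p.1 + p.2.1 + p.2.2.2.2 ∧ 0 ≤ p.1}

/-- The part of `evenSupport n` without the leading index. -/
def evenTail (n : ℕ) : Set (ℤ × Idx) := {p ∈ evenSupport n | p.2.1 < n}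

/-- The part of `oddSupport n` without the leading index. -/
def oddTail (n : ℕ) : Set (ℤ × Idx) := {p ∈ oddSupport n | p.2.1 < n + 1}

theorem mem_idxAbove {a b : Idx} (h₃ : b.1 ≤ a.1) (h₀ : b.2.2.2 ≤ a.2.2.2)
    (h : b.1 < a.1 ∨ b.2.2.2 < a.2.2.2)
    (h₂ : b.2.1 + a.2.2.2 + 2 * b.1 = a.2.1 + b.2.2.2 + 2 * a.1)
    (h₁ : b.2.2.1 + a.1 + 2 * b.2.2.2 = a.2.2.1 + b.1 + 2 * a.2.2.2) : b ∈ idxAbove a := by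
  refine ⟨idxLE_iff.2 ⟨a.1 - b.1, a.2.2.2 - b.2.2.2, ?_, ?_, ?_, ?_⟩, fun e => ?_⟩
  · omega
  · omega
  · omega
  · omega
  · subst e; omega

variable {K A : Type*} [Field K] [Ring A] [Algebra K A] {q : K} {u : Fin 4 → A}

theorem mem_qSpan_evenSupport {n : ℕ} {x : A}
    (hx : x - pbw q u (n, 0, 0, n) ∈ qSpan q (pbw q u) (evenTail n)) :
    x ∈ qSpan q (pbw q u) (evenSupport n) := by
  have h1 := qSpan_mono (fun p hp => hp.1) hx
  have h2 : pbw q u (n, 0, 0, n) ∈ qSpan q (pbw q u) (evenSupport n) :=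
    mem_qSpan (by refine ⟨?_, ?_, ?_, ?_, ?_⟩ <;> dsimp only <;> omega)
  have := add_mem h1 h2
  rwa [sub_add_cancel] at this

theorem mem_qSpan_oddSupport {n : ℕ} {x : A}
    (hx : x - pbw q u (n + 1, 0, 0, n) ∈ qSpan q (pbw q u) (oddTail n)) :
    x ∈ qSpan q (pbw q u) (oddSupport n) := by
  have h1 := qSpan_mono (fun p hp => hp.1) hx
  have h2 : pbw q u (n + 1, 0, 0, n) ∈ qSpan q (pbw q u) (oddSupport n) :=
    mem_qSpan (by refine ⟨?_, ?_, ?_, ?_, ?_, ?_⟩ <;> dsimp only <;> omega)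
  have := add_mem h1 h2
  rwa [sub_add_cancel] at this

namespace Straightening

variable (R : Straightening q u) (hq : q ≠ 0)

-- Multiplication by `u 3` on the left raises one entry and rescales by a power of q. If s and r
-- count the generating steps from the leading index, then membership in `evenSupport` bounds the
-- exponent of q below by s + r, and membership in `oddSupport` by s + r - 1 and by 0; the powers
-- are compatible with these bounds.
include hq in
theorem smul_u_three_mul_sub_mem {n : ℕ} {x : A}
    (hx : x - pbw q u (n, 0, 0, n) ∈ qSpan q (pbw q u) (evenTail n)) :
    q ^ n • (u 3 * x) - pbw q u (n + 1, 0, 0, n) ∈ qSpan q (pbw q u) (oddTail n) := by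
  have e : q ^ n • (u 3 * x) - pbw q u (n + 1, 0, 0, n) =
      q ^ n • (u 3 * (x - pbw q u (n, 0, 0, n))) := by
    rw [mul_sub, u_three_mul_pbw hq, smul_sub, zpow_neg, zpow_natCast,
      smul_inv_smul₀ (pow_ne_zero _ hq)]
  rw [e]
  refine map_mem_of_mem_qSpan ((DistribSMul.toAddMonoidHom A (q ^ n)).comp
    (AddMonoidHom.mulLeft (u 3))) (fun k b hb => ?_) hx
  obtain ⟨b₃, b₂, b₁, b₀⟩ := b
  change q ^ n • (u 3 * _) ∈ _
  rw [mul_smul_comm, u_three_mul_pbw hq, ← zpow_natCast, smul_smul, smul_smul, ← zpow_add₀ hq,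
    ← zpow_add₀ hq]
  refine zpow_smul_mem_qSpan ?_
  obtain ⟨⟨h1, h2, h3, h4, h5⟩, h6⟩ := hb
  dsimp only at h1 h2 h3 h4 h5 h6
  refine ⟨⟨?_, ?_, ?_, ?_, ?_, ?_⟩, ?_⟩ <;> dsimp only <;> omega

include hq in
theorem smul_mul_u_zero_sub_mem {n : ℕ} {x : A}
    (hx : x - pbw q u (n + 1, 0, 0, n) ∈ qSpan q (pbw q u) (oddTail n)) :
    q ^ n • (x * u 0) - pbw q u (n + 1, 0, 0, n + 1) ∈ qSpan q (pbw q u) (evenTail (n + 1)) := by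
  have e : q ^ n • (x * u 0) - pbw q u (n + 1, 0, 0, n + 1) =
      q ^ n • ((x - pbw q u (n + 1, 0, 0, n)) * u 0) := by
    rw [sub_mul, pbw_mul_zero hq, smul_sub, zpow_neg, zpow_natCast,
      smul_inv_smul₀ (pow_ne_zero _ hq)]
  rw [e]
  refine map_mem_of_mem_qSpan ((DistribSMul.toAddMonoidHom A (q ^ n)).comp
    (AddMonoidHom.mulRight (u 0))) (fun k b hb => ?_) hx
  obtain ⟨b₃, b₂, b₁, b₀⟩ := b
  change q ^ n • (_ * u 0) ∈ _
  rw [smul_mul_assoc, pbw_mul_zero hq, ← zpow_natCast, smul_smul, smul_smul, ← zpow_add₀ hq,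
    ← zpow_add₀ hq]
  refine zpow_smul_mem_qSpan ?_
  obtain ⟨⟨h1, h2, h3, h4, h5, h7⟩, h6⟩ := hb
  dsimp only at h1 h2 h3 h4 h5 h6 h7
  refine ⟨⟨?_, ?_, ?_, ?_, ?_⟩, ?_⟩ <;> dsimp only <;> omega

include R hq

theorem smul_minor₁_mul_mem {n : ℕ} {x : A} (hx : x ∈ qSpan q (pbw q u) (evenSupport n)) :
    q ^ (5 * (n : ℤ) + 3) • (minor₁ q u * (u 2 * x)) ∈ qSpan q (pbw q u) (oddTail (n + 1)) := by
  refine map_mem_of_mem_qSpan ((DistribSMul.toAddMonoidHom A (q ^ (5 * (n : ℤ) + 3))).comp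
    ((AddMonoidHom.mulLeft (minor₁ q u)).comp (AddMonoidHom.mulLeft (u 2))))
    (fun k b hb => ?_) hx
  obtain ⟨b₃, b₂, b₁, b₀⟩ := b
  change q ^ (5 * (n : ℤ) + 3) • (minor₁ q u * (u 2 * _)) ∈ _
  rw [mul_smul_comm, R.u_two_mul_pbw hq, mul_smul_comm, mul_smul_comm, R.minor₁_mul_pbw hq]
  simp only [smul_sub, smul_smul, ← zpow_add₀ hq]
  obtain ⟨h1, h2, h3, h4, h5⟩ := hb
  dsimp only at h1 h2 h3 h4 h5
  refine sub_mem (zpow_smul_mem_qSpan ?_) (zpow_smul_mem_qSpan ?_)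
  · refine ⟨⟨?_, ?_, ?_, ?_, ?_, ?_⟩, ?_⟩ <;> dsimp only <;> omega
  · refine ⟨⟨?_, ?_, ?_, ?_, ?_, ?_⟩, ?_⟩ <;> dsimp only <;> omega

theorem smul_minor₀_mul_mem {n : ℕ} {x : A} (hx : x ∈ qSpan q (pbw q u) (oddSupport n)) :
    q ^ (7 * (n : ℤ) + 8) • (minor₀ q u * (x * u 1)) ∈
      qSpan q (pbw q u) (evenTail (n + 2)) := by
  refine map_mem_of_mem_qSpan ((DistribSMul.toAddMonoidHom A (q ^ (7 * (n : ℤ) + 8))).comp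
    ((AddMonoidHom.mulLeft (minor₀ q u)).comp (AddMonoidHom.mulRight (u 1))))
    (fun k b hb => ?_) hx
  obtain ⟨b₃, b₂, b₁, b₀⟩ := b
  change q ^ (7 * (n : ℤ) + 8) • (minor₀ q u * (_ * u 1)) ∈ _
  rw [smul_mul_assoc, R.pbw_mul_one hq, mul_smul_comm, mul_smul_comm, R.minor₀_mul_pbw hq]
  simp only [smul_sub, smul_smul, ← zpow_add₀ hq]
  obtain ⟨h1, h2, h3, h4, h5, h6⟩ := hb
  dsimp only at h1 h2 h3 h4 h5 h6
  refine sub_mem (zpow_smul_mem_qSpan ?_) (zpow_smul_mem_qSpan ?_)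
  · refine ⟨⟨?_, ?_, ?_, ?_, ?_⟩, ?_⟩ <;> dsimp only <;> omega
  · refine ⟨⟨?_, ?_, ?_, ?_, ?_⟩, ?_⟩ <;> dsimp only <;> omega

/-- Both sequences are treated together, since each even element is built from earlier odd elements
and each odd one from even elements; the correction terms never reach the leading index. -/
theorem evenSeq_sub_mem_and_oddSeq_sub_mem (n : ℕ) :
    evenSeq q u (n + 1) - pbw q u (n, 0, 0, n) ∈ qSpan q (pbw q u) (evenTail n) ∧
      oddSeq q u n - pbw q u (n + 1, 0, 0, n) ∈ qSpan q (pbw q u) (oddTail n) := by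
  have hodd : ∀ n, evenSeq q u (n + 1) - pbw q u (n, 0, 0, n) ∈ qSpan q (pbw q u) (evenTail n) →
      evenSeq q u (n + 2) - pbw q u (n + 1, 0, 0, n + 1) ∈
        qSpan q (pbw q u) (evenTail (n + 1)) →
      oddSeq q u (n + 1) - pbw q u (n + 2, 0, 0, n + 1) ∈
        qSpan q (pbw q u) (oddTail (n + 1)) := fun n h h' => by
    have h1 := smul_u_three_mul_sub_mem hq h'
    have h2 := R.smul_minor₁_mul_mem hq (mem_qSpan_evenSupport h)
    rw [oddSeq, sub_right_comm]
    refine sub_mem h1 ?_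
    convert h2 using 2
    rw [zpow_add₀ hq, pow_mul, zpow_mul, zpow_natCast]
    norm_cast
    rw [← div_eq_mul_inv, div_eq_iff (pow_ne_zero 2 hq)]
    ring
  have h0 : evenSeq q u 1 - pbw q u (0, 0, 0, 0) ∈ qSpan q (pbw q u) (evenTail 0) := by
    simp [evenSeq, pbw, ordMonomial, bExp]
  have h0' : oddSeq q u 0 - pbw q u (1, 0, 0, 0) ∈ qSpan q (pbw q u) (oddTail 0) := by
    simp [oddSeq_zero, pbw, ordMonomial, bExp]
  induction n using Nat.twoStepInduction with
  | zero => exact ⟨h0, h0'⟩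
  | one =>
    have h : evenSeq q u 2 - pbw q u (1, 0, 0, 1) ∈ qSpan q (pbw q u) (evenTail 1) := by
      have h1 := smul_mul_u_zero_sub_mem hq h0'
      have h2 : q ^ (2 : ℤ) • pbw q u (0, 1, 1, 0) ∈ qSpan q (pbw q u) (evenTail 1) :=
        zpow_smul_mem_qSpan (by refine ⟨⟨?_, ?_, ?_, ?_, ?_⟩, ?_⟩ <;> simp)
      rw [evenSeq_two, sub_right_comm]
      refine sub_mem h1 ?_
      convert h2 using 1
      simp [pbw, ordMonomial, bExp]
    exact ⟨h, hodd 0 h0 h⟩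
  | more n ih1 ih2 =>
    have h : evenSeq q u (n + 3) - pbw q u (n + 2, 0, 0, n + 2) ∈
        qSpan q (pbw q u) (evenTail (n + 2)) := by
      have h1 := smul_mul_u_zero_sub_mem hq ih2.2
      have h2 := R.smul_minor₀_mul_mem hq (mem_qSpan_oddSupport ih1.2)
      rw [R.evenSeq_eq_oddSeq hq, sub_right_comm]
      refine sub_mem h1 ?_
      convert h2 using 2
      norm_cast
    exact ⟨h, hodd (n + 1) ih2.1 h⟩

/-- P times a PBW element has four terms. The first adds one to every entry, and the power 8n + 6
normalizes it at the leading index; all remaining terms lie strictly above with positive exponents.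
-/
theorem smul_minorP_mul_evenSeq_sub_mem (n : ℕ) :
    q ^ (8 * n + 6) • (minorP q u * evenSeq q u (n + 1)) - pbw q u (n + 1, 1, 1, n + 1) ∈
      qSpan q (pbw q u) {p | 0 < p.1 ∧ p.2 ∈ idxAbove (n + 1, 1, 1, n + 1)} := by
  have h := map_mem_of_mem_qSpan ((DistribSMul.toAddMonoidHom A (q ^ (8 * (n : ℤ) + 6))).comp
    (AddMonoidHom.mulLeft (minorP q u)))
    (N := qSpan q (pbw q u) {p | 0 < p.1 ∧ p.2 ∈ idxAbove (n + 1, 1, 1, n + 1)})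
    (fun k b hb => ?_) (R.evenSeq_sub_mem_and_oddSeq_sub_mem hq n).1
  · have h' : q ^ (8 * (n : ℤ) + 6) • (minorP q u * pbw q u (n, 0, 0, n)) -
        pbw q u (n + 1, 1, 1, n + 1) ∈
        qSpan q (pbw q u) {p | 0 < p.1 ∧ p.2 ∈ idxAbove (n + 1, 1, 1, n + 1)} := by
      rw [R.minorP_mul_pbw hq]
      simp only [smul_sub, smul_add, smul_smul, ← zpow_add₀ hq, zero_add]
      rw [show 8 * (n : ℤ) + 6 + (-7 * (n : ℤ) - 5 * (0 : ℕ) - 3 * (0 : ℕ) - n - 6) = 0 by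
        push_cast; ring, zpow_zero, one_smul,
        show ∀ a b c d : A, a - b - c + d - a = -b - c + d from fun a b c d => by abel]
      refine add_mem (sub_mem (neg_mem (zpow_smul_mem_qSpan ?_)) (zpow_smul_mem_qSpan ?_))
        (zpow_smul_mem_qSpan ?_)
      all_goals
        refine And.intro ?_ (mem_idxAbove ?_ ?_ ?_ ?_ ?_) <;> dsimp only <;> omega
    have := add_mem h h'
    change q ^ (8 * (n : ℤ) + 6) • (minorP q u * (_ - _)) + _ ∈ _ at this
    rw [mul_sub, smul_sub, sub_add_sub_cancel] at this
    exact_mod_cast this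
  · obtain ⟨b₃, b₂, b₁, b₀⟩ := b
    change q ^ (8 * (n : ℤ) + 6) • (minorP q u * _) ∈ _
    rw [mul_smul_comm, R.minorP_mul_pbw hq]
    simp only [smul_sub, smul_add, smul_smul, ← zpow_add₀ hq]
    obtain ⟨⟨h1, h2, h3, h4, h5⟩, h6⟩ := hb
    dsimp only at h1 h2 h3 h4 h5 h6
    refine add_mem (sub_mem (sub_mem (zpow_smul_mem_qSpan ?_) (zpow_smul_mem_qSpan ?_))
      (zpow_smul_mem_qSpan ?_)) (zpow_smul_mem_qSpan ?_)
    all_goals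
      refine And.intro ?_ (mem_idxAbove ?_ ?_ ?_ ?_ ?_) <;> dsimp only <;> omega

theorem smul_minorP_mul_oddSeq_sub_mem (n : ℕ) :
    q ^ (8 * n + 13) • (minorP q u * oddSeq q u n) - pbw q u (n + 2, 1, 1, n + 1) ∈
      qSpan q (pbw q u) {p | 0 < p.1 ∧ p.2 ∈ idxAbove (n + 2, 1, 1, n + 1)} := by
  have h := map_mem_of_mem_qSpan ((DistribSMul.toAddMonoidHom A (q ^ (8 * (n : ℤ) + 13))).comp
    (AddMonoidHom.mulLeft (minorP q u)))
    (N := qSpan q (pbw q u) {p | 0 < p.1 ∧ p.2 ∈ idxAbove (n + 2, 1, 1, n + 1)})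
    (fun k b hb => ?_) (R.evenSeq_sub_mem_and_oddSeq_sub_mem hq n).2
  · have h' : q ^ (8 * (n : ℤ) + 13) • (minorP q u * pbw q u (n + 1, 0, 0, n)) -
        pbw q u (n + 2, 1, 1, n + 1) ∈
        qSpan q (pbw q u) {p | 0 < p.1 ∧ p.2 ∈ idxAbove (n + 2, 1, 1, n + 1)} := by
      rw [R.minorP_mul_pbw hq]
      simp only [smul_sub, smul_add, smul_smul, ← zpow_add₀ hq, zero_add]
      rw [show 8 * (n : ℤ) + 13 +
        (-7 * ((n + 1 : ℕ) : ℤ) - 5 * (0 : ℕ) - 3 * (0 : ℕ) - n - 6) = 0 by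
        push_cast; ring, zpow_zero, one_smul,
        add_assoc n 1 1, one_add_one_eq_two,
        show ∀ a b c d : A, a - b - c + d - a = -b - c + d from fun a b c d => by abel]
      refine add_mem (sub_mem (neg_mem (zpow_smul_mem_qSpan ?_)) (zpow_smul_mem_qSpan ?_))
        (zpow_smul_mem_qSpan ?_)
      all_goals
        refine And.intro ?_ (mem_idxAbove ?_ ?_ ?_ ?_ ?_) <;> dsimp only <;> omega
    have := add_mem h h'
    change q ^ (8 * (n : ℤ) + 13) • (minorP q u * (_ - _)) + _ ∈ _ at this
    rw [mul_sub, smul_sub, sub_add_sub_cancel] at this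
    exact_mod_cast this
  · obtain ⟨b₃, b₂, b₁, b₀⟩ := b
    change q ^ (8 * (n : ℤ) + 13) • (minorP q u * _) ∈ _
    rw [mul_smul_comm, R.minorP_mul_pbw hq]
    simp only [smul_sub, smul_add, smul_smul, ← zpow_add₀ hq]
    obtain ⟨⟨h1, h2, h3, h4, h5, h7⟩, h6⟩ := hb
    dsimp only at h1 h2 h3 h4 h5 h6 h7
    refine add_mem (sub_mem (sub_mem (zpow_smul_mem_qSpan ?_) (zpow_smul_mem_qSpan ?_))
      (zpow_smul_mem_qSpan ?_)) (zpow_smul_mem_qSpan ?_)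
    all_goals
      refine And.intro ?_ (mem_idxAbove ?_ ?_ ?_ ?_ ?_) <;> dsimp only <;> omega

theorem smul_minor₁_mul_two_sub_mem :
    q ^ 2 • (minor₁ q u * u 2) - pbw q u (1, 1, 1, 0) ∈
      qSpan q (pbw q u) {p | 0 < p.1 ∧ p.2 ∈ idxAbove (1, 1, 1, 0)} := by
  have h := R.minor₁_mul_pbw hq 0 1 0 0
  have e : pbw q u (0, 1, 0, 0) = u 2 := by simp [pbw, ordMonomial, bExp]
  rw [e] at h
  have e' : q ^ 2 • (minor₁ q u * u 2) - pbw q u (1, 1, 1, 0) =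
      -(q ^ (1 : ℤ) • pbw q u (0, 3, 0, 0)) := by
    rw [h, ← zpow_natCast, smul_sub, smul_smul, smul_smul, ← zpow_add₀ hq, ← zpow_add₀ hq]
    simp
  rw [e']
  refine neg_mem (zpow_smul_mem_qSpan (And.intro ?_ (mem_idxAbove ?_ ?_ ?_ ?_ ?_))) <;>
    dsimp only <;> omega

end Straightening

end Triangular

/-! ### Invariance under σ and identification of the basis elements -/

section SigmaInvariance

variable {K A : Type*} [Field K] [Ring A] [Algebra K A] {q : K} {u : Fin 4 → A}
  {σ : A →+ A}

namespace IsAnti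

variable (hσ : IsAnti q u σ) (R : Straightening q u) (hq : q ≠ 0)
include hσ R hq

theorem map_minor₀ : σ (minor₀ q u) = q ^ 2 • minor₀ q u := by
  have h0 : σ (u 0) = u 0 := by simpa using hσ.map_u 0
  have h1 : σ (u 1) = q ^ 2 • u 1 := by simpa using hσ.map_u 1
  have h2 : σ (u 2) = q ^ 4 • u 2 := by simpa using hσ.map_u 2
  simp only [minor₀, map_sub, hσ.map_mul, hσ.map_pow_smul hq, h0, h1, h2, mul_smul_comm,
    smul_mul_assoc, R.mul_02 hq]
  match_scalars <;> field_simp; ring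

theorem map_minor₁ : σ (minor₁ q u) = q ^ 6 • minor₁ q u := by
  have h1 : σ (u 1) = q ^ 2 • u 1 := by simpa using hσ.map_u 1
  have h2 : σ (u 2) = q ^ 4 • u 2 := by simpa using hσ.map_u 2
  have h3 : σ (u 3) = q ^ 6 • u 3 := by simpa using hσ.map_u 3
  simp only [minor₁, map_sub, hσ.map_mul, hσ.map_pow_smul hq, h1, h2, h3, mul_smul_comm,
    smul_mul_assoc, R.mul_13 hq]
  match_scalars <;> field_simp; ring

theorem map_minorZ : σ (minorZ q u) = q ^ 4 • minorZ q u := by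
  have h0 : σ (u 0) = u 0 := by simpa using hσ.map_u 0
  have h1 : σ (u 1) = q ^ 2 • u 1 := by simpa using hσ.map_u 1
  have h2 : σ (u 2) = q ^ 4 • u 2 := by simpa using hσ.map_u 2
  have h3 : σ (u 3) = q ^ 6 • u 3 := by simpa using hσ.map_u 3
  simp only [minorZ, map_sub, hσ.map_mul, hσ.map_pow_smul hq, h0, h1, h2, h3, mul_smul_comm,
    smul_mul_assoc, R.mul_03 hq, R.mul_12 hq]
  match_scalars <;> field_simp; ring

theorem map_minorP : σ (minorP q u) = q ^ 12 • minorP q u := by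
  rw [minorP, hσ.map_mul, hσ.map_minor₀ R hq, hσ.map_minor₁ R hq, R.minor₀_mul_minor₁ hq,
    smul_mul_assoc, mul_smul_comm]
  match_scalars; field_simp

/-- Reversal of products is harmless because Xₙ commutes with Z and P; only the powers of q in the
recursion have to be compared. -/
theorem map_evenSeq (n : ℕ) :
    σ (evenSeq q u n) = q ^ (16 * n - 4 * n ^ 2 - 12 : ℤ) • evenSeq q u n := by
  induction n using Nat.twoStepInduction with
  | zero => simp [evenSeq]
  | one => simp [evenSeq, hσ.map_one]
  | more n ih1 ih2 =>
    have e1 : q ^ (16 * (n + 1 : ℕ) - 4 * (n + 1 : ℕ) ^ 2 - 12 : ℤ) =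
        q ^ (16 * n - 4 * n ^ 2 - 12 : ℤ) * (q ^ 12 * (q ^ (8 * n))⁻¹) := by
      rw [← zpow_natCast q (8 * n), ← zpow_natCast, ← zpow_neg, ← zpow_add₀ hq, ← zpow_add₀ hq]
      congr 1; push_cast; ring
    have e2 : q ^ (16 * (n + 2 : ℕ) - 4 * (n + 2 : ℕ) ^ 2 - 12 : ℤ) =
        q ^ (16 * n - 4 * n ^ 2 - 12 : ℤ) * (q ^ 16 * (q ^ (16 * n))⁻¹) := by
      rw [← zpow_natCast q (16 * n), ← zpow_natCast, ← zpow_neg, ← zpow_add₀ hq, ← zpow_add₀ hq]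
      congr 1; push_cast; ring
    have e3 : σ ((q ^ (8 * n) * (q ^ 2)⁻¹) • (minorP q u * evenSeq q u n)) =
        (q ^ 2 * (q ^ (8 * n))⁻¹) • σ (minorP q u * evenSeq q u n) := by
      have : q ^ (8 * n) * (q ^ 2)⁻¹ = q ^ ((8 * n : ℕ) - 2 : ℤ) := by
        rw [zpow_sub₀ hq, zpow_natCast, div_eq_mul_inv]; norm_cast
      rw [this, hσ.map_zpow_smul hq, neg_sub, zpow_sub₀ hq, zpow_natCast, div_eq_mul_inv]
      norm_cast
    rw [evenSeq_succ_succ, map_sub, e3, hσ.map_pow_smul hq, hσ.map_mul, hσ.map_mul, ih1, ih2,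
      hσ.map_minorZ R hq, hσ.map_minorP R hq, e1, e2, smul_mul_assoc, mul_smul_comm,
      smul_mul_assoc, mul_smul_comm, R.minorZ_mul_evenSeq hq, R.minorP_mul_evenSeq hq]
    generalize q ^ (16 * n - 4 * n ^ 2 - 12 : ℤ) = c
    match_scalars <;> field_simp <;> ring

/-- Here σ exchanges the products with Z on the right and on the left. Both expand in the same two
elements, with powers of q that differ exactly as invariance requires. -/
theorem map_oddSeq (n : ℕ) :
    σ (oddSeq q u n) = q ^ (6 + 4 * n - 4 * n ^ 2 : ℤ) • oddSeq q u n := by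
  have h0 : σ (oddSeq q u 0) = q ^ 6 • oddSeq q u 0 := by
    rw [oddSeq_zero]; simpa using hσ.map_u 3
  induction n using Nat.twoStepInduction with
  | zero =>
    rw [h0, ← zpow_natCast]
    norm_num
  | one =>
    have h2 : σ (u 2) = q ^ 4 • u 2 := by simpa using hσ.map_u 2
    have h : oddSeq q u 1 = q ^ 1 • (oddSeq q u 0 * minorZ q u) - q ^ 3 • (minor₁ q u * u 2) := by
      rw [oddSeq_zero_mul_minorZ hq]; match_scalars <;> field_simp; ring
    have e : q ^ (6 + 4 * (1 : ℕ) - 4 * (1 : ℕ) ^ 2 : ℤ) = q ^ 6 := by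
      rw [← zpow_natCast]; norm_num
    rw [e]
    conv_lhs => rw [h]
    rw [map_sub, hσ.map_pow_smul hq, hσ.map_pow_smul hq, hσ.map_mul, hσ.map_mul, h0,
      hσ.map_minorZ R hq, hσ.map_minor₁ R hq, h2, smul_mul_assoc, mul_smul_comm, smul_mul_assoc,
      mul_smul_comm, R.minorZ_mul_oddSeq_zero hq, ← R.minor₁_mul_two hq]
    match_scalars <;> field_simp; ring
  | more n ih1 ih2 =>
    have e1 : q ^ (6 + 4 * (n + 1 : ℕ) - 4 * (n + 1 : ℕ) ^ 2 : ℤ) =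
        q ^ (6 + 4 * n - 4 * n ^ 2 : ℤ) * (q ^ (8 * n))⁻¹ := by
      rw [← zpow_natCast, ← zpow_neg, ← zpow_add₀ hq]
      congr 1; push_cast; ring
    have e2 : q ^ (6 + 4 * (n + 2 : ℕ) - 4 * (n + 2 : ℕ) ^ 2 : ℤ) =
        q ^ (6 + 4 * n - 4 * n ^ 2 : ℤ) * (q ^ (16 * n + 8))⁻¹ := by
      rw [← zpow_natCast, ← zpow_neg, ← zpow_add₀ hq]
      congr 1; push_cast; ring
    have h : oddSeq q u (n + 2) = q ^ (4 * n + 5) • (oddSeq q u (n + 1) * minorZ q u) -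
        q ^ (8 * n + 14) • (minorP q u * oddSeq q u n) := by
      rw [R.oddSeq_mul_minorZ hq]; match_scalars <;> field_simp <;> ring
    have h' : oddSeq q u n * minorP q u = q ^ 6 • (minorP q u * oddSeq q u n) := by
      rw [R.minorP_mul_oddSeq hq, smul_inv_smul₀ (pow_ne_zero 6 hq)]
    conv_lhs => rw [h]
    rw [map_sub, hσ.map_pow_smul hq, hσ.map_pow_smul hq, hσ.map_mul, hσ.map_mul, ih1, ih2,
      hσ.map_minorZ R hq, hσ.map_minorP R hq, e1, e2, smul_mul_assoc, mul_smul_comm,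
      smul_mul_assoc, mul_smul_comm, R.minorZ_mul_oddSeq hq, h']
    generalize q ^ (6 + 4 * n - 4 * n ^ 2 : ℤ) = c
    match_scalars <;> field_simp <;> ring

theorem isDualCanonicalElement_evenSeq (n : ℕ) :
    IsDualCanonicalElement q u σ (n, 0, 0, n) (evenSeq q u (n + 1)) := by
  refine ⟨qSpan_mono ?_ (R.evenSeq_sub_mem_and_oddSeq_sub_mem hq n).1, ?_⟩
  · rintro ⟨k, b⟩ ⟨⟨h1, h2, h3, h4, h5⟩, h6⟩
    dsimp only at h1 h2 h3 h4 h5 h6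
    refine And.intro ?_ (mem_idxAbove ?_ ?_ ?_ ?_ ?_) <;> dsimp only <;> omega
  · rw [hσ.map_evenSeq R hq]
    congr 2
    simp only [normN]; push_cast; ring

theorem isDualCanonicalElement_oddSeq (n : ℕ) :
    IsDualCanonicalElement q u σ (n + 1, 0, 0, n) (oddSeq q u n) := by
  refine ⟨qSpan_mono ?_ (R.evenSeq_sub_mem_and_oddSeq_sub_mem hq n).2, ?_⟩
  · rintro ⟨k, b⟩ ⟨⟨h1, h2, h3, h4, h5, h7⟩, h6⟩
    dsimp only at h1 h2 h3 h4 h5 h6 h7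
    -- Off the leading index the first entry is at most n. The equation for the third entry then
    -- forces the last entry below n, which makes the exponent of q strictly positive.
    refine And.intro ?_ (mem_idxAbove ?_ ?_ ?_ ?_ ?_) <;> dsimp only <;> omega
  · rw [hσ.map_oddSeq R hq]
    congr 2
    simp only [normN]; push_cast; ring

theorem isDualCanonicalElement_minorP_mul_evenSeq (n : ℕ) :
    IsDualCanonicalElement q u σ (n + 1, 1, 1, n + 1)
      (q ^ (8 * n + 6) • (minorP q u * evenSeq q u (n + 1))) := by
  refine ⟨R.smul_minorP_mul_evenSeq_sub_mem hq n, ?_⟩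
  rw [hσ.map_pow_smul hq, hσ.map_mul, hσ.map_evenSeq R hq, hσ.map_minorP R hq, smul_mul_assoc,
    mul_smul_comm, ← R.minorP_mul_evenSeq hq]
  simp only [smul_smul, ← zpow_natCast, ← zpow_neg, ← zpow_add₀ hq]
  congr 2
  simp only [normN]; push_cast; ring

theorem isDualCanonicalElement_minorP_mul_oddSeq (n : ℕ) :
    IsDualCanonicalElement q u σ (n + 2, 1, 1, n + 1)
      (q ^ (8 * n + 13) • (minorP q u * oddSeq q u n)) := by
  refine ⟨R.smul_minorP_mul_oddSeq_sub_mem hq n, ?_⟩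
  have h' : oddSeq q u n * minorP q u = q ^ 6 • (minorP q u * oddSeq q u n) := by
    rw [R.minorP_mul_oddSeq hq, smul_inv_smul₀ (pow_ne_zero 6 hq)]
  rw [hσ.map_pow_smul hq, hσ.map_mul, hσ.map_oddSeq R hq, hσ.map_minorP R hq, smul_mul_assoc,
    mul_smul_comm, h']
  simp only [smul_smul, ← zpow_natCast, ← zpow_neg, ← zpow_add₀ hq]
  congr 2
  simp only [normN]; push_cast; ring

theorem isDualCanonicalElement_minor₁_mul_two :
    IsDualCanonicalElement q u σ (1, 1, 1, 0) (q ^ 2 • (minor₁ q u * u 2)) := by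
  refine ⟨R.smul_minor₁_mul_two_sub_mem hq, ?_⟩
  have h2 : σ (u 2) = q ^ 4 • u 2 := by simpa using hσ.map_u 2
  rw [hσ.map_pow_smul hq, hσ.map_mul, hσ.map_minor₁ R hq, h2, smul_mul_assoc, mul_smul_comm,
    ← R.minor₁_mul_two hq]
  simp only [smul_smul, ← zpow_natCast, ← zpow_neg, ← zpow_add₀ hq]
  congr 2

end IsAnti

end SigmaInvariance

/-! ### The multiplication formulas -/

section Products

variable {K A : Type*} [Field K] [Ring A] [Algebra K A] {q : K} {u : Fin 4 → A}
  {σ : A →+ A} {B : Idx → A}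

namespace IsQuantumPBW

variable (H : IsQuantumPBW q u) (hσ : IsAnti q u σ)
  (hB : ∀ a, IsDualCanonicalElement q u σ a (B a))
include H hσ hB

theorem apply_even (n : ℕ) : B (n, 0, 0, n) = evenSeq q u (n + 1) :=
  H.eq_of_isDualCanonicalElement hσ hσ (hB _)
    (hσ.isDualCanonicalElement_evenSeq H.straightening H.ne_zero n)

theorem apply_odd (n : ℕ) : B (n + 1, 0, 0, n) = oddSeq q u n :=
  H.eq_of_isDualCanonicalElement hσ hσ (hB _)
    (hσ.isDualCanonicalElement_oddSeq H.straightening H.ne_zero n)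

theorem apply_one_zero_zero_one : B (1, 0, 0, 1) = minorZ q u := by
  rw [H.apply_even hσ hB 1]; simp [evenSeq]

theorem apply_minorP_even (n : ℕ) :
    B (n + 1, 1, 1, n + 1) = q ^ (8 * n + 6) • (minorP q u * evenSeq q u (n + 1)) :=
  H.eq_of_isDualCanonicalElement hσ hσ (hB _)
    (hσ.isDualCanonicalElement_minorP_mul_evenSeq H.straightening H.ne_zero n)

theorem apply_minorP_odd (n : ℕ) :
    B (n + 2, 1, 1, n + 1) = q ^ (8 * n + 13) • (minorP q u * oddSeq q u n) :=
  H.eq_of_isDualCanonicalElement hσ hσ (hB _)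
    (hσ.isDualCanonicalElement_minorP_mul_oddSeq H.straightening H.ne_zero n)

theorem apply_one_one_one_zero : B (1, 1, 1, 0) = q ^ 2 • (minor₁ q u * u 2) :=
  H.eq_of_isDualCanonicalElement hσ hσ (hB _)
    (hσ.isDualCanonicalElement_minor₁_mul_two H.straightening H.ne_zero)

theorem odd_mul (n : ℕ) : B (n + 1, 0, 0, n) * B (1, 0, 0, 1) =
    q ^ (3 - 4 * ((n + 1 : ℕ) : ℤ)) • B (n + 2, 0, 0, n + 1) +
      q ^ (4 - 4 * ((n + 1 : ℕ) : ℤ)) • B (n + 1, 1, 1, n) := by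
  have hq := H.ne_zero
  rw [H.apply_one_zero_zero_one hσ hB, H.apply_odd hσ hB, H.apply_odd hσ hB]
  -- For n = 0 the second basis element comes from `minor₁` and `u 2` instead of P times an odd
  -- element.
  cases n with
  | zero =>
    rw [H.apply_one_one_one_zero hσ hB, oddSeq_zero_mul_minorZ hq]
    simp
  | succ n =>
    rw [H.apply_minorP_odd hσ hB, H.straightening.oddSeq_mul_minorZ hq]
    simp only [smul_smul, ← zpow_natCast, ← zpow_neg, ← zpow_add₀ hq]
    congr 3 <;> push_cast <;> ring

theorem mul_odd (n : ℕ) : B (1, 0, 0, 1) * B (n + 1, 0, 0, n) =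
    q ^ (1 - 4 * ((n + 1 : ℕ) : ℤ)) • B (n + 2, 0, 0, n + 1) +
      q ^ (-4 * ((n + 1 : ℕ) : ℤ)) • B (n + 1, 1, 1, n) := by
  have hq := H.ne_zero
  rw [H.apply_one_zero_zero_one hσ hB, H.apply_odd hσ hB, H.apply_odd hσ hB]
  cases n with
  | zero =>
    rw [H.apply_one_one_one_zero hσ hB, H.straightening.minorZ_mul_oddSeq_zero hq]
    simp only [smul_smul, ← zpow_natCast, ← zpow_neg, ← zpow_add₀ hq]
    congr 3
  | succ n =>
    rw [H.apply_minorP_odd hσ hB, H.straightening.minorZ_mul_oddSeq hq]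
    simp only [smul_smul, ← zpow_natCast, ← zpow_neg, ← zpow_add₀ hq]
    congr 3 <;> push_cast <;> ring

theorem even_mul (n : ℕ) : B (n + 1, 0, 0, n + 1) * B (1, 0, 0, 1) =
    q ^ (-4 * ((n + 1 : ℕ) : ℤ)) • B (n + 2, 0, 0, n + 2) +
      q ^ (-4 * ((n + 1 : ℕ) : ℤ)) • B (n + 1, 1, 1, n + 1) := by
  have hq := H.ne_zero
  rw [H.apply_one_zero_zero_one hσ hB, H.apply_even hσ hB, H.apply_even hσ hB,
    H.apply_minorP_even hσ hB, evenSeq_mul_minorZ hq]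
  simp only [smul_smul, ← zpow_natCast, ← zpow_neg, ← zpow_add₀ hq]
  congr 3 <;> push_cast <;> ring

theorem mul_even (n : ℕ) : B (1, 0, 0, 1) * B (n, 0, 0, n) = B (n, 0, 0, n) * B (1, 0, 0, 1) := by
  rw [H.apply_one_zero_zero_one hσ hB, H.apply_even hσ hB,
    H.straightening.minorZ_mul_evenSeq H.ne_zero]

/-- The product has nonzero coefficients at two different basis elements. -/
theorem even_mul_ne (n : ℕ) (c : K) (a : Idx) :
    B (n + 1, 0, 0, n + 1) * B (1, 0, 0, 1) ≠ c • B a := fun h => by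
  have hq := H.ne_zero
  rw [H.even_mul hσ hB] at h
  have hli := H.linearIndependent_of_isDualCanonicalElement hB
  rw [linearIndependent_iff] at hli
  have h' := hli (Finsupp.single (n + 2, 0, 0, n + 2) (q ^ (-4 * ((n + 1 : ℕ) : ℤ))) +
    Finsupp.single (n + 1, 1, 1, n + 1) (q ^ (-4 * ((n + 1 : ℕ) : ℤ))) - Finsupp.single a c) (by
      simp only [map_sub, map_add, Finsupp.linearCombination_single, h, sub_self])
  have h1 := DFunLike.congr_fun h' (n + 2, 0, 0, n + 2)
  have h2 := DFunLike.congr_fun h' (n + 1, 1, 1, n + 1)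
  have hz : q ^ (-4 * ((n + 1 : ℕ) : ℤ)) ≠ 0 := zpow_ne_zero _ hq
  simp only [Finsupp.sub_apply, Finsupp.add_apply, Finsupp.single_apply, Finsupp.zero_apply,
    Prod.mk.injEq] at h1 h2
  by_cases ha : a = (n + 2, 0, 0, n + 2)
  · subst ha
    simp at h2
    exact hz (by simpa using h2)
  · simp [ha] at h1
    exact hz (by simpa using h1)

end IsQuantumPBW

end Products

end KroneckerQuantum

open KroneckerQuantum in
theorem corollary4p4 :
    (∃! B : Module.Basis Idx Kq UqPlus, IsDualCanonicalBasis B) ∧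
    ∀ B : Module.Basis Idx Kq UqPlus, IsDualCanonicalBasis B →
      (∀ n : ℕ, 1 ≤ n →
        B (n, 0, 0, n - 1) * B (1, 0, 0, 1) =
            q ^ (3 - 4 * (n : ℤ)) • B (n + 1, 0, 0, n) +
            q ^ (4 - 4 * (n : ℤ)) • B (n, 1, 1, n - 1) ∧
        B (1, 0, 0, 1) * B (n, 0, 0, n - 1) =
            q ^ (1 - 4 * (n : ℤ)) • B (n + 1, 0, 0, n) +
            q ^ (-4 * (n : ℤ)) • B (n, 1, 1, n - 1) ∧
        B (n, 0, 0, n) * B (1, 0, 0, 1) =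
            q ^ (-4 * (n : ℤ)) • B (n + 1, 0, 0, n + 1) +
            q ^ (-4 * (n : ℤ)) • B (n, 1, 1, n) ∧
        B (1, 0, 0, 1) * B (n, 0, 0, n) =
            q ^ (-4 * (n : ℤ)) • B (n + 1, 0, 0, n + 1) +
            q ^ (-4 * (n : ℤ)) • B (n, 1, 1, n)) ∧
      (∀ n : ℕ, 1 ≤ n →
        QCommute (B (n, 0, 0, n)) (B (1, 0, 0, 1)) ∧
        (¬ ∃ (s : ℤ) (a : Idx), B (n, 0, 0, n) * B (1, 0, 0, 1) = q ^ s • B a) ∧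
        IsBZCounterexample B (B (n, 0, 0, n)) (B (1, 0, 0, 1))) ∧
      {p : UqPlus × UqPlus | IsBZCounterexample B p.1 p.2}.Infinite := by
  refine ⟨existsUnique_isDualCanonicalBasis, fun B hB => ?_⟩
  obtain ⟨σ, hσ', hB⟩ := (isDualCanonicalBasis_iff B).1 hB
  have hσ := isAnti_antiMap hσ'
  have H := isQuantumPBW_u
  have hcomm : ∀ n, QCommute (B (n, 0, 0, n)) (B (1, 0, 0, 1)) := fun n =>
    -- The two elements commute exactly, so the exponent is zero.
    ⟨0, by rw [zpow_zero, one_smul]; exact (H.mul_even hσ hB n).symm⟩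
  have hne : ∀ n, ¬ ∃ (s : ℤ) (a : Idx),
      B (n + 1, 0, 0, n + 1) * B (1, 0, 0, 1) = q ^ s • B a := fun n ⟨_, a, h⟩ =>
    H.even_mul_ne hσ hB n _ a h
  have hBZ : ∀ n, IsBZCounterexample B (B (n + 1, 0, 0, n + 1)) (B (1, 0, 0, 1)) := fun n =>
    ⟨⟨_, rfl⟩, ⟨_, rfl⟩, fun h => hne n (h.2 (hcomm (n + 1)))⟩
  refine ⟨fun n hn => ?_, fun n hn => ?_, ?_⟩
  · obtain ⟨n, rfl⟩ := Nat.exists_eq_add_of_le' hn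
    exact ⟨H.odd_mul hσ hB n, H.mul_odd hσ hB n, H.even_mul hσ hB n,
      (H.mul_even hσ hB (n + 1)).trans (H.even_mul hσ hB n)⟩
  · obtain ⟨n, rfl⟩ := Nat.exists_eq_add_of_le' hn
    exact ⟨hcomm _, hne n, hBZ n⟩
  -- Distinct indices give distinct first components, as a basis is injective.
  · refine Set.infinite_of_injective_forall_mem
      (f := fun n : ℕ => (B (n + 1, 0, 0, n + 1), B (1, 0, 0, 1))) (fun m n h => ?_) hBZ
    have h1 := B.injective (congrArg Prod.fst h)
    simpa using congrArg Prod.fst h1
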